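/- **Setting.** Let $\beta,a,\nu\ge 1$ be integers with $\beta a\nu=256$, put $d=\beta a$ (so $\nu=256/d$), let $q$ be a prime, $R_q=\mathbb Z_q[X]/(X^d+1)$, $\sigma_{-1}:X\mapsto X^{-1}$, and let $\kappa,\lambda\ge 0$, $\omega\ge 1$, $n_1=\kappa+\lambda+3+\beta$, $n_3=\kappa+\lambda+3$. ($64$-bit assets: $\beta=64$.) Norms are computed on centred representatives mod $q$. Let $\chi$ be a distribution on $\{-1,0,1\}$ and let the challenge $c$ be drawn from a distribution $\mathcal C$ on elements of $R_q$ with $\sigma_{-1}(c)=c$ and $\|c\|_1\le\omega$. Put $$\mathfrak s_1=11\omega\sqrt{n_1d},\quad \mathfrak s_2=11\sqrt{337\,\beta d},\quad \mathfrak s_3=11\omega\sqrt{n_3d},$$ $$B_1=\mathfrak s_1\sqrt{2n_1d},\quad B_2=1.64\,\mathfrak s_2\sqrt{256},\quad B_3=\mathfrak s_3\sqrt{2n_3d},$$ and assume $d\cdot 2B_2(2B_2+1)<q$. $D_{\mathfrak s}$ is the discrete Gaussian on $\mathbb Z$; $\mathrm{Bin}_1$ takes the values $-1,0,1$ with probabilities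 $\frac14,\frac12,\frac14$; $\mathrm{Rej}(z,v,\mathfrak s)$ accepts with probability $\min\{1,\frac13\exp(\frac{-2\langle z,v\rangle+\|v\|^2}{2\mathfrak s^2})\}$. **Statement proved.** Public: $A\in R_q^{\kappa\times n_3}$, rows $\mathbf b_1,\mathbf b_2,\mathbf b_3\in R_q^{n_3}$ (write $B=\mathbf b_3$), a commitment $com_0=A\mathbf r$, $com_k=\langle\mathbf b_k,\mathbf r\rangle+m_k$ ($k=1,2,3$), and an auxiliary key with rows $A_a$ ($\kappa$ rows), $B_{y_2}$ ($256/d$ rows), $B_g$, $B_{bin_\alpha}$ ($\alpha\in[\beta]$), $B_{g_1}$ in $R_q^{n_1}$. The prover claims that all $d$ coefficients (assets) of $v=m_3$ are integers in $[0,2^\beta)$. An honest witness is an opening $(\mathbf r,m)$ with this property and $\|\mathbf r\|\le\sqrt{n_3d}$. **Protocol $\pi^{A'}$.** Let $v_{bin_\alpha}\in R_q$ have as coefficient vector the concatenated $\beta$-bit expansions of the coefficients number $(\alpha-1)a+1,\dots,\alpha a$ of $v$. For scalars $d_j$ ($j\in[256]$), $d'_\alpha$ ($\alpha\in[\beta]$),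 $d''_j$ ($j\in[d]$) and a $256\times\beta d$ matrix $R$ with rows $\mathbf r_j\in R_q^\beta$, unit vectors $\mathbf e_j\in R_q^{256/d}$, put $$L(b,y,v)=\sum_j d_j\big(\sigma_{-1}(\mathbf r_j)^Tb+\sigma_{-1}(\mathbf e_j)^Ty\big)+\sum_\alpha d'_\alpha\,\sigma_{-1}(-\mathbf 1)\,b_\alpha+\sum_{j=1}^d d''_j\big(\sigma_{-1}(\hat\beta_{k(j)})\,b_{\alpha(j)}-\sigma_{-1}(X^{j-1})v\big),$$ $$Q(b,b')=\sum_\alpha d'_\alpha\sigma_{-1}(b_\alpha)b'_\alpha,\qquad E(z_2)=\sum_jd_j\,\sigma_{-1}(\mathbf e_j)^Tz_2,$$ where $-\mathbf 1$ has all coefficients $-1$, $\hat\beta_k=\sum_{i<\beta}2^iX^{i+(k-1)\beta}$, and $j=(\alpha(j)-1)a+k(j)$ with $1\le k(j)\le a$. 1. The prover samples $g$ uniform with zero constant coefficient, $s\leftarrow\chi^{n_1d}$, $y_1\leftarrow D_{\mathfrak s_1}^{n_1d}$, $y_2\leftarrow D_{\mathfrak s_2}^{256}$, $y_3\leftarrow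 D_{\mathfrak s_3}^{n_3d}$ and sends $u_0=A_as$, $u_{y_2}=B_{y_2}s+y_2$, $u_g=B_gs+g$, $u_{bin_\alpha}=B_{bin_\alpha}s+v_{bin_\alpha}$. The verifier sends $R\leftarrow\mathrm{Bin}_1^{256\times\beta d}$. 2. The prover sends $z_2=y_2+R\,l$ with $l$ the coefficient vector of $v_{bin}$ (and $\mathrm{Rej}(z_2,Rl,\mathfrak s_2)$). The verifier sends uniform $d_j,d'_\alpha,d''_j\in\mathbb Z_q$. 3. With $x=L(v_{bin},y_2,v)+Q(v_{bin},v_{bin})-E(z_2)$, $y_{bin}=-B_{bin}y_1$, $y_{y_2}=-B_{y_2}y_1$, $y_g=-B_gy_1$, $y_v=-By_3$, $g_1=L(y_{bin},y_{y_2},y_v)+Q(v_{bin},y_{bin})+Q(y_{bin},v_{bin})+y_g$, the prover sends $h=g+x$, $w_1=A_ay_1$, $w_2=Ay_3$, $\mathbf v=Q(y_{bin},y_{bin})+B_{g_1}y_1$, $u_{g_1}=B_{g_1}s+g_1$. The verifier sends $c\leftarrow\mathcal C$. 4. The prover sends $z_1=y_1+cs$, $z_3=y_3+c\mathbf r$ (and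 $\mathrm{Rej}(z_1,cs,\mathfrak s_1)$, $\mathrm{Rej}(z_3,c\mathbf r,\mathfrak s_3)$). 5. With $z_{bin}=cu_{bin}-B_{bin}z_1$, $z_g=cu_g-B_gz_1$, $z_{y_2}=cu_{y_2}-B_{y_2}z_1$, $z_v=c\,com_3-Bz_3$, $f=cu_{g_1}-B_{g_1}z_1$, the verifier accepts iff $\|z_1\|\le B_1$, $\|z_3\|\le B_3$, $\|z_2\|\le B_2$, $h$ has zero constant coefficient, $A_az_1=w_1+cu_0$, $Az_3=w_2+c\,com_0$, and $$\mathbf v=Q(z_{bin},z_{bin})+c\,L(z_{bin},z_{y_2},z_v)+c\,z_g-c^2\big(h+E(z_2)\big)-f .$$ **Theorem.** There are universal constants $C,k,D\in\mathbb N$ such that for all parameters as above, with $N=n_1+d+256$, the protocol $\pi^{A'}$ is complete, knowledge sound and honest-verifier zero-knowledge in the following concrete sense. (Procedures are probabilistic nonadaptive programs over $R_q$, which may sample from the distributions of the protocol; size counts coins, oracle calls and ring operations.) * *Completeness.* For all keys and every honest witness, the honest prover does not abort with probability at least $(1-2^{-100})/27$, and conditioned on not aborting it is accepted with probability at least $1-2^{-n_1d/8}-2^{-n_3d/8}-2^{-100}$.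 * *Knowledge soundness* with knowledge error $\epsilon=2\delta+\frac1q+2^{-256}$, where $\delta=\max_{c}\Pr_{c'\leftarrow\mathcal C}[c-c'\text{ is not invertible}]$ over $c$ in the support of $\mathcal C$. There is an extractor of size at most $CN^k$, with resettable black-box access to the prover, such that for all keys and commitments and every (unbounded, randomised) prover convincing the verifier with probability $\varepsilon>\epsilon$, with probability at least $(\varepsilon-\epsilon)^D/(CN^k)$ it outputs either a witness $(\bar c,\mathbf r^*,m^*)$ with $\bar c$ invertible, $\|\bar c\|_1\le2\omega$, $\|\bar c\,\mathbf r^*\|\le 2B_3$, $com=\mathrm{Com}(m^*,\mathbf r^*)$ and all coefficients of $m_3^*$ integers in $[0,2^\beta)$, or a break of binding: a nonzero $z$ with $A_az=0$, $\|z\|\le8\omega B_1$, or a nonzero $z$ with $Az=0$, $\|z\|\le 8\omega B_3$ (a Module-SIS solution). * *Computational honest-verifier zero-knowledge.* There are a simulator, which gets only the public inputs, and a reduction, both of size at most $CN^k$, such that for all $A,\mathbf b_k,com$, every honest witness, and every distinguisher $\mathcal D$ with values in $[0,1]$: for a uniformly random auxiliary key, the advantage of $\mathcal D$ between honest transcripts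 conditioned on not aborting and simulated transcripts is at most $2^{-100}$ plus the advantage, in the knapsack Module-LWE problem (distinguish $(M,Ms)$ from $(M,u)$, with $M$ uniform with $\kappa+256/d+\beta+2$ rows and $n_1$ columns, $s\leftarrow\chi^{n_1d}$, $u$ uniform), of the adversary that turns its sample into a transcript with the reduction and then runs $\mathcal D$ once. -/

import Mathlib

open Polynomial
open scoped ENNReal BigOperators

noncomputable section

namespace PoA

/-! ### Discrete probability -/

/-- Probability of an event. -/
def Pr {α : Type} (p : PMF α) (E : Set α) : ℝ := (p.toOuterMeasure E).toReal

/-- Expectation of a (bounded) real function. -/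
def expect {α : Type} (p : PMF α) (f : α → ℝ) : ℝ := ∑' x, (p x).toReal * f x

theorem tsum_pi_fin {α : Type} : ∀ (n : ℕ) (p : Fin n → PMF α),
    ∑' f : Fin n → α, ∏ i, p i (f i) = 1 := by
  intro n
  induction n with
  | zero => intro p; simp
  | succ n ih =>
    intro p
    rw [← (Fin.consEquiv (fun _ : Fin (n + 1) => α)).tsum_eq]
    rw [ENNReal.tsum_prod']
    simp only [Fin.consEquiv_apply, Fin.prod_univ_succ, Fin.cons_zero, Fin.cons_succ]
    simp only [ENNReal.tsum_mul_left]
    simp [ih (fun i => p i.succ), PMF.tsum_coe]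

theorem tsum_pi {ι α : Type} [Fintype ι] (p : ι → PMF α) :
    ∑' f : ι → α, ∏ i, p i (f i) = 1 := by
  have e := Fintype.equivFin ι
  rw [← tsum_pi_fin (Fintype.card ι) (fun k => p (e.symm k)),
    ← (Equiv.arrowCongr e (Equiv.refl α)).tsum_eq]
  refine tsum_congr fun f => ?_
  rw [← e.prod_comp]
  simp [Equiv.arrowCongr]

/-- Independent product of finitely many discrete distributions. -/
def piPMF {ι α : Type} [Fintype ι] (p : ι → PMF α) : PMF (ι → α) :=
  ⟨fun f => ∏ i, p i (f i), by rw [← tsum_pi p]; exact ENNReal.summable.hasSum⟩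

/-- Biased coin: `true` with probability `p`. -/
def coinPMF (p : ℝ≥0∞) (h : p ≤ 1) : PMF Bool :=
  PMF.ofFintype (fun b => cond b p (1 - p)) (by simp [h])

/-- Unnormalised weight `exp (-z² / (2 s²))`. -/
def gaussWeight (s : ℝ) (z : ℤ) : ℝ≥0∞ := ENNReal.ofReal (Real.exp (-(z : ℝ) ^ 2 / (2 * s ^ 2)))

theorem summable_gauss {s : ℝ} (hs : 0 < s) :
    Summable fun z : ℤ => Real.exp (-(z : ℝ) ^ 2 / (2 * s ^ 2)) := by
  have key : Summable fun n : ℕ => Real.exp (-(n : ℝ) ^ 2 / (2 * s ^ 2)) := by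
    have h1 : Summable fun n : ℕ => Real.exp ((n : ℝ) * (-(1 / (2 * s ^ 2)))) :=
      Real.summable_exp_nat_mul_iff.mpr (by
        have : (0 : ℝ) < 1 / (2 * s ^ 2) := by positivity
        linarith)
    refine Summable.of_nonneg_of_le (fun _ => (Real.exp_pos _).le) (fun n => ?_) h1
    refine Real.exp_le_exp.mpr ?_
    have h2 : (n : ℝ) ≤ (n : ℝ) ^ 2 := by
      have : n ≤ n ^ 2 := Nat.le_self_pow (by norm_num) n
      exact_mod_cast this
    have h3 : (n : ℝ) * (-(1 / (2 * s ^ 2))) = -(n : ℝ) / (2 * s ^ 2) := by ring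
    rw [h3]
    gcongr
  refine Summable.of_nat_of_neg ?_ ?_
  · simpa using key
  · simpa using key

/-- One-dimensional discrete Gaussian on `ℤ` with parameter `s` (used with `0 < s` only). -/
def gaussPMF (s : ℝ) : PMF ℤ :=
  if hs : 0 < s then
    PMF.normalize (gaussWeight s)
      (fun h => by
        have := (ENNReal.tsum_eq_zero.mp h) 0
        simp [gaussWeight] at this)
      (by
        have := (summable_gauss hs).tsum_ofReal_ne_top
        exact this)
  else PMF.pure 0

/-- `Bin₁`: the difference of two fair bits, i.e. `-1, 0, 1` with probabilities `1/4, 1/2, 1/4`. -/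
def binPMF : PMF ℤ := do
  let x ← PMF.uniformOfFintype (Fin 2)
  let y ← PMF.uniformOfFintype (Fin 2)
  pure ((x.val : ℤ) - (y.val : ℤ))

/-- Rejection step with repetition rate `M = 3`: accept (`true`) the masked vector `z` with
probability `min 1 (exp ((-2⟨z,v⟩ + ‖v‖²) / (2 s²)) / M)`. -/
def rej {m n : ℕ} (s : ℝ) (z v : Fin m → Fin n → ℤ) : PMF Bool :=
  coinPMF (min 1 (ENNReal.ofReal (1 / 3 * Real.exp
    ((-2 * (∑ i, ∑ k, (z i k : ℝ) * (v i k : ℝ)) + ∑ i, ∑ k, (v i k : ℝ) ^ 2) / (2 * s ^ 2)))))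
    (min_le_left _ _)

/-! ### Parameters and the ring -/

/-- `q` modulus; `β` bit length of an asset; `a = d / β` assets per binary polynomial;
`ν = 256 / d`; `κ, lam` module ranks; `ω` bound on the `ℓ₁`-norm of challenges. -/
structure Params where
  q : ℕ
  a : ℕ
  β : ℕ
  ν : ℕ
  κ : ℕ
  lam : ℕ
  ω : ℕ
  prime : q.Prime
  dims : β * a * ν = 256
  ω_pos : 0 < ω

namespace Params

variable (P : Params)

/-- Ring dimension, equal to the number of assets. -/
abbrev d : ℕ := P.β * P.a

/-- Length of the randomness of the input commitment. -/
abbrev n₃ : ℕ := P.κ + P.lam + 3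

/-- Length of the randomness of the auxiliary commitment. -/
abbrev n₁ : ℕ := P.κ + P.lam + 3 + P.β

/-- `R_q = ℤ_q[X] / (X^d + 1)`. -/
abbrev R : Type := AdjoinRoot (X ^ P.d + 1 : (ZMod P.q)[X])

theorem d_ne_zero : P.d ≠ 0 := by
  intro h
  have := P.dims
  rw [show P.β * P.a = 0 from h] at this
  simp at this

theorem monic : (X ^ P.d + 1 : (ZMod P.q)[X]).Monic := by
  simpa using monic_X_pow_add_C (1 : ZMod P.q) P.d_ne_zero

instance : NeZero P.q := ⟨P.prime.ne_zero⟩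

/-- Standard deviation for `y₁`. -/
def s₁ : ℝ := 11 * P.ω * √(P.n₁ * P.d)

/-- Standard deviation for `y₂`. -/
def s₂ : ℝ := 11 * √(337 * (P.β * P.d))

/-- Standard deviation for `y₃`. -/
def s₃ : ℝ := 11 * P.ω * √(P.n₃ * P.d)

/-- Verifier's bound on `‖z₁‖`. -/
def bound₁ : ℝ := P.s₁ * √(2 * (P.n₁ * P.d))

/-- Verifier's bound on `‖z₂‖`. -/
def bound₂ : ℝ := 1.64 * P.s₂ * √256

/-- Verifier's bound on `‖z₃‖`. -/
def bound₃ : ℝ := P.s₃ * √(2 * (P.n₃ * P.d))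

/-- The modulus is large enough that `∑ x (x - 1)`, over `d` integers `x` of size at most
twice the bound on `z₂`, does not wrap around. -/
def NoWrap : Prop := (P.d : ℝ) * (2 * P.bound₂) * (2 * P.bound₂ + 1) < P.q

/-- Size measure for running times. -/
def len : ℕ := P.n₁ + P.d + 256

end Params

section Ring

variable {P : Params}

/-- `i`-th coefficient of the representative of degree `< d`. -/
def coeff (x : P.R) (i : ℕ) : ZMod P.q := (AdjoinRoot.modByMonicHom P.monic x).coeff i

/-- Scalars. -/
def scal (c : ZMod P.q) : P.R := AdjoinRoot.of _ c

/-- The class of `X`. -/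
def Xbar : P.R := AdjoinRoot.root _

/-- Polynomial with given coefficients. -/
def ofCoeffs (f : Fin P.d → ZMod P.q) : P.R := ∑ i : Fin P.d, scal (f i) * Xbar ^ (i : ℕ)

/-- Reduction mod `q` of an integer coefficient vector. -/
def red (f : Fin P.d → ℤ) : P.R := ofCoeffs fun i => (f i : ZMod P.q)

/-- Centred integer representatives of the coefficients. -/
def lift (x : P.R) : Fin P.d → ℤ := fun i => (coeff x i).valMinAbs

/-- The automorphism `σ₋₁ : X ↦ X⁻¹ = -X^(d-1)`. -/
def conj (x : P.R) : P.R := ∑ i : Fin P.d, scal (coeff x i) * (-Xbar ^ (P.d - 1)) ^ (i : ℕ)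

/-- Euclidean norm of a vector over `R_q`. -/
def nrm {ι : Type} [Fintype ι] (x : ι → P.R) : ℝ := √(∑ i, ∑ k, (lift (x i) k : ℝ) ^ 2)

/-- `ℓ₁`-norm of a ring element. -/
def nrm1 (x : P.R) : ℝ := ∑ k, |(lift x k : ℝ)|

/-- Inner product of the coefficient vectors of two vectors over `R_q`. -/
def ip {ι : Type} [Fintype ι] (x y : ι → P.R) : ZMod P.q :=
  ∑ i, ∑ k : Fin P.d, coeff (x i) k * coeff (y i) k

end Ring

/-! ### Index types of public inputs and messages

All public inputs, messages and challenges are families of elements of `R_q`. -/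

/-- Entries of `ctk = (A, pk₁, pk₂, B)` (the last three are the rows `b 0, b 1, b 2`) and of
the commitment `com = (com₀, com₁, com₂, com₃)`. -/
inductive StmtIdx (P : Params) : Type
  | A (i : Fin P.κ) (j : Fin P.n₃)
  | b (k : Fin 3) (j : Fin P.n₃)
  | com₀ (i : Fin P.κ)
  | com (k : Fin 3)

/-- Rows of the auxiliary commitment key `(A_a, B_{y₂}, B_g, B_bin, B_{g₁})`. -/
inductive Row (P : Params) : Type
  | a (i : Fin P.κ)
  | y₂ (b : Fin P.ν)
  | g
  | bin (α : Fin P.β)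
  | g₁
  deriving Fintype

/-- Auxiliary commitment keys. -/
abbrev AuxKey (P : Params) : Type := Row P → Fin P.n₁ → P.R

/-- Verifier's challenges. The `256` rows of the matrix `R` are indexed by
`Fin (256 / d) × Fin d`; `R j α` is the `α`-th polynomial of row `j`. The scalars
`dy, dbin, dval` are the `d_j, d'_j, d''_j`. -/
inductive ChalIdx (P : Params) : Type
  | R (j : Fin P.ν × Fin P.d) (α : Fin P.β)
  | dy (j : Fin P.ν × Fin P.d)
  | dbin (α : Fin P.β)
  | dval (j : Fin P.d)
  | c
  deriving Fintype

/-- Prover's messages. -/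
inductive RespIdx (P : Params) : Type
  | u₀ (i : Fin P.κ)
  | uy₂ (b : Fin P.ν)
  | ug
  | ubin (α : Fin P.β)
  | z₂ (b : Fin P.ν)
  | h
  | w₁ (i : Fin P.κ)
  | w₂ (i : Fin P.κ)
  | v
  | ug₁
  | z₁ (j : Fin P.n₁)
  | z₃ (j : Fin P.n₃)
  deriving Fintype

/-- The round in which the verifier sends a challenge. -/
def ChalIdx.round {P : Params} : ChalIdx P → ℕ
  | .R _ _ => 1
  | .dy _ => 2
  | .dbin _ => 2
  | .dval _ => 2
  | .c => 3

/-- The round in which the prover sends a message; the `k`-th prover message precedes the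
`k`-th challenge. -/
def RespIdx.round {P : Params} : RespIdx P → ℕ
  | .u₀ _ => 1
  | .uy₂ _ => 1
  | .ug => 1
  | .ubin _ => 1
  | .z₂ _ => 2
  | .h => 3
  | .w₁ _ => 3
  | .w₂ _ => 3
  | .v => 3
  | .ug₁ => 3
  | .z₁ _ => 4
  | .z₃ _ => 4

abbrev Stmt (P : Params) : Type := StmtIdx P → P.R
abbrev Challenges (P : Params) : Type := ChalIdx P → P.R
abbrev Replies (P : Params) : Type := RespIdx P → P.R

structure Transcript (P : Params) where
  chal : Challenges P
  resp : Replies P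

/-! ### Distributions -/

/-- The distribution `χ` over `{-1, 0, 1}` and the challenge distribution, which is carried by
elements stable under `σ₋₁` of `ℓ₁`-norm at most `ω`. -/
structure Setup (P : Params) where
  χ : PMF ℤ
  χ_supp : ∀ z ∈ χ.support, z = -1 ∨ z = 0 ∨ z = 1
  C : PMF P.R
  C_conj : ∀ c ∈ C.support, conj c = c
  C_norm : ∀ c ∈ C.support, nrm1 c ≤ P.ω

variable {P : Params}

/-- Uniform element of `R_q`. -/
def unifPMF (P : Params) : PMF P.R := (PMF.uniformOfFintype (Fin P.d → ZMod P.q)).map ofCoeffs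

/-- Uniform scalar. -/
def scalPMF (P : Params) : PMF P.R := (PMF.uniformOfFintype (ZMod P.q)).map scal

/-- Polynomial with i.i.d. integer coefficients. -/
def polyPMF (p : PMF ℤ) : PMF P.R := (piPMF fun _ : Fin P.d => p).map red

/-- Vector of integer coefficient vectors with i.i.d. discrete Gaussian entries. -/
def gaussVec (P : Params) (s : ℝ) (n : ℕ) : PMF (Fin n → Fin P.d → ℤ) :=
  piPMF fun _ => piPMF fun _ => gaussPMF s

/-- The verifier's public coins. -/
def Setup.challenges (S : Setup P) : PMF (Challenges P) :=
  piPMF fun i => match i with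
    | .R _ _ => polyPMF binPMF
    | .dy _ => scalPMF P
    | .dbin _ => scalPMF P
    | .dval _ => scalPMF P
    | .c => S.C

/-- Uniform auxiliary commitment key. -/
def auxPMF (P : Params) : PMF (AuxKey P) := piPMF fun _ => piPMF fun _ => unifPMF P

/-! ### The protocol -/

/-- `e_j`: the unit coefficient vector at position `j` among `256 = ν d` coordinates. -/
def unitVec (j : Fin P.ν × Fin P.d) (b : Fin P.ν) : P.R :=
  if b = j.1 then Xbar ^ (j.2 : ℕ) else 0

/-- `pow(2^β - 1, kβ)`: the powers of two placed at coefficients `kβ, …, kβ + β - 1`. -/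
def powPoly (P : Params) (k : ℕ) : P.R :=
  ∑ i ∈ Finset.range P.β, (2 : P.R) ^ i * Xbar ^ (i + k * P.β)

/-- The polynomial all of whose coefficients are `-1`. -/
def negOnes (P : Params) : P.R := -∑ i ∈ Finset.range P.d, Xbar ^ i

/-- `v_{bin_α}`: the concatenated `β`-bit expansions of coefficients `αa, …, αa + a - 1` of `v`. -/
def binPoly (v : P.R) (α : Fin P.β) : P.R :=
  ofCoeffs fun t =>
    if (coeff v ((α : ℕ) * P.a + (t : ℕ) / P.β)).val.testBit ((t : ℕ) % P.β) then 1 else 0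

/-- Part of the relation that is linear in `(v_bin, y₂, v)`. -/
def lin (e : Challenges P) (vb : Fin P.β → P.R) (y : Fin P.ν → P.R) (v : P.R) : P.R :=
  ∑ j, e (.dy j) * (∑ α, conj (e (.R j α)) * vb α + ∑ b, conj (unitVec j b) * y b)
  + ∑ α, e (.dbin α) * (conj (negOnes P) * vb α)
  + ∑ j : Fin P.d, e (.dval j) *
      (conj (powPoly P (j.modNat : Fin P.a)) * vb j.divNat - conj (Xbar ^ (j : ℕ)) * v)

/-- Part of the relation that is quadratic in `v_bin`. -/
def quad (e : Challenges P) (x y : Fin P.β → P.R) : P.R :=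
  ∑ α, e (.dbin α) * (conj (x α) * y α)

/-- Constant part of the relation, depending on `z₂`. -/
def cst (e : Challenges P) (z : Fin P.ν → P.R) : P.R :=
  ∑ j, e (.dy j) * ∑ b, conj (unitVec j b) * z b

/-- The verifier's checks. -/
def Accepts (x : Stmt P) (K : AuxKey P) (t : Transcript P) : Prop :=
  let e := t.chal
  let m := t.resp
  let c := e .c
  let z₁ := fun j => m (.z₁ j)
  let z₂ := fun b => m (.z₂ b)
  let z₃ := fun j => m (.z₃ j)
  let zbin := fun α => c * m (.ubin α) - K (.bin α) ⬝ᵥ z₁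
  let zg := c * m .ug - K .g ⬝ᵥ z₁
  let zy₂ := fun b => c * m (.uy₂ b) - K (.y₂ b) ⬝ᵥ z₁
  let zv := c * x (.com 2) - (fun j => x (.b 2 j)) ⬝ᵥ z₃
  let f := c * m .ug₁ - K .g₁ ⬝ᵥ z₁
  (nrm z₁ ≤ P.bound₁ ∧ nrm z₃ ≤ P.bound₃) ∧
  nrm z₂ ≤ P.bound₂ ∧
  coeff (m .h) 0 = 0 ∧
  ((∀ i, K (.a i) ⬝ᵥ z₁ = m (.w₁ i) + c * m (.u₀ i)) ∧
    ∀ i, (fun j => x (.A i j)) ⬝ᵥ z₃ = m (.w₂ i) + c * x (.com₀ i)) ∧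
  m .v = quad e zbin zbin + c * lin e zbin zy₂ zv + c * zg
    - c ^ 2 * (m .h + cst e z₂) - f

/-- The vector `R l ∈ ℤ_q^256`, arranged as `256 / d` blocks of `d` centred integers. -/
def imageR (e : Challenges P) (vb : Fin P.β → P.R) : Fin P.ν → Fin P.d → ℤ :=
  fun b i => (ip (fun α => e (.R (b, i) α)) vb).valMinAbs

/-- The honest prover's messages, as a function of the witness `(r, v)`, of its coins
`g, s, y₁, y₂, y₃`, and of the challenges (each message uses earlier challenges only). -/
def honestReply (x : Stmt P) (K : AuxKey P) (r : Fin P.n₃ → P.R) (v g : P.R)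
    (s : Fin P.n₁ → P.R) (y₁ : Fin P.n₁ → Fin P.d → ℤ) (y₂ : Fin P.ν → Fin P.d → ℤ)
    (y₃ : Fin P.n₃ → Fin P.d → ℤ) (e : Challenges P) : Replies P :=
  let vb := binPoly v
  let Y₁ : Fin P.n₁ → P.R := fun j => red (y₁ j)
  let Y₂ : Fin P.ν → P.R := fun b => red (y₂ b)
  let Y₃ : Fin P.n₃ → P.R := fun j => red (y₃ j)
  let z₂ : Fin P.ν → P.R := fun b => red (y₂ b + imageR e vb b)
  let rel := lin e vb Y₂ v + quad e vb vb - cst e z₂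
  let ybin := fun α => -(K (.bin α) ⬝ᵥ Y₁)
  let yv := -((fun j => x (.b 2 j)) ⬝ᵥ Y₃)
  let yy₂ := fun b => -(K (.y₂ b) ⬝ᵥ Y₁)
  let yg := -(K .g ⬝ᵥ Y₁)
  let g₁ := lin e ybin yy₂ yv + quad e vb ybin + quad e ybin vb + yg
  fun i => match i with
    | .u₀ i => K (.a i) ⬝ᵥ s
    | .uy₂ b => K (.y₂ b) ⬝ᵥ s + Y₂ b
    | .ug => K .g ⬝ᵥ s + g
    | .ubin α => K (.bin α) ⬝ᵥ s + vb α
    | .z₂ b => z₂ b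
    | .h => g + rel
    | .w₁ i => K (.a i) ⬝ᵥ Y₁
    | .w₂ i => (fun j => x (.A i j)) ⬝ᵥ Y₃
    | .v => quad e ybin ybin + K .g₁ ⬝ᵥ Y₁
    | .ug₁ => K .g₁ ⬝ᵥ s + g₁
    | .z₁ j => Y₁ j + e .c * s j
    | .z₃ j => Y₃ j + e .c * r j

/-- Interaction of the honest prover with the verifier; `none` if a rejection step aborts. -/
def honestRun (S : Setup P) (x : Stmt P) (K : AuxKey P) (r : Fin P.n₃ → P.R) (v : P.R) :
    PMF (Option (Transcript P)) := do
  let g' ← unifPMF P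
  let g := g' - scal (coeff g' 0)
  let s ← piPMF fun _ : Fin P.n₁ => (polyPMF S.χ : PMF P.R)
  let y₁ ← gaussVec P P.s₁ P.n₁
  let y₂ ← gaussVec P P.s₂ P.ν
  let y₃ ← gaussVec P P.s₃ P.n₃
  let e ← S.challenges
  let Rl := imageR e (binPoly v)
  let cs := fun j => lift (e .c * s j)
  let cr := fun j => lift (e .c * r j)
  let ok₂ ← rej P.s₂ (y₂ + Rl) Rl
  let ok₁ ← rej P.s₁ (y₁ + cs) cs
  let ok₃ ← rej P.s₃ (y₃ + cr) cr
  pure (if ok₁ && ok₂ && ok₃ then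
    some ⟨e, honestReply x K r v g s y₁ y₂ y₃ e⟩ else none)

/-! ### Relations -/

/-- `com = Com_ctk(m, r)`: `com₀ = A r` and `com_k = ⟨b_k, r⟩ + m_k`. -/
def Opens (x : Stmt P) (r : Fin P.n₃ → P.R) (m : Fin 3 → P.R) : Prop :=
  (∀ i, x (.com₀ i) = (fun j => x (.A i j)) ⬝ᵥ r) ∧
    ∀ k, x (.com k) = (fun j => x (.b k j)) ⬝ᵥ r + m k

/-- Every coefficient of `v` is an integer in `[0, 2^β)`. -/
def InRange (v : P.R) : Prop := ∀ t : Fin P.d, (coeff v t).val < 2 ^ P.β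

/-- Relation guaranteed to the verifier: a weak opening `(c̄, r, m)` of `com` whose last message
has all its coefficients in `[0, 2^β)`. -/
def Rel (x : Stmt P) (cbar : P.R) (r : Fin P.n₃ → P.R) (m : Fin 3 → P.R) : Prop :=
  IsUnit cbar ∧ nrm1 cbar ≤ 2 * P.ω ∧ nrm (fun j => cbar * r j) ≤ 2 * P.bound₃ ∧
    Opens x r m ∧ InRange (m 2)

/-- Honest witnesses: openings (with `c̄ = 1`) with randomness as short as a ternary one. -/
def HonestRel (x : Stmt P) (r : Fin P.n₃ → P.R) (m : Fin 3 → P.R) : Prop :=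
  nrm r ≤ √(P.n₃ * P.d) ∧ Opens x r m ∧ InRange (m 2)

/-- `z` is a solution with bound `B` of the Module-SIS instance `M`. -/
def IsMSIS {n : ℕ} (M : Fin P.κ → Fin n → P.R) (B : ℝ) (z : Fin n → P.R) : Prop :=
  z ≠ 0 ∧ nrm z ≤ B ∧ ∀ i, M i ⬝ᵥ z = 0

/-! ### Efficient procedures

Probabilistic nonadaptive programs over `R_q`: they draw independent coins from the
distributions of the protocol, call an oracle on tuples of computed ring elements, and output
computed ring elements; the computations are formulas whose number of nodes is counted. -/

inductive Expr (P : Params) (V : Type) : Type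
  | var (x : V)
  | const (r : P.R)
  | add (f g : Expr P V)
  | mul (f g : Expr P V)
  | conj (f : Expr P V)
  | inv (f : Expr P V)
  | coeff (i : ℕ) (f : Expr P V)
  | bit (i : ℕ) (f : Expr P V)

namespace Expr

variable {V : Type}

def size : Expr P V → ℕ
  | var _ => 1
  | const _ => 1
  | add f g => f.size + g.size + 1
  | mul f g => f.size + g.size + 1
  | conj f => f.size + 1
  | inv f => f.size + 1
  | coeff _ f => f.size + 1
  | bit _ f => f.size + 1

/-- `inv` returns `0` on nonunits; `coeff i` extracts the `i`-th coefficient as a scalar, and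
`bit i` the `i`-th bit of the representative in `[0, q)` of the constant coefficient. -/
def eval (ρ : V → P.R) : Expr P V → P.R
  | var x => ρ x
  | const r => r
  | add f g => f.eval ρ + g.eval ρ
  | mul f g => f.eval ρ * g.eval ρ
  | conj f => PoA.conj (f.eval ρ)
  | inv f => Ring.inverse (f.eval ρ)
  | coeff i f => scal (PoA.coeff (f.eval ρ) i)
  | bit i f => if (PoA.coeff (f.eval ρ) 0).val.testBit i then 1 else 0

end Expr

/-- Available coins. -/
inductive Sampler : Type
  | unif
  | scalar
  | bit
  | gauss₁
  | gauss₂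
  | gauss₃
  | small
  | bin
  | chal

def Setup.sample (S : Setup P) : Sampler → PMF P.R
  | .unif => unifPMF P
  | .scalar => scalPMF P
  | .bit => (PMF.uniformOfFintype (Fin 2)).map fun b => (b.val : P.R)
  | .gauss₁ => polyPMF (gaussPMF P.s₁)
  | .gauss₂ => polyPMF (gaussPMF P.s₂)
  | .gauss₃ => polyPMF (gaussPMF P.s₃)
  | .small => polyPMF S.χ
  | .bin => polyPMF binPMF
  | .chal => S.C

structure Prog (P : Params) (inp query ans out : Type) where
  nCoins : ℕ
  coin : Fin nCoins → Sampler
  nCalls : ℕ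
  call : Fin nCalls → query → Expr P (inp ⊕ Fin nCoins)
  output : out → Expr P ((inp ⊕ Fin nCoins) ⊕ (Fin nCalls × ans))

namespace Prog

variable {inp query ans out : Type}

/-- Number of coins, oracle calls and ring operations. -/
def size [Fintype query] [Fintype out] (A : Prog P inp query ans out) : ℕ :=
  A.nCoins + A.nCalls + ∑ k, ∑ j, (A.call k j).size + ∑ o, (A.output o).size

def run (A : Prog P inp query ans out) (S : Setup P)
    (oracle : (query → P.R) → ans → P.R) (x : inp → P.R) : PMF (out → P.R) :=
  (piPMF fun k => S.sample (A.coin k)).map fun w =>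
    let ρ := Sum.elim x w
    fun o => (A.output o).eval
      (Sum.elim ρ fun p => oracle (fun j => (A.call p.1 j).eval ρ) p.2)

end Prog

/-! ### Completeness -/

/-- The honest prover, restarted until no rejection step aborts (each of the three accepts with
probability about `1/3`), convinces the verifier except with explicitly negligible
probability. -/
def Complete (S : Setup P) : Prop :=
  ∀ (x : Stmt P) (K : AuxKey P) (r : Fin P.n₃ → P.R) (m : Fin 3 → P.R), HonestRel x r m →
    (1 - 2 ^ (-100 : ℤ)) / 27 ≤ Pr (honestRun S x K r (m 2)) {o | o.isSome} ∧
    (1 - ((2 : ℝ) ^ (-((P.n₁ * P.d : ℕ) : ℝ) / 8) + (2 : ℝ) ^ (-((P.n₃ * P.d : ℕ) : ℝ) / 8)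
        + 2 ^ (-100 : ℤ))) * Pr (honestRun S x K r (m 2)) {o | o.isSome}
      ≤ Pr (honestRun S x K r (m 2)) {o | ∃ t, o = some t ∧ Accepts x K t}

/-! ### Knowledge soundness -/

/-- Deterministic prover: each message depends on the challenges of earlier rounds only. -/
structure Strategy (P : Params) where
  reply : Challenges P → Replies P
  causal : ∀ (e e' : Challenges P) (i : RespIdx P),
    (∀ j : ChalIdx P, j.round < i.round → e j = e' j) → reply e i = reply e' i

/-- Probability that a (randomised) prover convinces the verifier. -/
def acceptProb (S : Setup P) (x : Stmt P) (K : AuxKey P) (A : PMF (Strategy P)) : ℝ :=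
  Pr (do
    let σ ← A
    let e ← S.challenges
    pure (⟨e, σ.reply e⟩ : Transcript P)) {t | Accepts x K t}

/-- Largest probability, over a fixed challenge `c`, that `c - c'` is not invertible for a fresh
challenge `c'`. -/
def nonInvProb (S : Setup P) : ℝ :=
  (⨆ c ∈ S.C.support, S.C.toOuterMeasure {c' | ¬ IsUnit (c - c')}).toReal

/-- Knowledge error. -/
def knowledgeError (S : Setup P) : ℝ := 2 * nonInvProb S + 1 / P.q + 2 ^ (-256 : ℤ)

/-- Outputs of an extractor: a witness `(c̄, r, m)` and two candidate Module-SIS solutions. -/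
inductive ExtIdx (P : Params) : Type
  | cbar
  | r (j : Fin P.n₃)
  | m (k : Fin 3)
  | sis₁ (j : Fin P.n₁)
  | sis₃ (j : Fin P.n₃)
  deriving Fintype

/-- The extractor outputs a witness. -/
def Extracted (x : Stmt P) (o : ExtIdx P → P.R) : Prop :=
  Rel x (o .cbar) (fun j => o (.r j)) (fun k => o (.m k))

/-- The extractor breaks the binding property of one of the two commitments, by solving
`MSIS_{κ, n₁, 8 ω bound₁}` on `A_a` or `MSIS_{κ, n₃, 8 ω bound₃}` on `A`. -/
def BreaksBinding (x : Stmt P) (K : AuxKey P) (o : ExtIdx P → P.R) : Prop :=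
  IsMSIS (fun i => K (.a i)) (8 * P.ω * P.bound₁) (fun j => o (.sis₁ j)) ∨
    IsMSIS (fun i j => x (.A i j)) (8 * P.ω * P.bound₃) (fun j => o (.sis₃ j))

/-- There is an extractor of size at most `c * len ^ k`, with access to the prover on a fixed
random tape, that outputs a witness or breaks binding with probability at least
`(ε - knowledgeError) ^ D / (c * len ^ k)` for every statement, every key and every prover of
success probability `ε > knowledgeError`. -/
def KnowledgeSound (S : Setup P) (c k D : ℕ) : Prop :=
  ∃ E : Prog P (StmtIdx P ⊕ (Row P × Fin P.n₁)) (ChalIdx P) (RespIdx P) (ExtIdx P),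
    E.size ≤ c * P.len ^ k ∧
    ∀ (x : Stmt P) (K : AuxKey P) (A : PMF (Strategy P)),
      knowledgeError S < acceptProb S x K A →
      (acceptProb S x K A - knowledgeError S) ^ D ≤ (c * P.len ^ k : ℕ) *
        Pr (do
          let σ ← A
          E.run S σ.reply (Sum.elim x fun p => K p.1 p.2))
          {o | Extracted x o ∨ BreaksBinding x K o}

/-! ### Honest-verifier zero-knowledge -/

/-- Advantage of `B` in the knapsack Module-LWE problem with `κ + 256/d + β + 2` rows and
`n₁` columns and secrets from `χ`. -/
def mlweAdv (S : Setup P) (B : AuxKey P → (Row P → P.R) → ℝ) : ℝ :=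
  |expect (auxPMF P) (fun M =>
      expect (piPMF fun _ : Fin P.n₁ => (polyPMF S.χ : PMF P.R)) fun s => B M fun i => M i ⬝ᵥ s)
    - expect (auxPMF P) (fun M => expect (piPMF fun _ : Row P => unifPMF P) fun u => B M u)|

/-- Expected output of a distinguisher on a non-aborting honest transcript. -/
def honestExpect (S : Setup P) (x : Stmt P) (K : AuxKey P) (r : Fin P.n₃ → P.R) (v : P.R)
    (D : Transcript P → ℝ) : ℝ :=
  expect (honestRun S x K r v) (fun o => o.elim 0 D) / Pr (honestRun S x K r v) {o | o.isSome}

/-- Programs that output a transcript, without oracle. -/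
abbrev TranscriptProg (P : Params) (inp : Type) : Type :=
  Prog P inp Empty Empty (ChalIdx P ⊕ RespIdx P)

def TranscriptProg.expect {inp : Type} (A : TranscriptProg P inp) (S : Setup P) (x : inp → P.R)
    (D : Transcript P → ℝ) : ℝ :=
  PoA.expect (A.run S (fun _ i => i.elim) x)
    fun o => D ⟨fun i => o (.inl i), fun i => o (.inr i)⟩

/-- There are a simulator and a reduction, of size at most `c * len ^ k`, such that for every
statement with an honest witness and every distinguisher `D`, the advantage of `D` between
non-aborting honest transcripts and simulated ones, for a random auxiliary key, is at most
`2⁻¹⁰⁰` plus the knapsack Module-LWE advantage of the adversary that turns its sample into a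
transcript with the reduction and then runs `D`. The simulator has the public inputs only; the
reduction has also the Module-LWE sample and the witness. -/
def HVZK (S : Setup P) (c k : ℕ) : Prop :=
  ∃ (Sim : TranscriptProg P (StmtIdx P ⊕ (Row P × Fin P.n₁)))
    (T : TranscriptProg P ((StmtIdx P ⊕ (Row P × Fin P.n₁)) ⊕ (Row P ⊕ (Fin P.n₃ ⊕ Fin 3)))),
    Sim.size ≤ c * P.len ^ k ∧ T.size ≤ c * P.len ^ k ∧
    ∀ (x : Stmt P) (r : Fin P.n₃ → P.R) (m : Fin 3 → P.R), HonestRel x r m →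
    ∀ D : AuxKey P → Transcript P → ℝ, (∀ K t, 0 ≤ D K t ∧ D K t ≤ 1) →
      |expect (auxPMF P) (fun K => honestExpect S x K r (m 2) (D K))
        - expect (auxPMF P) (fun K => Sim.expect S (Sum.elim x fun p => K p.1 p.2) (D K))|
      ≤ mlweAdv S (fun M u =>
          T.expect S (Sum.elim (Sum.elim x fun p => M p.1 p.2) (Sum.elim u (Sum.elim r m))) (D M))
        + 2 ^ (-100 : ℤ)

end PoA

end

open PoA

open Polynomial
open scoped ENNReal BigOperators

noncomputable section

namespace PoA


/-! ### Expectations with values in `[0, ∞]` -/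

section Ev

variable {α β γ : Type}

/-! All probabilities are handled through `ev`, an expectation with values in `[0, ∞]`, so that sums
may be exchanged freely and independent products `piPMF` may be resampled coordinate by coordinate.

Completeness and zero-knowledge rest on one reparametrisation. A Gaussian mask shifted by `v` and
kept with the rejection probability has density `1/3 * wt` with respect to the centred Gaussian
(`ev_gaussVec_rej`), and `wt ≤ 1` has mean at least `1 - 2⁻¹⁰²` when `‖v‖ ≤ s / 11`
(`one_le_ev_wt`). The shifts `c s` and `c r` are that short by the choice of the widths; `R l` is
that short outside an event of probability at most `2⁻¹⁰²` (`ev_imageR_tail`, a sub-Gaussian bound).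
Moreover an honest transcript is a function of the masked openings, the auxiliary commitment and `h`
alone, because the other messages are the solutions of the verification equations
(`honestReply_eq`). So an honest run is `1/27` times the experiment `hybrid` with centred Gaussian
openings, weighted by `wts` (`ev_honestRun`).

For completeness, the norm checks then fail only on Gaussian tails, and `h` has zero constant
coefficient because the constant coefficient of the relation is a linear combination of gaps that
vanish for correct bits (`coeff_relation`).

For zero-knowledge, dropping the weights costs at most `2⁻¹⁰⁰`. The products `K s` are then replaced
by a uniform vector, which is the Module-LWE step, and a uniform vector absorbs the committed
messages while the uniform garbage polynomial absorbs the value of the relation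
(`ev_hybrid_uniform`). What remains is the simulator.

For soundness, two accepting transcripts that differ only in `c`, with invertible difference, give
weak openings `(s, r)` of both commitments (`GoodPair`). Given a third one with the same opening,
the verification equation is a quadratic polynomial in `c` with three roots of pairwise invertible
differences, so its leading coefficient vanishes: the relation equals `h`, and its constant
coefficient is zero (`relation_of_triple`). For a fixed opening of out-of-range assets this happens,
together with a short `z₂`, with probability at most `1/q + 2⁻²⁵⁶` (`ev_lucky_le`): a nonzero gap is
caught by the random scalars, a large extracted bit is caught by `R`, and small extracted bits with
zero gaps are genuine bits.

The extractor runs two independent pairs. The first pair fixes `(s, r)`. If its assets are out of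
range, triples on fresh challenges that avoid the lucky event must contain a pair with a different
opening (`ev_differs`), and two different openings of one commitment solve Module-SIS
(`isMSIS_cross`). The third transcript occurs only in the analysis. A tangent-line inequality for `t
^ 8` passes from one random tape of the prover to the average (`tangent_succeeds`). -/

/-- Expectation of a function with values in `[0, ∞]`. -/
def ev (p : PMF α) (f : α → ℝ≥0∞) : ℝ≥0∞ := ∑' x, p x * f x

theorem ev_pure (a : α) (f : α → ℝ≥0∞) : ev (PMF.pure a) f = f a := by
  unfold ev
  rw [tsum_eq_single a]
  · simp
  · intro b hb
    simp [hb]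

theorem ev_bind (p : PMF α) (k : α → PMF β) (f : β → ℝ≥0∞) :
    ev (p.bind k) f = ev p fun x => ev (k x) f := by
  unfold ev
  simp only [PMF.bind_apply, ← ENNReal.tsum_mul_right, ← ENNReal.tsum_mul_left]
  rw [ENNReal.tsum_comm]
  simp only [mul_assoc]

theorem ev_map (p : PMF α) (g : α → β) (f : β → ℝ≥0∞) :
    ev (p.map g) f = ev p fun x => f (g x) := by
  rw [PMF.map, ev_bind]
  simp [ev_pure]

theorem ev_const (p : PMF α) (c : ℝ≥0∞) : ev p (fun _ => c) = c := by
  unfold ev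
  rw [ENNReal.tsum_mul_right, p.tsum_coe, one_mul]

theorem ev_mono_support (p : PMF α) {f g : α → ℝ≥0∞} (h : ∀ x ∈ p.support, f x ≤ g x) :
    ev p f ≤ ev p g := by
  refine ENNReal.tsum_le_tsum fun x => ?_
  by_cases hx : p x = 0
  · simp [hx]
  · exact mul_le_mul_right (h x hx) _

theorem ev_mono (p : PMF α) {f g : α → ℝ≥0∞} (h : ∀ x, f x ≤ g x) : ev p f ≤ ev p g :=
  ev_mono_support p fun x _ => h x

theorem ev_congr_support (p : PMF α) {f g : α → ℝ≥0∞} (h : ∀ x ∈ p.support, f x = g x) :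
    ev p f = ev p g :=
  le_antisymm (ev_mono_support p fun x hx => (h x hx).le)
    (ev_mono_support p fun x hx => (h x hx).ge)

theorem ev_add (p : PMF α) (f g : α → ℝ≥0∞) : ev p (fun x => f x + g x) = ev p f + ev p g := by
  unfold ev
  simp only [mul_add, ENNReal.tsum_add]

theorem ev_mul_left (p : PMF α) (c : ℝ≥0∞) (f : α → ℝ≥0∞) :
    ev p (fun x => c * f x) = c * ev p f := by
  unfold ev
  rw [← ENNReal.tsum_mul_left]
  exact tsum_congr fun x => by ring

theorem ev_mul_right (p : PMF α) (c : ℝ≥0∞) (f : α → ℝ≥0∞) :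
    ev p (fun x => f x * c) = ev p f * c := by
  simp only [mul_comm _ c, ev_mul_left]

theorem ev_le_const (p : PMF α) {f : α → ℝ≥0∞} {c : ℝ≥0∞} (h : ∀ x ∈ p.support, f x ≤ c) :
    ev p f ≤ c :=
  (ev_mono_support p h).trans (ev_const p c).le

/-- Tonelli. It lets independent coins be drawn in whatever order an argument needs. -/
theorem ev_comm (p : PMF α) (q : PMF β) (f : α → β → ℝ≥0∞) :
    ev p (fun x => ev q fun y => f x y) = ev q fun y => ev p fun x => f x y := by
  unfold ev
  simp only [← ENNReal.tsum_mul_left]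
  rw [ENNReal.tsum_comm]
  exact tsum_congr fun x => tsum_congr fun y => by ring

theorem ev_uniform [Fintype α] [Nonempty α] (f : α → ℝ≥0∞) :
    ev (PMF.uniformOfFintype α) f = (Fintype.card α : ℝ≥0∞)⁻¹ * ∑ x, f x := by
  unfold ev
  simp [tsum_fintype, Finset.mul_sum]

/-- A bijection preserves the uniform distribution. -/
theorem ev_uniform_equiv [Fintype α] [Nonempty α] (e : α ≃ α) (f : α → ℝ≥0∞) :
    ev (PMF.uniformOfFintype α) (fun x => f (e x)) = ev (PMF.uniformOfFintype α) f := by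
  rw [ev_uniform, ev_uniform, e.sum_comp]

theorem ev_coin (a : ℝ≥0∞) (h : a ≤ 1) (f : Bool → ℝ≥0∞) :
    ev (coinPMF a h) f = a * f true + (1 - a) * f false := by
  unfold ev coinPMF
  simp [tsum_fintype]

open Classical in
/-- Indicator of a proposition. -/
def ind (A : Prop) : ℝ≥0∞ := if A then 1 else 0

theorem ind_true {A : Prop} (h : A) : ind A = 1 := by simp [ind, h]

theorem ind_false {A : Prop} (h : ¬ A) : ind A = 0 := by simp [ind, h]

theorem ind_le_one (A : Prop) : ind A ≤ 1 := by
  unfold ind; split_ifs <;> simp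

theorem ind_mono {A B : Prop} (h : A → B) : ind A ≤ ind B := by
  by_cases hA : A
  · simp [ind_true hA, ind_true (h hA)]
  · simp [ind_false hA]

theorem ind_and (A B : Prop) : ind (A ∧ B) = ind A * ind B := by
  by_cases hA : A <;> by_cases hB : B <;> simp [ind, hA, hB]

theorem ind_or_le (A B : Prop) : ind (A ∨ B) ≤ ind A + ind B := by
  by_cases hA : A <;> by_cases hB : B <;> simp [ind, hA, hB]

theorem ind_le_add_not (A B : Prop) : ind A ≤ ind B + ind (A ∧ ¬ B) := by
  by_cases hA : A <;> by_cases hB : B <;> simp [ind, hA, hB]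

theorem ev_ne_top {p : PMF α} {f : α → ℝ≥0∞} {c : ℝ≥0∞} (hc : c ≠ ⊤) (h : ∀ x, f x ≤ c) :
    ev p f ≠ ⊤ :=
  ne_top_of_le_ne_top hc (ev_le_const p fun x _ => h x)

theorem Pr_eq (p : PMF α) (E : Set α) : Pr p E = (ev p fun x => ind (x ∈ E)).toReal := by
  classical
  unfold Pr ev ind
  rw [PMF.toOuterMeasure_apply]
  congr 1
  refine tsum_congr fun x => ?_
  by_cases hx : x ∈ E <;> simp [hx]

theorem ofReal_Pr (p : PMF α) (E : Set α) :
    ENNReal.ofReal (Pr p E) = ev p fun x => ind (x ∈ E) := by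
  rw [Pr_eq, ENNReal.ofReal_toReal]
  exact ev_ne_top ENNReal.one_ne_top fun x => ind_le_one _

theorem Pr_nonneg (p : PMF α) (E : Set α) : 0 ≤ Pr p E := ENNReal.toReal_nonneg

theorem expect_eq (p : PMF α) (f : α → ℝ) (hf : ∀ x, 0 ≤ f x) :
    expect p f = (ev p fun x => ENNReal.ofReal (f x)).toReal := by
  unfold expect ev
  rw [ENNReal.tsum_toReal_eq]
  · refine tsum_congr fun x => ?_
    rw [ENNReal.toReal_mul, ENNReal.toReal_ofReal (hf x)]
  · intro x
    exact ENNReal.mul_ne_top (p.apply_ne_top x) ENNReal.ofReal_ne_top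

theorem ofReal_expect (p : PMF α) (f : α → ℝ) (hf : ∀ x, 0 ≤ f x ∧ f x ≤ 1) :
    ENNReal.ofReal (expect p f) = ev p fun x => ENNReal.ofReal (f x) := by
  rw [expect_eq p f fun x => (hf x).1, ENNReal.ofReal_toReal]
  exact ev_ne_top ENNReal.one_ne_top fun x => by simpa using (hf x).2

theorem expect_mem (p : PMF α) (f : α → ℝ) (hf : ∀ x, 0 ≤ f x ∧ f x ≤ 1) :
    0 ≤ expect p f ∧ expect p f ≤ 1 := by
  rw [expect_eq p f fun x => (hf x).1]
  refine ⟨ENNReal.toReal_nonneg, ENNReal.toReal_le_of_le_ofReal zero_le_one ?_⟩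
  exact ev_le_const p fun x _ => ENNReal.ofReal_le_ofReal (hf x).2

end Ev

/-! ### Independent products -/

section PiPMF

variable {α β : Type}

theorem tsum_prod_fin : ∀ (n : ℕ) (w : Fin n → α → ℝ≥0∞),
    ∑' f : Fin n → α, ∏ i, w i (f i) = ∏ i, ∑' a, w i a := by
  intro n
  induction n with
  | zero => intro w; simp
  | succ n ih =>
    intro w
    rw [← (Fin.consEquiv (fun _ : Fin (n + 1) => α)).tsum_eq]
    rw [ENNReal.tsum_prod']
    simp only [Fin.consEquiv_apply, Fin.prod_univ_succ, Fin.cons_zero, Fin.cons_succ]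
    simp only [ENNReal.tsum_mul_left, ENNReal.tsum_mul_right, ih (fun i => w i.succ)]

theorem tsum_prod_pi {ι : Type} [Fintype ι] (w : ι → α → ℝ≥0∞) :
    ∑' f : ι → α, ∏ i, w i (f i) = ∏ i, ∑' a, w i a := by
  have e := Fintype.equivFin ι
  rw [← e.symm.prod_comp, ← tsum_prod_fin (Fintype.card ι) (fun k => w (e.symm k)),
    ← (Equiv.arrowCongr e (Equiv.refl α)).tsum_eq]
  refine tsum_congr fun f => ?_
  rw [← e.prod_comp]
  simp [Equiv.arrowCongr]

theorem piPMF_apply {ι : Type} [Fintype ι] (p : ι → PMF α) (f : ι → α) :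
    piPMF p f = ∏ i, p i (f i) := rfl

theorem ev_piPMF_prod {ι : Type} [Fintype ι] (p : ι → PMF α) (g : ι → α → ℝ≥0∞) :
    ev (piPMF p) (fun f => ∏ i, g i (f i)) = ∏ i, ev (p i) (g i) := by
  unfold ev
  simp only [piPMF_apply, ← Finset.prod_mul_distrib]
  rw [tsum_prod_pi fun i a => p i a * g i a]

theorem mem_support_piPMF {ι : Type} [Fintype ι] (p : ι → PMF α) (f : ι → α) :
    f ∈ (piPMF p).support ↔ ∀ i, f i ∈ (p i).support := by
  simp [PMF.mem_support_iff, piPMF_apply, Finset.prod_eq_zero_iff]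

theorem piPMF_map {ι : Type} [Fintype ι] (p : ι → PMF α) (g : ι → α → β) :
    piPMF (fun i => (p i).map (g i)) = (piPMF p).map fun x i => g i (x i) := by
  classical
  ext y
  rw [piPMF_apply, PMF.map_apply]
  simp only [PMF.map_apply]
  rw [← tsum_prod_pi fun i a => if y i = g i a then p i a else 0]
  refine tsum_congr fun x => ?_
  by_cases h : y = fun i => g i (x i)
  · rw [if_pos h, piPMF_apply]
    exact Finset.prod_congr rfl fun i _ => if_pos (congrFun h i)
  · rw [if_neg h]
    obtain ⟨i, hi⟩ := Function.ne_iff.mp h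
    exact Finset.prod_eq_zero (Finset.mem_univ i) (if_neg hi)

theorem ev_pi_equiv {ι κ : Type} [Fintype ι] [Fintype κ] (e : ι ≃ κ) (p : κ → PMF α)
    (f : (κ → α) → ℝ≥0∞) :
    ev (piPMF p) f = ev (piPMF fun i => p (e i)) fun x => f fun k => x (e.symm k) := by
  unfold ev
  rw [← (Equiv.arrowCongr e (Equiv.refl α)).tsum_eq]
  refine tsum_congr fun x => ?_
  simp only [piPMF_apply]
  rw [← e.prod_comp]
  simp [Equiv.arrowCongr, Function.comp_def]

theorem ev_pi_sum {ι κ : Type} [Fintype ι] [Fintype κ] (p : ι ⊕ κ → PMF α)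
    (f : (ι ⊕ κ → α) → ℝ≥0∞) :
    ev (piPMF p) f = ev (piPMF fun i => p (.inl i)) fun x =>
      ev (piPMF fun k => p (.inr k)) fun y => f (Sum.elim x y) := by
  unfold ev
  rw [← (Equiv.sumArrowEquivProdArrow ι κ α).symm.tsum_eq, ENNReal.tsum_prod']
  refine tsum_congr fun x => ?_
  rw [← ENNReal.tsum_mul_left]
  refine tsum_congr fun y => ?_
  simp only [piPMF_apply, Fintype.prod_sum_type, Equiv.sumArrowEquivProdArrow_symm_apply_inl,
    Equiv.sumArrowEquivProdArrow_symm_apply_inr, mul_assoc]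
  rfl

theorem ev_pi_unit (p : Unit → PMF α) (f : (Unit → α) → ℝ≥0∞) :
    ev (piPMF p) f = ev (p ()) fun a => f fun _ => a := by
  unfold ev
  rw [← (Equiv.funUnique Unit α).symm.tsum_eq]
  refine tsum_congr fun a => ?_
  simp [piPMF_apply]
  rfl

open Classical in
/-- Families indexed by `ι`, split according to membership in `S`. -/
theorem ev_pi_split {ι : Type} [Fintype ι] (S : Set ι) (p : ι → PMF α) (f : (ι → α) → ℝ≥0∞) :
    ev (piPMF p) f = ev (piPMF fun i : S => p i) fun x =>
      ev (piPMF fun i : (Sᶜ : Set ι) => p i) fun y =>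
        f fun i => if h : i ∈ S then x ⟨i, h⟩ else y ⟨i, h⟩ := by
  rw [ev_pi_equiv (Equiv.Set.sumCompl S) p, ev_pi_sum]
  simp only [Equiv.Set.sumCompl_apply_inl, Equiv.Set.sumCompl_apply_inr]
  congr 1
  funext x
  congr 1
  funext y
  congr 1
  funext i
  by_cases h : i ∈ S
  · rw [Equiv.Set.sumCompl_symm_apply_of_mem h, dif_pos h]; rfl
  · rw [Equiv.Set.sumCompl_symm_apply_of_notMem h, dif_neg h]; rfl

/-- Marginals of an independent product. -/
theorem ev_pi_marginal {ι κ : Type} [Fintype ι] [Fintype κ] (p : ι → PMF α) (φ : κ → ι)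
    (hφ : Function.Injective φ) (f : (κ → α) → ℝ≥0∞) :
    ev (piPMF p) (fun x => f fun k => x (φ k)) = ev (piPMF fun k => p (φ k)) f := by
  classical
  rw [ev_pi_split (Set.range φ) p]
  simp only [Set.mem_range_self, dite_true, ev_const]
  have key : ∀ _ : Fintype (Set.range φ),
      ev (piPMF fun i : Set.range φ => p i) (fun x => f fun k => x ⟨φ k, Set.mem_range_self k⟩)
        = ev (piPMF fun k => p (φ k)) f := by
    intro _
    rw [ev_pi_equiv (Equiv.ofInjective φ hφ)]
    simp only [Equiv.ofInjective_apply]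
    congr 1
    funext x
    congr 1
    funext k
    congr 1
    exact Equiv.ofInjective_symm_apply hφ k
  exact key _

theorem ev_pi_coord {ι : Type} [Fintype ι] (p : ι → PMF α) (i : ι) (f : α → ℝ≥0∞) :
    ev (piPMF p) (fun x => f (x i)) = ev (p i) f := by
  rw [ev_pi_marginal p (fun _ : Unit => i) (fun _ _ _ => rfl) (fun y => f (y ())), ev_pi_unit]

open Classical in
/-- Resampling the coordinates in `S`. -/
theorem ev_pi_resample {ι : Type} [Fintype ι] (S : Set ι) (p : ι → PMF α)
    (f : (ι → α) → ℝ≥0∞) :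
    ev (piPMF p) f = ev (piPMF p) fun x => ev (piPMF p) fun y =>
      f fun i => if i ∈ S then y i else x i := by
  have h : ∀ x : ι → α, ev (piPMF p) (fun y => f fun i => if i ∈ S then y i else x i)
      = ev (piPMF fun i : S => p i) fun y => f fun i => if h : i ∈ S then y ⟨i, h⟩ else x i :=
    fun x => ev_pi_marginal p (Subtype.val : S → ι) Subtype.val_injective
      (fun y => f fun i => if h : i ∈ S then y ⟨i, h⟩ else x i)
  simp only [h]
  rw [ev_comm, ev_pi_split S p f]
  congr 1
  funext x
  exact (ev_pi_marginal p (Subtype.val : (Sᶜ : Set ι) → ι) Subtype.val_injective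
    (fun y => f fun i => if h : i ∈ S then x ⟨i, h⟩ else y ⟨i, h⟩)).symm

open Classical in
/-- Resampling one coordinate. -/
theorem ev_pi_update {ι : Type} [Fintype ι] (i : ι) (p : ι → PMF α)
    (f : (ι → α) → ℝ≥0∞) :
    ev (piPMF p) f = ev (piPMF p) fun x => ev (p i) fun a => f (Function.update x i a) := by
  rw [ev_pi_resample {i} p f]
  congr 1
  funext x
  rw [← ev_pi_coord p i (fun a => f (Function.update x i a))]
  congr 1
  funext y
  congr 1
  funext j
  by_cases hj : j = i
  · subst hj; simp
  · simp [hj]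

end PiPMF


/-! ### The ring `R_q` -/

section RingBasics

variable {P : Params}

theorem Params.d_pos (P : Params) : 0 < P.d := Nat.pos_of_ne_zero P.d_ne_zero

instance (P : Params) : NeZero P.d := ⟨P.d_ne_zero⟩

instance (P : Params) : Fact P.q.Prime := ⟨P.prime⟩

theorem natDegree_modulus (P : Params) : (X ^ P.d + 1 : (ZMod P.q)[X]).natDegree = P.d := by
  simpa using natDegree_X_pow_add_C (n := P.d) (r := (1 : ZMod P.q))

theorem coeff_add (x y : P.R) (i : ℕ) : coeff (x + y) i = coeff x i + coeff y i := by
  simp [coeff]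

theorem coeff_zero (i : ℕ) : coeff (0 : P.R) i = 0 := by simp [coeff]

theorem coeff_neg (x : P.R) (i : ℕ) : coeff (-x) i = -coeff x i := by simp [coeff]

theorem coeff_sub (x y : P.R) (i : ℕ) : coeff (x - y) i = coeff x i - coeff y i := by
  simp [coeff]

theorem coeff_sum {ι : Type} (s : Finset ι) (f : ι → P.R) (i : ℕ) :
    coeff (∑ j ∈ s, f j) i = ∑ j ∈ s, coeff (f j) i := by
  classical
  induction s using Finset.induction_on with
  | empty => simp [coeff_zero]
  | insert a s ha ih => simp [Finset.sum_insert ha, coeff_add, ih]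

theorem coeff_scal_mul (c : ZMod P.q) (x : P.R) (i : ℕ) : coeff (scal c * x) i = c * coeff x i := by
  have h : scal c * x = c • x := by
    rw [Algebra.smul_def]; rfl
  rw [h]
  simp [coeff]

theorem scal_neg (a : ZMod P.q) : (scal (-a) : P.R) = -scal a := by simp [scal]

theorem scal_zero : (scal 0 : P.R) = 0 := by simp [scal]

theorem scal_one : (scal 1 : P.R) = 1 := by simp [scal]

theorem scal_natCast (n : ℕ) : (scal (n : ZMod P.q) : P.R) = n := by simp [scal]

theorem Xbar_pow_d : (Xbar : P.R) ^ P.d = -1 := by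
  have h : (AdjoinRoot.mk (X ^ P.d + 1 : (ZMod P.q)[X])) (X ^ P.d + 1) = 0 := AdjoinRoot.mk_self
  rw [map_add, map_pow, AdjoinRoot.mk_X, map_one] at h
  exact eq_neg_of_add_eq_zero_left h

theorem coeff_mk_of_degree_lt (p : (ZMod P.q)[X]) (hp : p.degree < P.d) (i : ℕ) :
    coeff (AdjoinRoot.mk (X ^ P.d + 1) p : P.R) i = p.coeff i := by
  rw [coeff, AdjoinRoot.modByMonicHom_mk, (modByMonic_eq_self_iff P.monic).mpr]
  rwa [degree_eq_natDegree P.monic.ne_zero, natDegree_modulus]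

theorem coeff_of_le (x : P.R) {i : ℕ} (h : P.d ≤ i) : coeff x i = 0 := by
  induction x using AdjoinRoot.induction_on with
  | ih p =>
    rw [coeff, AdjoinRoot.modByMonicHom_mk]
    refine coeff_eq_zero_of_degree_lt ((degree_modByMonic_lt p P.monic).trans_le ?_)
    rw [degree_eq_natDegree P.monic.ne_zero, natDegree_modulus]
    exact_mod_cast h

theorem ofCoeffs_eq_mk (f : Fin P.d → ZMod P.q) :
    (ofCoeffs f : P.R) = AdjoinRoot.mk (X ^ P.d + 1) (∑ i : Fin P.d, C (f i) * X ^ (i : ℕ)) := by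
  simp [ofCoeffs, scal, Xbar]

theorem coeff_ofCoeffs (f : Fin P.d → ZMod P.q) (i : Fin P.d) : coeff (ofCoeffs f) i = f i := by
  rw [ofCoeffs_eq_mk, coeff_mk_of_degree_lt _ (degree_sum_fin_lt _), finsetSum_coeff]
  simp [coeff_C_mul, coeff_X_pow, Fin.val_inj]

theorem ext_coeff {x y : P.R} (h : ∀ i : Fin P.d, coeff x i = coeff y i) : x = y := by
  have hinj := (AdjoinRoot.mk_leftInverse P.monic).injective
  refine hinj ?_
  ext i
  by_cases hi : i < P.d
  · exact h ⟨i, hi⟩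
  · exact (coeff_of_le x (not_lt.mp hi)).trans (coeff_of_le y (not_lt.mp hi)).symm

theorem ofCoeffs_coeff (x : P.R) : ofCoeffs (fun i : Fin P.d => coeff x i) = x :=
  ext_coeff fun i => coeff_ofCoeffs _ i

theorem ofCoeffs_add (f g : Fin P.d → ZMod P.q) :
    (ofCoeffs (f + g) : P.R) = ofCoeffs f + ofCoeffs g :=
  ext_coeff fun i => by simp [coeff_add, coeff_ofCoeffs]

theorem coeff_scal (c : ZMod P.q) : coeff (scal c : P.R) 0 = c := by
  have h := coeff_mk_of_degree_lt (P := P) (C c)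
    (degree_C_le.trans_lt (by exact_mod_cast P.d_pos)) 0
  simpa [scal] using h

theorem ofCoeffs_eq_sum_range (f : ℕ → ZMod P.q) :
    (ofCoeffs (fun i : Fin P.d => f i) : P.R) = ∑ i ∈ Finset.range P.d, scal (f i) * Xbar ^ i := by
  rw [ofCoeffs, Finset.sum_range fun i => (scal (f i) * Xbar ^ i : P.R)]

/-- Since `X ^ d = -1`, multiplication by `X` is a negacyclic shift; both the isometry property of
`X` and the inner product formula for `conj` come from this. -/
theorem Xbar_mul_eq (x : P.R) : Xbar * x = ofCoeffs fun i : Fin P.d =>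
    if (i : ℕ) = 0 then -coeff x (P.d - 1) else coeff x (i - 1) := by
  obtain ⟨n, hn⟩ : ∃ n, P.d = n + 1 := ⟨P.d - 1, by have := P.d_pos; omega⟩
  conv_lhs => rw [← ofCoeffs_coeff x]
  rw [ofCoeffs_eq_sum_range (coeff x),
    ofCoeffs_eq_sum_range fun i => if i = 0 then -coeff x (P.d - 1) else coeff x (i - 1)]
  have h2 : (Xbar : P.R) ^ (n + 1) = -1 :=
    (congrArg (fun m => (Xbar : P.R) ^ m) hn).symm.trans Xbar_pow_d
  rw [show P.d - 1 = n by omega, show Finset.range P.d = Finset.range (n + 1) by rw [hn],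
    Finset.mul_sum, Finset.sum_range_succ, Finset.sum_range_succ']
  simp only [Nat.add_eq_zero_iff, one_ne_zero, and_false, if_false, Nat.add_sub_cancel,
    if_true, pow_zero, mul_one, scal_neg]
  congr 1
  · exact Finset.sum_congr rfl fun i _ => by ring
  · linear_combination scal (coeff x n) * h2

theorem coeff_Xbar_mul_zero (x : P.R) : coeff (Xbar * x) 0 = -coeff x (P.d - 1) := by
  have h := coeff_ofCoeffs (P := P) (fun i : Fin P.d =>
    if (i : ℕ) = 0 then -coeff x (P.d - 1) else coeff x (i - 1)) ⟨0, P.d_pos⟩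
  rw [Xbar_mul_eq]
  simpa using h

theorem coeff_Xbar_mul_succ (x : P.R) {i : ℕ} (hi : i + 1 < P.d) :
    coeff (Xbar * x) (i + 1) = coeff x i := by
  have h := coeff_ofCoeffs (P := P) (fun i : Fin P.d =>
    if (i : ℕ) = 0 then -coeff x (P.d - 1) else coeff x (i - 1)) ⟨i + 1, hi⟩
  rw [Xbar_mul_eq]
  simpa using h

/-! ### The automorphism `σ₋₁` -/

theorem Xbar_mul_inv : (Xbar : P.R) * (-Xbar ^ (P.d - 1)) = 1 := by
  have h : (Xbar : P.R) * Xbar ^ (P.d - 1) = -1 := by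
    rw [← pow_succ', Nat.sub_add_cancel P.d_pos, Xbar_pow_d]
  rw [mul_neg, h, neg_neg]

theorem Xinv_pow_d : (-(Xbar : P.R) ^ (P.d - 1)) ^ P.d = -1 := by
  have h : (Xbar * (-Xbar ^ (P.d - 1)) : P.R) ^ P.d = 1 := by rw [Xbar_mul_inv, one_pow]
  rw [mul_pow, Xbar_pow_d] at h
  linear_combination -h

/-- `σ₋₁` as a ring homomorphism. -/
def conjHom (P : Params) : P.R →+* P.R :=
  AdjoinRoot.lift (AdjoinRoot.of _) (-Xbar ^ (P.d - 1)) (by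
    rw [eval₂_add, eval₂_pow, eval₂_X, eval₂_one, Xinv_pow_d]
    ring)

theorem conj_eq (x : P.R) : conj x = conjHom P x := by
  conv_rhs => rw [← ofCoeffs_coeff x]
  simp [ofCoeffs, conj, conjHom, scal, Xbar]

theorem conj_add (x y : P.R) : conj (x + y) = conj x + conj y := by simp [conj_eq]

theorem conj_mul (x y : P.R) : conj (x * y) = conj x * conj y := by simp [conj_eq]

theorem conj_neg (x : P.R) : conj (-x) = -conj x := by simp [conj_eq]

theorem conj_sum {ι : Type} (s : Finset ι) (f : ι → P.R) :
    conj (∑ i ∈ s, f i) = ∑ i ∈ s, conj (f i) := by simp [conj_eq]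

theorem conj_scal (c : ZMod P.q) : conj (scal c : P.R) = scal c := by
  simp [conj_eq, conjHom, scal]

theorem conj_Xbar : conj (Xbar : P.R) = -Xbar ^ (P.d - 1) := by
  simp [conj_eq, conjHom, Xbar]

/-- `conj (X ^ i)` is the inverse of `X ^ i`, hence a shift down by `i`; as `i + j < d`, no sign
change from wrapping occurs. -/
theorem coeff_conj_Xbar_pow_mul (y : P.R) (i j : ℕ) (h : i + j < P.d) :
    coeff (conj (Xbar ^ i) * y) j = coeff y (i + j) := by
  induction i generalizing j with
  | zero => simp [conj_eq]
  | succ i ih =>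
    rw [show i + 1 + j = i + (j + 1) by ring, ← ih (j + 1) (by omega),
      ← coeff_Xbar_mul_succ _ (by omega)]
    congr 1
    have h1 : (Xbar : P.R) * conj Xbar = 1 := by rw [conj_Xbar, Xbar_mul_inv]
    rw [pow_succ, conj_mul]
    linear_combination (conj (Xbar ^ i) * y) * h1

/-- The constant coefficient of `σ₋₁(x) y` is the inner product of the coefficient vectors. -/
theorem coeff_conj_mul (x y : P.R) :
    coeff (conj x * y) 0 = ∑ k : Fin P.d, coeff x k * coeff y k := by
  conv_lhs => rw [← ofCoeffs_coeff x]
  rw [ofCoeffs, conj_sum, Finset.sum_mul, coeff_sum]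
  refine Finset.sum_congr rfl fun i _ => ?_
  rw [conj_mul, conj_scal, mul_assoc, coeff_scal_mul, coeff_conj_Xbar_pow_mul y i 0 i.2, add_zero]

/-! ### Centred representatives -/

theorem coeff_red (f : Fin P.d → ℤ) (i : Fin P.d) : coeff (red f : P.R) i = (f i : ZMod P.q) :=
  coeff_ofCoeffs _ i

theorem red_lift (x : P.R) : red (lift x) = x :=
  ext_coeff fun i => by rw [coeff_red, lift, ZMod.coe_valMinAbs]

theorem red_add (f g : Fin P.d → ℤ) : (red (f + g) : P.R) = red f + red g :=
  ext_coeff fun i => by simp [coeff_red, coeff_add]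

/-- The centred representative is the shortest in its class: another one differs from it by at least
`q`, while it has size at most `q / 2`. All norm inequalities modulo `q` reduce to integer
inequalities through this. -/
theorem abs_valMinAbs_le {q : ℕ} [NeZero q] (x : ZMod q) (k : ℤ) (h : (k : ZMod q) = x) :
    |x.valMinAbs| ≤ |k| := by
  have h1 := ZMod.natAbs_valMinAbs_le x
  have h2 : (q : ℤ) ∣ k - x.valMinAbs := by
    rw [← ZMod.intCast_zmod_eq_zero_iff_dvd]
    push_cast
    rw [h, sub_self]
  by_cases h3 : k - x.valMinAbs = 0
  · rw [sub_eq_zero.mp h3]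
  · have h4 := Int.le_of_dvd (abs_pos.mpr h3) ((dvd_abs _ _).mpr h2)
    have h5 : |k - x.valMinAbs| ≤ |k| + |x.valMinAbs| := abs_sub k _
    have h6 : |x.valMinAbs| = (x.valMinAbs.natAbs : ℤ) := Int.abs_eq_natAbs _
    omega

theorem abs_lift_red_le (f : Fin P.d → ℤ) (k : Fin P.d) : |lift (red f : P.R) k| ≤ |f k| :=
  abs_valMinAbs_le _ _ (coeff_red f k).symm

theorem abs_lift_add_le (x y : P.R) (k : Fin P.d) : |lift (x + y) k| ≤ |lift x k + lift y k| :=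
  abs_valMinAbs_le _ _ (by simp [lift, coeff_add])

theorem abs_lift_neg (x : P.R) (k : Fin P.d) : |lift (-x) k| = |lift x k| := by
  rw [lift, lift, coeff_neg, Int.abs_eq_natAbs, ZMod.natAbs_valMinAbs_neg, Int.abs_eq_natAbs]

/-! ### Norms -/

section Norm

variable {ι : Type} [Fintype ι]

theorem nrm_nonneg (x : ι → P.R) : 0 ≤ nrm x := Real.sqrt_nonneg _

theorem nrm_sq (x : ι → P.R) : nrm x ^ 2 = ∑ i, ∑ k, (lift (x i) k : ℝ) ^ 2 :=
  Real.sq_sqrt (Finset.sum_nonneg fun _ _ => Finset.sum_nonneg fun _ _ => sq_nonneg _)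

theorem nrm_le_of_sq_le {x : ι → P.R} {b : ℝ} (hb : 0 ≤ b)
    (h : ∑ i, ∑ k, (lift (x i) k : ℝ) ^ 2 ≤ b ^ 2) : nrm x ≤ b :=
  Real.sqrt_le_iff.mpr ⟨hb, h⟩

/-- The centred coefficients as a Euclidean vector. -/
def euclid (x : ι → P.R) : EuclideanSpace ℝ (ι × Fin P.d) :=
  WithLp.toLp 2 fun p => (lift (x p.1) p.2 : ℝ)

theorem norm_euclid (x : ι → P.R) : ‖euclid x‖ = nrm x := by
  rw [EuclideanSpace.norm_eq, nrm, Fintype.sum_prod_type]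
  simp [euclid]

theorem nrm_add_le (x y : ι → P.R) : nrm (x + y) ≤ nrm x + nrm y := by
  rw [← norm_euclid x, ← norm_euclid y]
  refine le_trans ?_ (norm_add_le _ _)
  rw [EuclideanSpace.norm_eq, nrm, Fintype.sum_prod_type]
  refine Real.sqrt_le_sqrt (Finset.sum_le_sum fun i _ => Finset.sum_le_sum fun k _ => ?_)
  rw [Real.norm_eq_abs, sq_abs]
  refine sq_le_sq.mpr ?_
  have h := abs_lift_add_le (x i) (y i) k
  simpa [euclid] using (by exact_mod_cast h :
    |(lift (x i + y i) k : ℝ)| ≤ |(lift (x i) k : ℝ) + lift (y i) k|)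

theorem nrm_neg (x : ι → P.R) : nrm (-x) = nrm x := by
  unfold nrm
  congr 1
  refine Finset.sum_congr rfl fun i _ => Finset.sum_congr rfl fun k _ => ?_
  rw [sq_eq_sq_iff_abs_eq_abs]
  exact_mod_cast abs_lift_neg (x i) k

theorem nrm_sub_le (x y : ι → P.R) : nrm (x - y) ≤ nrm x + nrm y := by
  rw [sub_eq_add_neg, ← nrm_neg y]
  exact nrm_add_le _ _

theorem nrm_zero : nrm (0 : ι → P.R) = 0 := by
  simp [nrm, lift, coeff_zero]

theorem nrm_sum_le {κ : Type} (s : Finset κ) (f : κ → ι → P.R) :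
    nrm (fun j => ∑ i ∈ s, f i j) ≤ ∑ i ∈ s, nrm (f i) := by
  classical
  induction s using Finset.induction_on with
  | empty =>
    simp only [Finset.sum_empty]
    exact nrm_zero.le
  | insert a s ha ih =>
    simp only [Finset.sum_insert ha]
    exact (nrm_add_le (f a) fun j => ∑ i ∈ s, f i j).trans (by gcongr)

theorem nrm_scal_mul_le (c : ZMod P.q) (x : ι → P.R) :
    nrm (fun j => scal c * x j) ≤ |(c.valMinAbs : ℝ)| * nrm x := by
  refine nrm_le_of_sq_le (mul_nonneg (abs_nonneg _) (nrm_nonneg x)) ?_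
  rw [mul_pow, nrm_sq, Finset.mul_sum]
  refine Finset.sum_le_sum fun i _ => ?_
  rw [Finset.mul_sum]
  refine Finset.sum_le_sum fun k _ => ?_
  rw [sq_abs, ← mul_pow]
  refine sq_le_sq.mpr ?_
  have h : |lift (scal c * x i) k| ≤ |c.valMinAbs * lift (x i) k| :=
    abs_valMinAbs_le _ _ (by simp [lift, coeff_scal_mul])
  exact_mod_cast h

/-- A negacyclic shift permutes the centred coefficients up to sign. -/
theorem sum_sq_lift_Xbar_mul (x : P.R) :
    ∑ k, (lift (Xbar * x) k : ℝ) ^ 2 = ∑ k, (lift x k : ℝ) ^ 2 := by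
  obtain ⟨n, hn⟩ : ∃ n, P.d = n + 1 := ⟨P.d - 1, by have := P.d_pos; omega⟩
  have h1 : ∀ y : P.R, ∑ k, (lift y k : ℝ) ^ 2
      = ∑ k ∈ Finset.range (n + 1), ((coeff y k).valMinAbs : ℝ) ^ 2 := fun y => by
    rw [← hn, Finset.sum_range fun k => ((coeff y k).valMinAbs : ℝ) ^ 2]; rfl
  rw [h1, h1, Finset.sum_range_succ', Finset.sum_range_succ]
  congr 1
  · refine Finset.sum_congr rfl fun k hk => ?_
    rw [coeff_Xbar_mul_succ]
    have := Finset.mem_range.mp hk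
    omega
  · rw [coeff_Xbar_mul_zero, show P.d - 1 = n by omega, sq_eq_sq_iff_abs_eq_abs]
    have h := ZMod.natAbs_valMinAbs_neg (coeff x n)
    rw [← Int.cast_abs, ← Int.cast_abs, Int.abs_eq_natAbs, h, Int.abs_eq_natAbs]

theorem nrm_Xbar_pow_mul (i : ℕ) (x : ι → P.R) : nrm (fun j => Xbar ^ i * x j) = nrm x := by
  induction i with
  | zero => simp
  | succ i ih =>
    rw [← ih]
    unfold nrm
    congr 1
    refine Finset.sum_congr rfl fun j _ => ?_
    simpa only [pow_succ', mul_assoc] using sum_sq_lift_Xbar_mul (Xbar ^ i * x j)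

/-- Expand `c` in powers of `X`, each of which is an isometry, and apply the triangle inequality. -/
theorem nrm_mul_le (c : P.R) (x : ι → P.R) : nrm (fun j => c * x j) ≤ nrm1 c * nrm x := by
  have h : (fun j => c * x j)
      = fun j => ∑ k : Fin P.d, scal (coeff c k) * (Xbar ^ (k : ℕ) * x j) := by
    funext j
    conv_lhs => rw [← ofCoeffs_coeff c]
    rw [ofCoeffs, Finset.sum_mul]
    exact Finset.sum_congr rfl fun k _ => by ring
  rw [h, nrm1, Finset.sum_mul]
  refine (nrm_sum_le _ _).trans (Finset.sum_le_sum fun k _ => ?_)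
  refine (nrm_scal_mul_le _ _).trans ?_
  rw [nrm_Xbar_pow_mul]
  rfl

theorem nrm1_sub_le (x y : P.R) : nrm1 (x - y) ≤ nrm1 x + nrm1 y := by
  unfold nrm1
  rw [← Finset.sum_add_distrib]
  refine Finset.sum_le_sum fun k _ => ?_
  have h1 : |lift (x - y) k| ≤ |lift x k - lift y k| :=
    abs_valMinAbs_le _ _ (by simp [lift, coeff_sub])
  have h2 : |lift (x - y) k| ≤ |lift x k| + |lift y k| := h1.trans (abs_sub _ _)
  exact_mod_cast h2

theorem nrm_red_le (f : ι → Fin P.d → ℤ) :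
    nrm (fun i => (red (f i) : P.R)) ≤ √(∑ i, ∑ k, (f i k : ℝ) ^ 2) := by
  refine Real.sqrt_le_sqrt (Finset.sum_le_sum fun i _ => Finset.sum_le_sum fun k _ => ?_)
  exact sq_le_sq.mpr (by exact_mod_cast abs_lift_red_le (f i) k)

end Norm

end RingBasics


/-! ### The discrete Gaussian -/

section Gauss

theorem exp_neg_pi_sq {s : ℝ} (hs : 0 < s) (z : ℤ) :
    Real.exp (-Real.pi * (1 / (2 * Real.pi * s ^ 2)) * (z : ℝ) ^ 2)
      = Real.exp (-(z : ℝ) ^ 2 / (2 * s ^ 2)) := by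
  congr 1
  have := Real.pi_pos.ne'
  field_simp

/-- Poisson summation bounds shifted Gaussian sums by centred ones. -/
theorem tsum_gauss_mgf {s : ℝ} (hs : 0 < s) (t : ℝ) :
    Summable (fun z : ℤ => Real.exp (-(z : ℝ) ^ 2 / (2 * s ^ 2) + t * z)) ∧
    ∑' z : ℤ, Real.exp (-(z : ℝ) ^ 2 / (2 * s ^ 2) + t * z)
      ≤ Real.exp (s ^ 2 * t ^ 2 / 2) * ∑' z : ℤ, Real.exp (-(z : ℝ) ^ 2 / (2 * s ^ 2)) := by
  have hpi := Real.pi_pos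
  set a : ℝ := 1 / (2 * Real.pi * s ^ 2) with ha
  have ha0 : 0 < a := by positivity
  set b : ℝ := t / (2 * Real.pi) with hb
  have hsum : Summable (fun z : ℤ => Real.exp (-(z : ℝ) ^ 2 / (2 * s ^ 2) + t * z)) := by
    -- Completing the square dominates the tilted weight by a multiple of the Gaussian weight of
    -- width `2 * s`.
    have h1 := summable_gauss (s := 2 * s) (by positivity)
    refine Summable.of_nonneg_of_le (fun _ => (Real.exp_pos _).le) (fun z => ?_)
      (h1.mul_left (Real.exp (s ^ 2 * t ^ 2 * 2)))
    rw [← Real.exp_add]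
    refine Real.exp_le_exp.mpr ?_
    have h2 : s ^ 2 * t ^ 2 * 2 + -(z : ℝ) ^ 2 / (2 * (2 * s) ^ 2)
        - (-(z : ℝ) ^ 2 / (2 * s ^ 2) + t * z)
        = (z / s - 4 / 3 * s * t) ^ 2 * (3 / 8) + 4 / 3 * (s * t) ^ 2 := by
      field_simp
      ring
    nlinarith [sq_nonneg ((z : ℝ) / s - 4 / 3 * s * t), sq_nonneg (s * t)]
  refine ⟨hsum, ?_⟩
  -- In the dual sum the tilt becomes an imaginary shift: each term has modulus `exp (π b² / a) =
  -- exp (s² t² / 2)` times the dual term at `t = 0`, and discarding the phases gives the bound.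
  have hC := Complex.tsum_exp_neg_quadratic (a := (a : ℂ)) (by simpa using ha0) (b : ℂ)
  have hR := Real.tsum_exp_neg_mul_int_sq ha0
  have hL : ∑' n : ℤ, Complex.exp (-Real.pi * a * (n : ℂ) ^ 2 + 2 * Real.pi * b * (n : ℂ))
      = ((∑' z : ℤ, Real.exp (-(z : ℝ) ^ 2 / (2 * s ^ 2) + t * z) : ℝ) : ℂ) := by
    rw [Complex.ofReal_tsum]
    refine tsum_congr fun n => ?_
    rw [Complex.ofReal_exp]
    congr 1
    have h1 : -Real.pi * a * (n : ℝ) ^ 2 + 2 * Real.pi * b * n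
        = -(n : ℝ) ^ 2 / (2 * s ^ 2) + t * n := by
      rw [ha, hb]; field_simp
    rw [← h1]
    push_cast
    ring
  rw [hL] at hC
  have hnorm := congrArg norm hC
  rw [Complex.norm_real, Real.norm_of_nonneg (tsum_nonneg fun _ => (Real.exp_pos _).le)] at hnorm
  rw [hnorm, norm_mul]
  have h1 : ∀ n : ℤ, ‖Complex.exp (-Real.pi / a * ((n : ℂ) + Complex.I * b) ^ 2)‖
      = Real.exp (s ^ 2 * t ^ 2 / 2) * Real.exp (-Real.pi / a * (n : ℝ) ^ 2) := by
    intro n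
    rw [Complex.norm_exp, ← Real.exp_add]
    congr 1
    have h2 : (-Real.pi / a * ((n : ℂ) + Complex.I * b) ^ 2 : ℂ)
        = ((-Real.pi / a * ((n : ℝ) ^ 2 - b ^ 2) : ℝ) : ℂ)
          + ((-Real.pi / a * (2 * n * b) : ℝ) : ℂ) * Complex.I := by
      push_cast
      linear_combination (-Real.pi / a * (b : ℂ) ^ 2) * Complex.I_sq
    rw [h2, Complex.add_re, Complex.ofReal_re, Complex.re_ofReal_mul, Complex.I_re, mul_zero,
      add_zero, ha, hb]
    field_simp
    ring
  have h3 : Summable fun n : ℤ => Real.exp (-Real.pi / a * (n : ℝ) ^ 2) := by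
    have h4 := summable_gauss (s := 1 / (2 * Real.pi * s)) (by positivity)
    refine h4.congr fun n => ?_
    congr 1
    rw [ha]
    field_simp
  have h5 : ‖∑' n : ℤ, Complex.exp (-Real.pi / a * ((n : ℂ) + Complex.I * b) ^ 2)‖
      ≤ Real.exp (s ^ 2 * t ^ 2 / 2) * ∑' n : ℤ, Real.exp (-Real.pi / a * (n : ℝ) ^ 2) := by
    rw [← tsum_mul_left]
    refine (norm_tsum_le_tsum_norm ?_).trans (tsum_congr h1).le
    exact (h3.mul_left _).congr fun n => (h1 n).symm
  have h6 : ‖(1 / (a : ℂ) ^ (1 / 2 : ℂ))‖ = 1 / a ^ (1 / 2 : ℝ) := by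
    rw [norm_div, norm_one, Complex.norm_cpow_eq_rpow_re_of_pos ha0]
    norm_num
  have h7 : ∑' z : ℤ, Real.exp (-(z : ℝ) ^ 2 / (2 * s ^ 2))
      = 1 / a ^ (1 / 2 : ℝ) * ∑' n : ℤ, Real.exp (-Real.pi / a * (n : ℝ) ^ 2) := by
    rw [← hR]
    exact tsum_congr fun z => (exp_neg_pi_sq hs z).symm
  rw [h6, h7]
  calc _ ≤ 1 / a ^ (1 / 2 : ℝ) * (Real.exp (s ^ 2 * t ^ 2 / 2)
        * ∑' n : ℤ, Real.exp (-Real.pi / a * (n : ℝ) ^ 2)) := by gcongr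
    _ = _ := by ring

/-- The left side is a Gaussian sum of width `√2 * s`. By Poisson summation it equals `√2` times the
prefactor at width `s` times a dual Gaussian sum that is narrower, hence smaller. -/
theorem tsum_gauss_wide {s : ℝ} (hs : 0 < s) :
    ∑' z : ℤ, Real.exp (-(z : ℝ) ^ 2 / (2 * s ^ 2) + (z : ℝ) ^ 2 / (4 * s ^ 2))
      ≤ √2 * ∑' z : ℤ, Real.exp (-(z : ℝ) ^ 2 / (2 * s ^ 2)) := by
  have hpi := Real.pi_pos
  set a : ℝ := 1 / (2 * Real.pi * s ^ 2) with ha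
  have ha0 : 0 < a := by positivity
  have hR := Real.tsum_exp_neg_mul_int_sq ha0
  have hR2 := Real.tsum_exp_neg_mul_int_sq (a := a / 2) (by positivity)
  have h1 : ∑' z : ℤ, Real.exp (-(z : ℝ) ^ 2 / (2 * s ^ 2) + (z : ℝ) ^ 2 / (4 * s ^ 2))
      = ∑' z : ℤ, Real.exp (-Real.pi * (a / 2) * (z : ℝ) ^ 2) := by
    refine tsum_congr fun z => ?_
    congr 1
    rw [ha]
    field_simp
    ring
  have h2 : ∑' z : ℤ, Real.exp (-(z : ℝ) ^ 2 / (2 * s ^ 2))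
      = ∑' z : ℤ, Real.exp (-Real.pi * a * (z : ℝ) ^ 2) :=
    tsum_congr fun z => (exp_neg_pi_sq hs z).symm
  have hsm : ∀ c : ℝ, 0 < c → Summable fun n : ℤ => Real.exp (-Real.pi / c * (n : ℝ) ^ 2) := by
    intro c hc
    have h4 := summable_gauss (s := √(c / (2 * Real.pi))) (by positivity)
    refine h4.congr fun n => ?_
    congr 1
    rw [Real.sq_sqrt (by positivity)]
    field_simp
  rw [h1, h2, hR, hR2, ← mul_assoc]
  have h3 : 1 / (a / 2) ^ (1 / 2 : ℝ) = √2 * (1 / a ^ (1 / 2 : ℝ)) := by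
    rw [Real.div_rpow ha0.le (by norm_num), Real.sqrt_eq_rpow]
    field_simp
  rw [h3]
  refine mul_le_mul_of_nonneg_left ?_ (by positivity)
  refine (hsm (a / 2) (by positivity)).tsum_le_tsum (fun n => ?_) (hsm a ha0)
  refine Real.exp_le_exp.mpr ?_
  have : Real.pi / a * (n : ℝ) ^ 2 ≤ Real.pi / (a / 2) * (n : ℝ) ^ 2 := by
    gcongr
    linarith
  rw [neg_div, neg_div]
  linarith

theorem gaussPMF_apply {s : ℝ} (hs : 0 < s) (z : ℤ) :
    gaussPMF s z = gaussWeight s z * (∑' y, gaussWeight s y)⁻¹ := by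
  rw [gaussPMF, dif_pos hs]
  rfl

theorem tsum_gaussWeight {s : ℝ} (hs : 0 < s) : ∑' y, gaussWeight s y
    = ENNReal.ofReal (∑' z : ℤ, Real.exp (-(z : ℝ) ^ 2 / (2 * s ^ 2))) :=
  (ENNReal.ofReal_tsum_of_nonneg (fun _ => (Real.exp_pos _).le) (summable_gauss hs)).symm

theorem ev_gauss_exp_le {s : ℝ} (hs : 0 < s) (g : ℤ → ℝ) (M : ℝ) (hM : 0 ≤ M)
    (hsum : Summable fun z : ℤ => Real.exp (-(z : ℝ) ^ 2 / (2 * s ^ 2) + g z))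
    (h : ∑' z : ℤ, Real.exp (-(z : ℝ) ^ 2 / (2 * s ^ 2) + g z)
      ≤ M * ∑' z : ℤ, Real.exp (-(z : ℝ) ^ 2 / (2 * s ^ 2))) :
    ev (gaussPMF s) (fun z => ENNReal.ofReal (Real.exp (g z))) ≤ ENNReal.ofReal M := by
  have hpos : 0 < ∑' z : ℤ, Real.exp (-(z : ℝ) ^ 2 / (2 * s ^ 2)) :=
    (summable_gauss hs).tsum_pos (fun _ => (Real.exp_pos _).le) 0 (Real.exp_pos _)
  unfold ev
  simp only [gaussPMF_apply hs]
  have h1 : ∀ z : ℤ, gaussWeight s z * (∑' y, gaussWeight s y)⁻¹ * ENNReal.ofReal (Real.exp (g z))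
      = ENNReal.ofReal (Real.exp (-(z : ℝ) ^ 2 / (2 * s ^ 2) + g z))
        * (∑' y, gaussWeight s y)⁻¹ := fun z => by
    rw [Real.exp_add, ENNReal.ofReal_mul (Real.exp_pos _).le, gaussWeight]
    ring
  simp only [h1]
  rw [ENNReal.tsum_mul_right, ← ENNReal.ofReal_tsum_of_nonneg (fun _ => (Real.exp_pos _).le) hsum,
    tsum_gaussWeight hs, ← div_eq_mul_inv]
  refine ENNReal.div_le_of_le_mul ?_
  rw [← ENNReal.ofReal_mul hM]
  exact ENNReal.ofReal_le_ofReal h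

theorem ev_gauss_mgf {s : ℝ} (hs : 0 < s) (t : ℝ) :
    ev (gaussPMF s) (fun z => ENNReal.ofReal (Real.exp (t * z)))
      ≤ ENNReal.ofReal (Real.exp (s ^ 2 * t ^ 2 / 2)) :=
  ev_gauss_exp_le hs (fun z => t * z) _ (Real.exp_pos _).le (tsum_gauss_mgf hs t).1
    (tsum_gauss_mgf hs t).2

theorem ev_gauss_sq {s : ℝ} (hs : 0 < s) :
    ev (gaussPMF s) (fun z => ENNReal.ofReal (Real.exp ((z : ℝ) ^ 2 / (4 * s ^ 2))))
      ≤ ENNReal.ofReal √2 := by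
  refine ev_gauss_exp_le hs (fun z => (z : ℝ) ^ 2 / (4 * s ^ 2)) _ (Real.sqrt_nonneg _) ?_
    (tsum_gauss_wide hs)
  have h := summable_gauss (s := √2 * s) (by positivity)
  refine h.congr fun z => ?_
  congr 1
  rw [mul_pow, Real.sq_sqrt (by norm_num)]
  field_simp
  ring

end Gauss


/-! ### Gaussian vectors and rejection sampling -/

section Vec

variable {P : Params}

/-- Inner product of integer matrices. -/
def dot {m n : ℕ} (z v : Fin m → Fin n → ℤ) : ℝ := ∑ i, ∑ k, (z i k : ℝ) * (v i k : ℝ)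

/-- Squared norm of an integer matrix. -/
def sqn {m n : ℕ} (z : Fin m → Fin n → ℤ) : ℝ := ∑ i, ∑ k, (z i k : ℝ) ^ 2

theorem ofReal_exp_sum {ι : Type} (s : Finset ι) (f : ι → ℝ) :
    ENNReal.ofReal (Real.exp (∑ i ∈ s, f i)) = ∏ i ∈ s, ENNReal.ofReal (Real.exp (f i)) := by
  rw [Real.exp_sum, ENNReal.ofReal_prod_of_nonneg fun _ _ => (Real.exp_pos _).le]

theorem ev_pi_pi_exp_le {ι κ : Type} [Fintype ι] [Fintype κ] (p : PMF ℤ)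
    (g : ι → κ → ℤ → ℝ) (M : ι → κ → ℝ≥0∞)
    (h : ∀ i k, ev p (fun z => ENNReal.ofReal (Real.exp (g i k z))) ≤ M i k) :
    ev (piPMF fun _ : ι => piPMF fun _ : κ => p)
      (fun z => ENNReal.ofReal (Real.exp (∑ i, ∑ k, g i k (z i k)))) ≤ ∏ i, ∏ k, M i k := by
  simp only [ofReal_exp_sum]
  rw [ev_piPMF_prod _ fun i (x : κ → ℤ) => ∏ k, ENNReal.ofReal (Real.exp (g i k (x k)))]
  refine Finset.prod_le_prod' fun i _ => ?_
  rw [ev_piPMF_prod _ fun k (x : ℤ) => ENNReal.ofReal (Real.exp (g i k x))]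
  exact Finset.prod_le_prod' fun k _ => h i k

theorem ev_gaussVec_dot {s : ℝ} (hs : 0 < s) {n : ℕ} (t : ℝ) (v : Fin n → Fin P.d → ℤ) :
    ev (gaussVec P s n) (fun z => ENNReal.ofReal (Real.exp (t * dot z v)))
      ≤ ENNReal.ofReal (Real.exp (s ^ 2 * t ^ 2 * sqn v / 2)) := by
  have h := ev_pi_pi_exp_le (gaussPMF s) (fun (i : Fin n) (k : Fin P.d) z => t * v i k * z)
    (fun i k => ENNReal.ofReal (Real.exp (s ^ 2 * (t * v i k) ^ 2 / 2)))
    (fun i k => ev_gauss_mgf hs (t * v i k))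
  simp only [← ofReal_exp_sum] at h
  have e1 : ∀ z : Fin n → Fin P.d → ℤ, ∑ i, ∑ k, t * v i k * z i k = t * dot z v := fun z => by
    simp only [dot, Finset.mul_sum]
    exact Finset.sum_congr rfl fun i _ => Finset.sum_congr rfl fun k _ => by ring
  have e2 : ∑ i, ∑ k, s ^ 2 * (t * v i k) ^ 2 / 2 = s ^ 2 * t ^ 2 * sqn v / 2 := by
    simp only [sqn, Finset.mul_sum, Finset.sum_div]
    exact Finset.sum_congr rfl fun i _ => Finset.sum_congr rfl fun k _ => by ring
  simp only [e1, e2] at h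
  exact h

/-- Tail bound for the norm of a Gaussian vector. -/
theorem ev_gaussVec_tail {s : ℝ} (hs : 0 < s) (n : ℕ) (t : ℝ) :
    ev (gaussVec P s n) (fun z => ind (t * ((n * P.d : ℕ) : ℝ) * s ^ 2 < sqn z))
      ≤ ENNReal.ofReal ((√2 * Real.exp (-t / 4)) ^ (n * P.d)) := by
  have h := ev_pi_pi_exp_le (gaussPMF s) (fun (_ : Fin n) (_ : Fin P.d) z => (z : ℝ) ^ 2 / (4 * s ^ 2))
    (fun _ _ => ENNReal.ofReal √2) (fun _ _ => ev_gauss_sq hs)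
  simp only [Finset.prod_const, Finset.card_univ, Fintype.card_fin, ← pow_mul] at h
  have e1 : ∀ z : Fin n → Fin P.d → ℤ, ∑ i, ∑ k, (z i k : ℝ) ^ 2 / (4 * s ^ 2)
      = sqn z / (4 * s ^ 2) := fun z => by
    simp only [sqn, Finset.sum_div]
  simp only [e1] at h
  -- Markov's inequality for `exp (‖z‖² / (4 s²))`, whose mean is at most `√2` per coordinate.
  have h2 : ∀ z : Fin n → Fin P.d → ℤ, ind (t * ((n * P.d : ℕ) : ℝ) * s ^ 2 < sqn z)
      ≤ ENNReal.ofReal (Real.exp (-t / 4) ^ (n * P.d))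
        * ENNReal.ofReal (Real.exp (sqn z / (4 * s ^ 2))) := by
    intro z
    by_cases hz : t * ((n * P.d : ℕ) : ℝ) * s ^ 2 < sqn z
    · rw [ind_true hz, ← ENNReal.ofReal_mul (by positivity), ← Real.exp_nat_mul, ← Real.exp_add]
      rw [ENNReal.one_le_ofReal]
      refine Real.one_le_exp ?_
      have h3 : t * ((n * P.d : ℕ) : ℝ) / 4 ≤ sqn z / (4 * s ^ 2) := by
        rw [le_div_iff₀ (by positivity)]
        nlinarith
      linarith
    · rw [ind_false hz]
      exact zero_le
  refine (ev_mono _ h2).trans ?_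
  rw [ev_mul_left, mul_comm √2, mul_pow, ENNReal.ofReal_mul (by positivity),
    ENNReal.ofReal_pow (Real.sqrt_nonneg 2), mul_comm P.d n] at *
  gcongr
  exact h

/-- Exponent in the acceptance probability of a rejection step. -/
def rejExp {m n : ℕ} (s : ℝ) (z v : Fin m → Fin n → ℤ) : ℝ := (-2 * dot z v + sqn v) / (2 * s ^ 2)

/-- Acceptance probability of a rejection step. -/
def rejAcc {m n : ℕ} (s : ℝ) (z v : Fin m → Fin n → ℤ) : ℝ≥0∞ :=
  min 1 (ENNReal.ofReal (1 / 3 * Real.exp (rejExp s z v)))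

theorem ev_rej {m n : ℕ} (s : ℝ) (z v : Fin m → Fin n → ℤ) (g : Bool → ℝ≥0∞) :
    ev (rej s z v) g = rejAcc s z v * g true + (1 - rejAcc s z v) * g false :=
  ev_coin _ _ g

/-- Three times the density of the accepted vector with respect to the centred Gaussian. -/
def wt {m n : ℕ} (s : ℝ) (v z : Fin m → Fin n → ℤ) : ℝ≥0∞ :=
  min 1 (ENNReal.ofReal (3 * Real.exp (-rejExp s z v)))

theorem wt_le_one {m n : ℕ} (s : ℝ) (v z : Fin m → Fin n → ℤ) : wt s v z ≤ 1 := min_le_left _ _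

/-- With `ρ` the rejection exponent, `e^{-ρ} * min 1 (e^ρ / 3) = min 1 (3 e^{-ρ}) / 3`: the density
ratio caused by the shift is cancelled by the acceptance probability, except where it is clipped. -/
theorem rejAcc_mul {m n : ℕ} (s : ℝ) (z v : Fin m → Fin n → ℤ) :
    ENNReal.ofReal (Real.exp (-rejExp s z v)) * rejAcc s z v = ENNReal.ofReal (1 / 3) * wt s v z := by
  have h1 : rejAcc s z v = ENNReal.ofReal (min 1 (1 / 3 * Real.exp (rejExp s z v))) := by
    rw [rejAcc, ENNReal.ofReal_min, ENNReal.ofReal_one]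
  have h2 : wt s v z = ENNReal.ofReal (min 1 (3 * Real.exp (-rejExp s z v))) := by
    rw [wt, ENNReal.ofReal_min, ENNReal.ofReal_one]
  have h3 : Real.exp (-rejExp s z v) * Real.exp (rejExp s z v) = 1 := by
    rw [← Real.exp_add, neg_add_cancel, Real.exp_zero]
  rw [h1, h2, ← ENNReal.ofReal_mul (Real.exp_pos _).le, ← ENNReal.ofReal_mul (by norm_num)]
  congr 1
  rw [mul_min_of_nonneg _ _ (Real.exp_pos _).le, mul_min_of_nonneg _ _ (by norm_num), min_comm]
  congr 1
  · linear_combination (1 / 3 : ℝ) * h3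
  · ring

/-- The shift is integral, so both densities carry the same normalising constant and the ratio is a
pure exponential. -/
theorem gaussVec_sub_apply {s : ℝ} (hs : 0 < s) {n : ℕ} (z v : Fin n → Fin P.d → ℤ) :
    gaussVec P s n (z - v) = gaussVec P s n z * ENNReal.ofReal (Real.exp (-rejExp s z v)) := by
  have e : -rejExp s z v
      = ∑ i, ∑ k, ((z i k : ℝ) ^ 2 / (2 * s ^ 2) - ((z i k : ℝ) - v i k) ^ 2 / (2 * s ^ 2)) := by
    simp only [rejExp, dot, sqn, Finset.mul_sum, ← Finset.sum_add_distrib, Finset.sum_div,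
      ← Finset.sum_neg_distrib]
    exact Finset.sum_congr rfl fun i _ => Finset.sum_congr rfl fun k _ => by ring
  rw [e]
  simp only [ofReal_exp_sum, gaussVec, piPMF_apply, ← Finset.prod_mul_distrib]
  refine Finset.prod_congr rfl fun i _ => Finset.prod_congr rfl fun k _ => ?_
  rw [gaussPMF_apply hs, gaussPMF_apply hs, mul_right_comm]
  congr 1
  rw [gaussWeight, gaussWeight, ← ENNReal.ofReal_mul (Real.exp_pos _).le, ← Real.exp_add]
  congr 2
  simp only [Pi.sub_apply]
  push_cast
  ring

/-- Accepted outputs of a rejection step, in terms of the centred Gaussian. -/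
theorem ev_gaussVec_rej {s : ℝ} (hs : 0 < s) {n : ℕ} (v : Fin n → Fin P.d → ℤ)
    (F : (Fin n → Fin P.d → ℤ) → ℝ≥0∞) :
    ev (gaussVec P s n) (fun y => rejAcc s (y + v) v * F (y + v))
      = ENNReal.ofReal (1 / 3) * ev (gaussVec P s n) fun z => wt s v z * F z := by
  unfold ev
  rw [← (Equiv.subRight v).tsum_eq, ← ENNReal.tsum_mul_left]
  refine tsum_congr fun z => ?_
  simp only [Equiv.subRight_apply, sub_add_cancel]
  rw [gaussVec_sub_apply hs, ← mul_assoc, mul_assoc (gaussVec P s n z), rejAcc_mul]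
  ring

/-- Here `69` is an upper bound for `8256 / 121`, the exponent of a 128th moment for a shift of norm
`s / 11`. -/
theorem exp_num : Real.exp 69 ≤ 3 ^ 128 / 2 ^ 102 := by
  have h := Real.exp_one_lt_d9
  calc Real.exp 69 = Real.exp 1 ^ 69 := by rw [← Real.exp_nat_mul]; norm_num
    _ ≤ 2.7182818286 ^ 69 := by gcongr
    _ ≤ 3 ^ 128 / 2 ^ 102 := by norm_num

/-- The rejection step accepts with probability close to `1/3`. -/
theorem one_le_ev_wt {s : ℝ} (hs : 0 < s) {n : ℕ} (v : Fin n → Fin P.d → ℤ)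
    (hv : sqn v ≤ (s / 11) ^ 2) :
    1 ≤ ev (gaussVec P s n) (wt s v) + ENNReal.ofReal (1 / 2 ^ 102) := by
  -- Clipping occurs only where `e^ρ / 3 ≥ 1`, so `1 - wt` is at most `(e^ρ / 3) ^ 128`; the mean of
  -- this power is controlled by the Gaussian moment generating function.
  have h1 : ∀ z : Fin n → Fin P.d → ℤ, 1 ≤ wt s v z
      + ENNReal.ofReal (1 / 3 ^ 128 * Real.exp (64 * sqn v / s ^ 2))
        * ENNReal.ofReal (Real.exp (-(128 / s ^ 2) * dot z v)) := by
    intro z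
    rw [← ENNReal.ofReal_mul (by positivity), mul_assoc, ← Real.exp_add]
    have e : 64 * sqn v / s ^ 2 + -(128 / s ^ 2) * dot z v = (128 : ℕ) * rejExp s z v := by
      rw [rejExp]
      push_cast
      field_simp
      ring
    rw [e, Real.exp_nat_mul]
    rcases le_total 1 (3 * Real.exp (-rejExp s z v)) with h | h
    · rw [wt, min_eq_left (ENNReal.one_le_ofReal.mpr h)]
      exact le_self_add
    · refine le_trans ?_ le_add_self
      rw [ENNReal.one_le_ofReal]
      rw [Real.exp_neg] at h
      have h3 : 3 ≤ Real.exp (rejExp s z v) := by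
        rwa [← div_eq_mul_inv, div_le_one (Real.exp_pos _)] at h
      rw [one_div, inv_mul_eq_div, one_le_div (by positivity)]
      gcongr
  have h2 := ev_mono (gaussVec P s n) h1
  rw [ev_const, ev_add, ev_mul_left] at h2
  refine h2.trans ?_
  gcongr
  refine (mul_le_mul_right (ev_gaussVec_dot hs _ v) _).trans ?_
  rw [← ENNReal.ofReal_mul (by positivity), mul_assoc, ← Real.exp_add]
  refine ENNReal.ofReal_le_ofReal ?_
  -- `8256 = 64 + 128 ^ 2 / 2`, and `‖v‖² ≤ s² / 121`.
  have h3 : 64 * sqn v / s ^ 2 + s ^ 2 * (-(128 / s ^ 2)) ^ 2 * sqn v / 2 ≤ 69 := by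
    have h4 : 64 * sqn v / s ^ 2 + s ^ 2 * (-(128 / s ^ 2)) ^ 2 * sqn v / 2
        = 8256 * sqn v / s ^ 2 := by
      field_simp
      ring
    rw [h4, div_le_iff₀ (by positivity)]
    nlinarith [sq_nonneg s]
  calc _ ≤ 1 / 3 ^ 128 * Real.exp 69 := by gcongr
    _ ≤ 1 / 3 ^ 128 * (3 ^ 128 / 2 ^ 102) := by gcongr; exact exp_num
    _ = _ := by norm_num

theorem ev_wt_le_one {s : ℝ} {n : ℕ} (v : Fin n → Fin P.d → ℤ) :
    ev (gaussVec P s n) (wt s v) ≤ 1 := ev_le_const _ fun z _ => wt_le_one s v z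

end Vec

/-! ### The approximate range proof: norm of the image -/

section Bin

theorem ev_bin (f : ℤ → ℝ≥0∞) : ev binPMF f = 4⁻¹ * (f (-1) + f 0 + f 0 + f 1) := by
  have h : binPMF = (PMF.uniformOfFintype (Fin 2)).bind fun x =>
      (PMF.uniformOfFintype (Fin 2)).bind fun y => PMF.pure ((x.val : ℤ) - (y.val : ℤ)) := rfl
  rw [h]
  simp only [ev_bind, ev_pure, ev_uniform, Fin.sum_univ_two, Fintype.card_fin]
  have h4 : (4 : ℝ≥0∞)⁻¹ = 2⁻¹ * 2⁻¹ := by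
    rw [← ENNReal.mul_inv (by simp) (by simp)]; norm_num
  rw [h4]
  simp
  ring

/-- A difference of two fair bits has moment generating function `cosh (t / 2) ^ 2`, and `cosh u ≤
exp (u² / 2)`. -/
theorem ev_bin_exp (t : ℝ) : ev binPMF (fun z => ENNReal.ofReal (Real.exp (t * z)))
    ≤ ENNReal.ofReal (Real.exp (t ^ 2 / 4)) := by
  have h4 : (4 : ℝ≥0∞)⁻¹ = ENNReal.ofReal (1 / 4) := by
    rw [one_div, ENNReal.ofReal_inv_of_pos (by norm_num)]; norm_num
  rw [ev_bin, h4, ← ENNReal.ofReal_add (by positivity) (by positivity),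
    ← ENNReal.ofReal_add (by positivity) (by positivity),
    ← ENNReal.ofReal_add (by positivity) (by positivity), ← ENNReal.ofReal_mul (by positivity)]
  refine ENNReal.ofReal_le_ofReal ?_
  have h := Real.cosh_le_exp_half_sq (t / 2)
  have h0 : 0 < Real.cosh (t / 2) := Real.cosh_pos _
  have h1 : Real.cosh (t / 2) ^ 2 ≤ Real.exp (t ^ 2 / 4) := by
    calc _ ≤ Real.exp ((t / 2) ^ 2 / 2) ^ 2 := by gcongr
      _ = _ := by rw [← Real.exp_nat_mul]; congr 1; push_cast; ring
  refine le_trans (le_of_eq ?_) h1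
  rw [Real.cosh_eq]
  have e1 : Real.exp t = Real.exp (t / 2) ^ 2 := by rw [← Real.exp_nat_mul]; congr 1; push_cast; ring
  have e2 : Real.exp (-t) = Real.exp (-(t / 2)) ^ 2 := by
    rw [← Real.exp_nat_mul]; congr 1; push_cast; ring
  have e3 : Real.exp (t / 2) * Real.exp (-(t / 2)) = 1 := by
    rw [← Real.exp_add, add_neg_cancel, Real.exp_zero]
  have e4 : Real.exp (t * ((-1 : ℤ) : ℝ)) = Real.exp (-t) := by congr 1; push_cast; ring
  have e5 : Real.exp (t * ((1 : ℤ) : ℝ)) = Real.exp t := by congr 1; push_cast; ring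
  have e6 : Real.exp (t * ((0 : ℤ) : ℝ)) = 1 := by simp
  rw [e4, e5, e6, e1, e2]
  linear_combination (-1 / 2 : ℝ) * e3

open MeasureTheory in
/-- From a sub-Gaussian moment generating function to the square-exponential moment. -/
theorem ev_exp_sq_le {Ω : Type} [Countable Ω] (p : PMF Ω) (x : Ω → ℝ) {n : ℝ} (hn : 0 < n)
    (h : ∀ c : ℝ, ev p (fun w => ENNReal.ofReal (Real.exp (c * x w)))
      ≤ ENNReal.ofReal (Real.exp (c ^ 2 * n / 4))) :
    ev p (fun w => ENNReal.ofReal (Real.exp (x w ^ 2 / (2 * n)))) ≤ ENNReal.ofReal √2 := by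
  have hgauss : ∀ b : ℝ, 0 < b → ∫⁻ g : ℝ, ENNReal.ofReal (Real.exp (-b * g ^ 2))
      = ENNReal.ofReal √(Real.pi / b) := fun b hb => by
    rw [← integral_gaussian b, ofReal_integral_eq_lintegral_ofReal (integrable_exp_neg_mul_sq hb)]
    exact Filter.Eventually.of_forall fun _ => (Real.exp_pos _).le
  -- The square in the exponent is linearised: `exp (a²)` is a Gaussian average over `g` of `exp (2
  -- g a)`, to which the hypothesis on the moment generating function applies.
  have hrep : ∀ a : ℝ, ENNReal.ofReal √Real.pi * ENNReal.ofReal (Real.exp (a ^ 2))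
      = ∫⁻ g : ℝ, ENNReal.ofReal (Real.exp (-g ^ 2)) * ENNReal.ofReal (Real.exp (2 * g * a)) := by
    intro a
    have h1 := hgauss 1 one_pos
    rw [div_one] at h1
    rw [← h1, ← lintegral_sub_right_eq_self _ a, ← lintegral_mul_const']
    · refine lintegral_congr fun g => ?_
      rw [← ENNReal.ofReal_mul (Real.exp_pos _).le, ← ENNReal.ofReal_mul (Real.exp_pos _).le,
        ← Real.exp_add, ← Real.exp_add]
      congr 2
      ring
    · exact ENNReal.ofReal_ne_top
  have hpi : ENNReal.ofReal √Real.pi ≠ 0 := by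
    have := Real.sqrt_pos.mpr Real.pi_pos
    simpa using this
  rw [← ENNReal.mul_le_mul_iff_right hpi ENNReal.ofReal_ne_top, ← ev_mul_left]
  have e1 : ∀ w, x w ^ 2 / (2 * n) = (x w / √(2 * n)) ^ 2 := fun w => by
    rw [div_pow, Real.sq_sqrt (by positivity)]
  simp only [e1, hrep]
  have hswap : ev p (fun w => ∫⁻ g : ℝ, ENNReal.ofReal (Real.exp (-g ^ 2))
        * ENNReal.ofReal (Real.exp (2 * g * (x w / √(2 * n)))))
      = ∫⁻ g : ℝ, ENNReal.ofReal (Real.exp (-g ^ 2))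
        * ev p (fun w => ENNReal.ofReal (Real.exp (2 * g / √(2 * n) * x w))) := by
    unfold ev
    simp only [← ENNReal.tsum_mul_left]
    rw [lintegral_tsum]
    · refine tsum_congr fun w => ?_
      rw [← lintegral_const_mul]
      · refine lintegral_congr fun g => ?_
        rw [show 2 * g * (x w / √(2 * n)) = 2 * g / √(2 * n) * x w by ring]
        ring
      · fun_prop
    · intro w
      fun_prop
  rw [hswap]
  -- For `c = 2 g / √(2 n)` the hypothesis contributes `c² n / 4 = g² / 2`, leaving `exp (-g² / 2)`,
  -- whose integral is `√2 * √π`.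
  have h2 : ∀ g : ℝ, ENNReal.ofReal (Real.exp (-g ^ 2))
        * ev p (fun w => ENNReal.ofReal (Real.exp (2 * g / √(2 * n) * x w)))
      ≤ ENNReal.ofReal (Real.exp (-(1 / 2) * g ^ 2)) := fun g => by
    refine (mul_le_mul_right (h _) _).trans ?_
    rw [← ENNReal.ofReal_mul (Real.exp_pos _).le, ← Real.exp_add]
    refine le_of_eq ?_
    congr 2
    rw [div_pow, Real.sq_sqrt (by positivity)]
    field_simp
    ring
  refine (lintegral_mono h2).trans ?_
  rw [hgauss _ (by norm_num), ← ENNReal.ofReal_mul (Real.sqrt_nonneg _)]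
  refine ENNReal.ofReal_le_ofReal (le_of_eq ?_)
  rw [← Real.sqrt_mul Real.pi_pos.le]
  congr 1
  ring

end Bin


/-! ### Algebra of the relation -/

section Relation

variable {P : Params}

/-- The verifier evaluates the relation at values of the form `c * message + mask`; together with
`quad_comb` this expands it as a polynomial in `c`. -/
theorem lin_comb (e : Challenges P) (c : P.R) (b b' : Fin P.β → P.R) (y y' : Fin P.ν → P.R)
    (v v' : P.R) :
    lin e (fun α => c * b α + b' α) (fun k => c * y k + y' k) (c * v + v')
      = c * lin e b y v + lin e b' y' v' := by
  unfold lin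
  simp only [mul_add, Finset.mul_sum, Finset.sum_add_distrib, mul_sub, Finset.sum_sub_distrib]
  have h1 : ∀ a d : P.R, a * (c * d) = c * (a * d) := fun a d => by ring
  simp only [h1]
  ring

/-- Stability of `c` under `conj` is what makes the leading term `c ^ 2`, and not `conj c * c`. -/
theorem quad_comb (e : Challenges P) (c : P.R) (hc : conj c = c) (x y : Fin P.β → P.R) :
    quad e (fun α => c * x α + y α) (fun α => c * x α + y α)
      = c ^ 2 * quad e x x + c * (quad e x y + quad e y x) + quad e y y := by
  unfold quad
  simp only [conj_add, conj_mul, hc, Finset.mul_sum, ← Finset.sum_add_distrib]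
  exact Finset.sum_congr rfl fun α _ => by ring

/-- The scalar part of the challenges consists of scalars. -/
def ScalarChal (e : Challenges P) : Prop :=
  (∀ j, e (.dy j) = scal (coeff (e (.dy j)) 0)) ∧ (∀ α, e (.dbin α) = scal (coeff (e (.dbin α)) 0)) ∧
    ∀ j, e (.dval j) = scal (coeff (e (.dval j)) 0)

theorem sum_conj_unitVec (j : Fin P.ν × Fin P.d) (y : Fin P.ν → P.R) :
    coeff (∑ b, conj (unitVec j b) * y b) 0 = coeff (y j.1) j.2 := by
  rw [Finset.sum_eq_single j.1]
  · rw [unitVec, if_pos rfl, coeff_conj_Xbar_pow_mul _ _ _ (by simp), add_zero]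
  · intro b _ hb
    rw [unitVec, if_neg hb, conj_eq, map_zero, zero_mul]
  · simp

theorem sum_conj_eq_ip {n : ℕ} (x y : Fin n → P.R) :
    coeff (∑ α, conj (x α) * y α) 0 = ip x y := by
  rw [coeff_sum, ip]
  exact Finset.sum_congr rfl fun α _ => coeff_conj_mul _ _

theorem coeff_conj_negOnes_mul (x : P.R) :
    coeff (conj (negOnes P) * x) 0 = -∑ k : Fin P.d, coeff x k := by
  rw [negOnes, conj_neg, conj_sum, neg_mul, Finset.sum_mul, coeff_neg, coeff_sum,
    Finset.sum_range fun i => coeff (conj (Xbar ^ i) * x) 0]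
  congr 1
  refine Finset.sum_congr rfl fun k _ => ?_
  rw [coeff_conj_Xbar_pow_mul _ _ _ (by simp), add_zero]

theorem idx_lt (i : ℕ) (k : Fin P.a) (hi : i < P.β) : i + k * P.β < P.d := by
  have hk := k.2
  calc i + k * P.β < P.β + k * P.β := by omega
    _ = (k + 1) * P.β := by ring
    _ ≤ P.a * P.β := Nat.mul_le_mul_right _ hk
    _ = P.d := Nat.mul_comm _ _

theorem coeff_conj_powPoly_mul (k : Fin P.a) (x : P.R) :
    coeff (conj (powPoly P k) * x) 0
      = ∑ i ∈ Finset.range P.β, 2 ^ i * coeff x (i + k * P.β) := by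
  rw [powPoly, conj_sum, Finset.sum_mul, coeff_sum]
  refine Finset.sum_congr rfl fun i hi => ?_
  have h2 : (2 : P.R) ^ i = scal (2 ^ i) := by
    have := scal_natCast (P := P) (2 ^ i)
    push_cast at this
    exact this.symm
  rw [conj_mul, h2, conj_scal, mul_assoc, coeff_scal_mul,
    coeff_conj_Xbar_pow_mul _ _ _ (by simpa using idx_lt i k (Finset.mem_range.mp hi)), add_zero]

/-- Coefficient of `d_j` in the constant coefficient of the relation. -/
def gapY (e : Challenges P) (b : Fin P.β → P.R) (y z : Fin P.ν → P.R) (j : Fin P.ν × Fin P.d) :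
    ZMod P.q :=
  ip (fun α => e (.R j α)) b + coeff (y j.1) j.2 - coeff (z j.1) j.2

/-- Coefficient of `d'_α`. -/
def gapBin (b : Fin P.β → P.R) (α : Fin P.β) : ZMod P.q :=
  ∑ k : Fin P.d, (coeff (b α) k * coeff (b α) k - coeff (b α) k)

/-- Coefficient of `d''_j`. -/
def gapVal (b : Fin P.β → P.R) (v : P.R) (j : Fin P.d) : ZMod P.q :=
  ∑ i ∈ Finset.range P.β, 2 ^ i * coeff (b (Fin.divNat j)) (i + (Fin.modNat j : Fin P.a) * P.β)
    - coeff v j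

/-- Because the challenges `d_j, d'_α, d''_j` are scalars, they come out of the constant
coefficient, and `conj` turns products into inner products. The relation thus batches all the gaps
into one random linear combination: correctness of `z₂`, of the bits, and of their recomposition. -/
theorem coeff_relation (e : Challenges P) (he : ScalarChal e) (b : Fin P.β → P.R)
    (y z : Fin P.ν → P.R) (v : P.R) :
    coeff (lin e b y v + quad e b b - cst e z) 0
      = ∑ j, coeff (e (.dy j)) 0 * gapY e b y z j + ∑ α, coeff (e (.dbin α)) 0 * gapBin b α
        + ∑ j, coeff (e (.dval j)) 0 * gapVal b v j := by
  have h1 : coeff (lin e b y v) 0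
      = ∑ j, coeff (e (.dy j)) 0 * (ip (fun α => e (.R j α)) b + coeff (y j.1) j.2)
        + ∑ α, coeff (e (.dbin α)) 0 * (-∑ k : Fin P.d, coeff (b α) k)
        + ∑ j, coeff (e (.dval j)) 0 * gapVal b v j := by
    unfold lin
    rw [coeff_add, coeff_add, coeff_sum, coeff_sum, coeff_sum]
    congr 1
    · congr 1
      · refine Finset.sum_congr rfl fun j _ => ?_
        conv_lhs => rw [he.1 j]
        rw [coeff_scal_mul, coeff_add, sum_conj_unitVec, sum_conj_eq_ip]
      · refine Finset.sum_congr rfl fun j _ => ?_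
        conv_lhs => rw [he.2.1 j]
        rw [coeff_scal_mul, coeff_conj_negOnes_mul]
    · refine Finset.sum_congr rfl fun j _ => ?_
      conv_lhs => rw [he.2.2 j]
      rw [coeff_scal_mul, coeff_sub, coeff_conj_powPoly_mul,
        coeff_conj_Xbar_pow_mul _ _ _ (by simp), add_zero, gapVal]
  have h2 : coeff (quad e b b) 0
      = ∑ α, coeff (e (.dbin α)) 0 * ∑ k : Fin P.d, coeff (b α) k * coeff (b α) k := by
    unfold quad
    rw [coeff_sum]
    refine Finset.sum_congr rfl fun j _ => ?_
    conv_lhs => rw [he.2.1 j]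
    rw [coeff_scal_mul, coeff_conj_mul]
  have h3 : coeff (cst e z) 0 = ∑ j, coeff (e (.dy j)) 0 * coeff (z j.1) j.2 := by
    unfold cst
    rw [coeff_sum]
    refine Finset.sum_congr rfl fun j _ => ?_
    conv_lhs => rw [he.1 j]
    rw [coeff_scal_mul, sum_conj_unitVec]
  rw [coeff_sub, coeff_add, h1, h2, h3]
  simp only [gapY, gapBin, mul_sub, mul_add, Finset.sum_add_distrib, Finset.sum_sub_distrib,
    mul_neg, Finset.sum_neg_distrib]
  ring

theorem coeff_binPoly (v : P.R) (α : Fin P.β) (t : Fin P.d) : coeff (binPoly v α) t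
    = if (coeff v ((α : ℕ) * P.a + (t : ℕ) / P.β)).val.testBit ((t : ℕ) % P.β) then 1 else 0 :=
  coeff_ofCoeffs _ t

theorem gapBin_binPoly (v : P.R) (α : Fin P.β) : gapBin (binPoly v) α = 0 := by
  refine Finset.sum_eq_zero fun k _ => ?_
  rw [coeff_binPoly]
  split_ifs <;> simp

/-- Truncated binary expansion; for an asset below `2 ^ β` the reduction on the right is void. -/
theorem sum_testBit (n m : ℕ) :
    ∑ i ∈ Finset.range m, 2 ^ i * (if n.testBit i then 1 else 0) = n % 2 ^ m := by
  induction m with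
  | zero => simp [Nat.mod_one]
  | succ m ih =>
    rw [Finset.sum_range_succ, ih, Nat.mod_pow_succ, Nat.testBit_eq_decide_div_mod_eq]
    congr 1
    rcases Nat.mod_two_eq_zero_or_one (n / 2 ^ m) with h | h <;> simp [h]

theorem Params.β_pos (P : Params) : 0 < P.β :=
  Nat.pos_of_ne_zero fun h => P.d_ne_zero (by rw [Params.d, h, zero_mul])

theorem Params.a_pos (P : Params) : 0 < P.a :=
  Nat.pos_of_ne_zero fun h => P.d_ne_zero (by rw [Params.d, h, mul_zero])

theorem divNat_modNat (j : Fin P.d) :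
    (Fin.divNat j : Fin P.β) * P.a + (Fin.modNat j : Fin P.a) = (j : ℕ) := by
  rw [Fin.coe_divNat, Fin.coe_modNat]
  exact Nat.div_add_mod' _ _

theorem gapVal_binPoly (v : P.R) (hv : InRange v) (j : Fin P.d) :
    gapVal (binPoly v) v j = 0 := by
  have h1 : ∀ i ∈ Finset.range P.β,
      2 ^ i * coeff (binPoly v (Fin.divNat j)) (i + (Fin.modNat j : Fin P.a) * P.β)
      = ((2 ^ i * (if (coeff v j).val.testBit i then 1 else 0) : ℕ) : ZMod P.q) := by
    intro i hi
    have hi' := Finset.mem_range.mp hi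
    have h := coeff_binPoly v (Fin.divNat j) ⟨_, idx_lt i (Fin.modNat j) hi'⟩
    simp only at h
    rw [h, Nat.add_mul_div_right _ _ P.β_pos, Nat.div_eq_of_lt hi', zero_add, divNat_modNat,
      Nat.add_mul_mod_self_right, Nat.mod_eq_of_lt hi']
    push_cast
    split_ifs <;> simp
  rw [gapVal, Finset.sum_congr rfl h1, ← Nat.cast_sum, sum_testBit, Nat.mod_eq_of_lt (hv j),
    ZMod.natCast_zmod_val, sub_self]

end Relation

/-! ### Transcripts determined by the masked openings -/

section Masked

variable {P : Params}

/-- Right-hand side of the verification equation. -/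
def verifyRhs (x : Stmt P) (K : AuxKey P) (e : Challenges P) (u : Row P → P.R) (h : P.R)
    (z₁ : Fin P.n₁ → P.R) (z₂ : Fin P.ν → P.R) (z₃ : Fin P.n₃ → P.R) : P.R :=
  let c := e .c
  let zbin := fun α => c * u (.bin α) - K (.bin α) ⬝ᵥ z₁
  quad e zbin zbin + c * lin e zbin (fun b => c * u (.y₂ b) - K (.y₂ b) ⬝ᵥ z₁)
      (c * x (.com 2) - (fun j => x (.b 2 j)) ⬝ᵥ z₃) + c * (c * u .g - K .g ⬝ᵥ z₁)
    - c ^ 2 * (h + cst e z₂) - (c * u .g₁ - K .g₁ ⬝ᵥ z₁)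

/-- The messages determined by the auxiliary commitment `u`, the garbage opening `h`, and the
masked openings. -/
def maskedReply (x : Stmt P) (K : AuxKey P) (e : Challenges P) (u : Row P → P.R) (h : P.R)
    (z₁ : Fin P.n₁ → P.R) (z₂ : Fin P.ν → P.R) (z₃ : Fin P.n₃ → P.R) : Replies P :=
  fun i => match i with
    | .u₀ i => u (.a i)
    | .uy₂ b => u (.y₂ b)
    | .ug => u .g
    | .ubin α => u (.bin α)
    | .z₂ b => z₂ b
    | .h => h
    | .w₁ i => K (.a i) ⬝ᵥ z₁ - e .c * u (.a i)
    | .w₂ i => (fun j => x (.A i j)) ⬝ᵥ z₃ - e .c * x (.com₀ i)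
    | .v => verifyRhs x K e u h z₁ z₂ z₃
    | .ug₁ => u .g₁
    | .z₁ j => z₁ j
    | .z₃ j => z₃ j

/-- The messages `w₁`, `w₂` and `v` are defined by solving the verification equations, so only the
norm and constant-coefficient checks remain. -/
theorem accepts_masked (x : Stmt P) (K : AuxKey P) (e : Challenges P) (u : Row P → P.R) (h : P.R)
    (z₁ : Fin P.n₁ → P.R) (z₂ : Fin P.ν → P.R) (z₃ : Fin P.n₃ → P.R) :
    Accepts x K ⟨e, maskedReply x K e u h z₁ z₂ z₃⟩ ↔
      nrm z₁ ≤ P.bound₁ ∧ nrm z₃ ≤ P.bound₃ ∧ nrm z₂ ≤ P.bound₂ ∧ coeff h 0 = 0 := by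
  simp only [Accepts, maskedReply, sub_add_cancel, implies_true, and_true]
  constructor
  · rintro ⟨⟨h1, h2⟩, h3, h4, -⟩
    exact ⟨h1, h2, h3, h4⟩
  · rintro ⟨h1, h2, h3, h4⟩
    exact ⟨⟨h1, h2⟩, h3, h4, trivial, rfl⟩

/-- The messages committed to in the auxiliary commitment, computed from the masked openings and
from the products `t` of the key with the commitment randomness. -/
def payload (x : Stmt P) (K : AuxKey P) (r : Fin P.n₃ → P.R) (v g : P.R) (e : Challenges P)
    (t : Row P → P.R) (z₁ : Fin P.n₁ → P.R) (y₂ : Fin P.ν → P.R) (z₃ : Fin P.n₃ → P.R) :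
    Row P → P.R :=
  let vb := binPoly v
  let c := e .c
  let ybin := fun α => c * t (.bin α) - K (.bin α) ⬝ᵥ z₁
  let yy₂ := fun b => c * t (.y₂ b) - K (.y₂ b) ⬝ᵥ z₁
  let yg := c * t .g - K .g ⬝ᵥ z₁
  let yv := c * ((fun j => x (.b 2 j)) ⬝ᵥ r) - (fun j => x (.b 2 j)) ⬝ᵥ z₃
  fun i => match i with
    | .a _ => 0
    | .y₂ b => y₂ b
    | .g => g
    | .bin α => vb α
    | .g₁ => lin e ybin yy₂ yv + quad e vb ybin + quad e ybin vb + yg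

/-- The constant coefficient of the garbage opening vanishes for honest data. -/
def relVal (v : P.R) (e : Challenges P) (y₂ z₂ : Fin P.ν → P.R) : P.R :=
  lin e (binPoly v) y₂ v + quad e (binPoly v) (binPoly v) - cst e z₂

/-- From `z₁ = y₁ + c s`, the verifier's `c * u - K z₁` is `c * message - K y₁`. In the expansion of
its equation, `h` cancels the `c ^ 2` term and `g₁` the linear term, leaving the honest `v`. Hence
the masks can be eliminated in favour of the masked openings. -/
theorem honestReply_eq (x : Stmt P) (K : AuxKey P) (r : Fin P.n₃ → P.R) (m : Fin 3 → P.R)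
    (hx : Opens x r m) (g : P.R) (s : Fin P.n₁ → P.R) (y₁ : Fin P.n₁ → Fin P.d → ℤ)
    (y₂ : Fin P.ν → Fin P.d → ℤ) (y₃ : Fin P.n₃ → Fin P.d → ℤ) (e : Challenges P)
    (hc : conj (e .c) = e .c) :
    honestReply x K r (m 2) g s y₁ y₂ y₃ e =
      let z₁ := fun j => red (y₁ j) + e .c * s j
      let z₃ := fun j => red (y₃ j) + e .c * r j
      let z₂ : Fin P.ν → P.R := fun b => red (y₂ b + imageR e (binPoly (m 2)) b)
      let Y₂ : Fin P.ν → P.R := fun b => red (y₂ b)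
      let t := fun i => K i ⬝ᵥ s
      maskedReply x K e (fun i => t i + payload x K r (m 2) g e t z₁ Y₂ z₃ i)
        (g + relVal (m 2) e Y₂ z₂) z₁ z₂ z₃ := by
  have hdot : ∀ {n : ℕ} (a y s : Fin n → P.R) (c : P.R),
      a ⬝ᵥ (fun j => y j + c * s j) = a ⬝ᵥ y + c * (a ⬝ᵥ s) := fun a y s c => by
    simp only [dotProduct, mul_add, Finset.sum_add_distrib, Finset.mul_sum]
    congr 1
    exact Finset.sum_congr rfl fun i _ => by ring
  have h1 : ∀ a b c' : P.R, c' * b - (a + c' * b) = -a := fun a b c' => by ring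
  have h2 : ∀ a b d c' : P.R, c' * (b + d) - (a + c' * b) = c' * d + -a := fun a b d c' => by ring
  funext i
  cases i with
  | u₀ i => simp [honestReply, maskedReply, payload]
  | uy₂ b => simp [honestReply, maskedReply, payload]
  | ug => simp [honestReply, maskedReply, payload]
  | ubin α => simp [honestReply, maskedReply, payload]
  | z₂ b => simp [honestReply, maskedReply]
  | h => simp [honestReply, maskedReply, relVal]
  | w₁ i =>
    simp only [honestReply, maskedReply, payload, hdot]
    ring
  | w₂ i =>
    simp only [honestReply, maskedReply, hdot, hx.1 i]
    ring
  | ug₁ =>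
    simp only [honestReply, maskedReply, payload, hdot, h1]
  | z₁ j => simp [honestReply, maskedReply]
  | z₃ j => simp [honestReply, maskedReply]
  | v =>
    simp only [honestReply, maskedReply, verifyRhs, payload, hdot, h1, h2, hx.2 2,
      lin_comb, quad_comb e _ hc, relVal]
    ring

end Masked


/-! ### The distribution of the challenges, and the length of the projected bits -/

section Challenges

variable {P : Params}

theorem ev_pi_curry {ι κ α : Type} [Fintype ι] [Fintype κ] (p : ι × κ → PMF α)
    (f : (ι × κ → α) → ℝ≥0∞) :
    ev (piPMF p) f = ev (piPMF fun i => piPMF fun k => p (i, k)) fun x => f fun q => x q.1 q.2 := by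
  unfold ev
  rw [← (Equiv.curry ι κ α).symm.tsum_eq]
  refine tsum_congr fun x => ?_
  simp only [piPMF_apply, Fintype.prod_prod_type]
  rfl

/-- The distribution of one coordinate of the challenges. -/
def Setup.chalDist (S : Setup P) : ChalIdx P → PMF P.R
  | .R _ _ => polyPMF binPMF
  | .dy _ => scalPMF P
  | .dbin _ => scalPMF P
  | .dval _ => scalPMF P
  | .c => S.C

theorem challenges_eq (S : Setup P) : S.challenges = piPMF S.chalDist := by
  unfold Setup.challenges
  congr 1

theorem mem_support_scalPMF {x : P.R} (h : x ∈ (scalPMF P).support) : x = scal (coeff x 0) := by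
  rw [scalPMF, PMF.mem_support_map_iff] at h
  obtain ⟨c, -, rfl⟩ := h
  rw [coeff_scal]

theorem chal_support (S : Setup P) {e : Challenges P} (he : e ∈ S.challenges.support) (i) :
    e i ∈ (S.chalDist i).support := by
  rw [challenges_eq] at he
  exact (mem_support_piPMF _ _).mp he i

theorem scalarChal_of_mem (S : Setup P) {e : Challenges P} (he : e ∈ S.challenges.support) :
    ScalarChal e :=
  ⟨fun j => mem_support_scalPMF (chal_support S he (.dy j)),
    fun j => mem_support_scalPMF (chal_support S he (.dbin j)),
    fun j => mem_support_scalPMF (chal_support S he (.dval j))⟩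

theorem c_mem (S : Setup P) {e : Challenges P} (he : e ∈ S.challenges.support) :
    e .c ∈ S.C.support := chal_support S he .c

/-- Vectors of polynomials with independent integer coefficients. -/
theorem ev_pi_poly {ι : Type} [Fintype ι] (p : PMF ℤ) (f : (ι → P.R) → ℝ≥0∞) :
    ev (piPMF fun _ : ι => (polyPMF p : PMF P.R)) f
      = ev (piPMF fun _ : ι => piPMF fun _ : Fin P.d => p) fun y => f fun i => red (y i) := by
  unfold polyPMF
  rw [piPMF_map, ev_map]

theorem ip_red {n : ℕ} (x l : Fin n → Fin P.d → ℤ) (b : Fin n → P.R)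
    (hb : ∀ α k, coeff (b α) (k : Fin P.d) = ((l α k : ℤ) : ZMod P.q)) :
    ip (fun α => (red (x α) : P.R)) b = ((∑ α, ∑ k, x α k * l α k : ℤ) : ZMod P.q) := by
  unfold ip
  push_cast
  exact Finset.sum_congr rfl fun α _ => Finset.sum_congr rfl fun k _ => by rw [coeff_red, hb]

/-- One factor `√2` for each of the 256 rows, against the Markov factor at squared length `337`
times `β d`. -/
theorem exp_num_image : (√2) ^ 256 * Real.exp (-(337 / 2)) ≤ 1 / 2 ^ 102 := by
  have h1 : (√2) ^ 256 = 2 ^ 128 := by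
    rw [show 256 = 2 * 128 by norm_num, pow_mul, Real.sq_sqrt (by norm_num)]
  have h2 : (2 : ℝ) ^ 230 ≤ Real.exp (337 / 2) := by
    have h := Real.exp_one_gt_d9
    calc (2 : ℝ) ^ 230 ≤ 2.7 ^ 168 := by norm_num
      _ ≤ Real.exp 1 ^ 168 := by gcongr; linarith
      _ = Real.exp 168 := by rw [← Real.exp_nat_mul]; norm_num
      _ ≤ Real.exp (337 / 2) := Real.exp_le_exp.mpr (by norm_num)
  rw [h1, Real.exp_neg, ← div_eq_mul_inv, div_le_iff₀ (Real.exp_pos _)]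
  calc (2 : ℝ) ^ 128 = 1 / 2 ^ 102 * 2 ^ 230 := by norm_num
    _ ≤ _ := by gcongr

theorem ν_mul_d (P : Params) : P.ν * P.d = 256 := by
  rw [Nat.mul_comm]; exact P.dims

/-- The image of a binary vector under the projection matrix is short. -/
theorem ev_imageR_tail (S : Setup P) (b : Fin P.β → P.R) (l : Fin P.β → Fin P.d → ℤ)
    (hl : ∀ α k, l α k = 0 ∨ l α k = 1)
    (hb : ∀ α k, coeff (b α) (k : Fin P.d) = ((l α k : ℤ) : ZMod P.q)) :
    ev S.challenges (fun e => ind (337 * (P.β * P.d) < sqn (imageR e b)))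
      ≤ ENNReal.ofReal (1 / 2 ^ 102) := by
  set n : ℝ := (P.β * P.d : ℝ) with hn
  have hn0 : 0 < n := by
    have h1 := P.β_pos
    have h2 := P.d_pos
    positivity
  set G : (Fin P.β → P.R) → ℝ≥0∞ := fun x =>
    ENNReal.ofReal (Real.exp (((ip x b).valMinAbs : ℝ) ^ 2 / (2 * n))) with hG
  -- Markov's inequality for `exp (‖R l‖² / (2 n))`, which factors over the independent rows of `R`.
  have h1 : ∀ e : Challenges P, ind (337 * n < sqn (imageR e b))
      ≤ ENNReal.ofReal (Real.exp (-(337 / 2))) * ∏ j : Fin P.ν × Fin P.d, G fun α => e (.R j α) := by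
    intro e
    by_cases h : 337 * n < sqn (imageR e b)
    · rw [ind_true h, hG]
      simp only
      rw [← ofReal_exp_sum, ← ENNReal.ofReal_mul (Real.exp_pos _).le, ← Real.exp_add,
        ENNReal.one_le_ofReal]
      refine Real.one_le_exp ?_
      rw [← Finset.sum_div, Fintype.sum_prod_type]
      have h2 : 337 / 2 ≤ sqn (imageR e b) / (2 * n) := by
        rw [le_div_iff₀ (by positivity)]
        linarith
      have h3 : sqn (imageR e b) = ∑ x : Fin P.ν, ∑ y : Fin P.d,
          ((ip (fun α => e (.R (x, y) α)) b).valMinAbs : ℝ) ^ 2 := rfl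
      rw [← h3]
      linarith
    · rw [ind_false h]
      exact zero_le
  refine (ev_mono _ h1).trans ?_
  rw [ev_mul_left, challenges_eq]
  have h2 : ev (piPMF S.chalDist) (fun e => ∏ j : Fin P.ν × Fin P.d, G fun α => e (.R j α))
      = ∏ _j : Fin P.ν × Fin P.d, ev (piPMF fun _ : Fin P.β => (polyPMF binPMF : PMF P.R)) G := by
    have h3 := ev_pi_marginal S.chalDist
      (fun q : (Fin P.ν × Fin P.d) × Fin P.β => ChalIdx.R q.1 q.2)
      (fun q q' h => by
        cases q; cases q'
        simpa using h)
      (fun y => ∏ j : Fin P.ν × Fin P.d, G fun α => y (j, α))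
    rw [h3, ev_pi_curry]
    exact ev_piPMF_prod _ fun _ => G
  -- The centred residue is no longer than the integer inner product. As the entries of `l` are
  -- bits, that product has moment generating function at most `exp (c² n / 4)`, as `ev_exp_sq_le`
  -- requires.
  have h4 : ev (piPMF fun _ : Fin P.β => (polyPMF binPMF : PMF P.R)) G ≤ ENNReal.ofReal √2 := by
    rw [ev_pi_poly]
    refine le_trans (ev_mono _ fun y => ?_) (ev_exp_sq_le
      (piPMF fun _ : Fin P.β => piPMF fun _ : Fin P.d => binPMF)
      (fun y => ∑ α, ∑ k, (y α k : ℝ) * l α k) hn0 fun c => ?_)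
    · refine ENNReal.ofReal_le_ofReal (Real.exp_le_exp.mpr ?_)
      gcongr ?_ / _
      refine sq_le_sq.mpr ?_
      have h5 := abs_valMinAbs_le _ _ (ip_red y l b hb).symm
      exact_mod_cast h5
    · have h5 := ev_pi_pi_exp_le binPMF
        (fun (α : Fin P.β) (k : Fin P.d) z => c * l α k * z) _ fun α k => ev_bin_exp (c * l α k)
      have e1 : ∀ y : Fin P.β → Fin P.d → ℤ, ∑ α, ∑ k, c * l α k * y α k
          = c * ∑ α, ∑ k, (y α k : ℝ) * l α k := fun y => by
        simp only [Finset.mul_sum]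
        exact Finset.sum_congr rfl fun i _ => Finset.sum_congr rfl fun k _ => by ring
      simp only [e1, ← ofReal_exp_sum] at h5
      refine h5.trans (ENNReal.ofReal_le_ofReal (Real.exp_le_exp.mpr ?_))
      calc ∑ α, ∑ k, (c * l α k) ^ 2 / 4 ≤ ∑ _α : Fin P.β, ∑ _k : Fin P.d, c ^ 2 / 4 := by
            refine Finset.sum_le_sum fun α _ => Finset.sum_le_sum fun k _ => ?_
            rcases hl α k with h | h <;> simp [h]
            positivity
        _ = c ^ 2 * n / 4 := by
            simp only [Finset.sum_const, Finset.card_univ, Fintype.card_fin, nsmul_eq_mul, hn]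
            ring
  rw [h2, mul_comm]
  refine (mul_le_mul_left (Finset.prod_le_prod' fun _ _ => h4) _).trans ?_
  rw [Finset.prod_const, Finset.card_univ, Fintype.card_prod, Fintype.card_fin, Fintype.card_fin,
    ν_mul_d, ← ENNReal.ofReal_pow (Real.sqrt_nonneg 2), ← ENNReal.ofReal_mul (by positivity)]
  exact ENNReal.ofReal_le_ofReal exp_num_image

end Challenges

/-! ### Honest transcripts in terms of the masked openings -/

section Hybrid

variable {P : Params}

theorem ev_do_bind {α β : Type} (p : PMF α) (k : α → PMF β) (f : β → ℝ≥0∞) :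
    ev (p >>= k) f = ev p fun x => ev (k x) f := ev_bind p k f

theorem ev_do_pure {α : Type} (a : α) (f : α → ℝ≥0∞) : ev (pure a : PMF α) f = f a := ev_pure a f

/-- Distribution of the garbage polynomial. -/
def zeroConst (g : P.R) : P.R := g - scal (coeff g 0)

theorem coeff_zeroConst (g : P.R) : coeff (zeroConst g) 0 = 0 := by
  rw [zeroConst, coeff_sub, coeff_scal, sub_self]

/-- Reduction of an integer matrix. -/
def redV {n : ℕ} (z : Fin n → Fin P.d → ℤ) : Fin n → P.R := fun i => red (z i)

/-- Transcript determined by the masked openings `z₁, z₂, z₃`, the products `t` of the auxiliary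
key with the commitment randomness, the garbage polynomial `g` and the challenges `e`. -/
def hybrid (x : Stmt P) (K : AuxKey P) (r : Fin P.n₃ → P.R) (v g : P.R) (e : Challenges P)
    (t : Row P → P.R) (z₁ : Fin P.n₁ → P.R) (z₂ : Fin P.ν → P.R) (z₃ : Fin P.n₃ → P.R) :
    Transcript P :=
  let Y₂ := fun b => z₂ b - redV (imageR e (binPoly v)) b
  ⟨e, maskedReply x K e (fun i => t i + payload x K r v g e t z₁ Y₂ z₃ i)
    (g + relVal v e Y₂ z₂) z₁ z₂ z₃⟩

/-- Expectation over all the coins of an honest transcript, with Gaussian masked openings. -/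
def evHybrid (S : Setup P)
    (F : P.R → (Fin P.n₁ → P.R) → Challenges P → (Fin P.n₁ → Fin P.d → ℤ) →
      (Fin P.ν → Fin P.d → ℤ) → (Fin P.n₃ → Fin P.d → ℤ) → ℝ≥0∞) : ℝ≥0∞ :=
  ev (unifPMF P) fun g => ev (piPMF fun _ : Fin P.n₁ => (polyPMF S.χ : PMF P.R)) fun s =>
    ev S.challenges fun e => ev (gaussVec P P.s₁ P.n₁) fun z₁ => ev (gaussVec P P.s₂ P.ν) fun z₂ =>
      ev (gaussVec P P.s₃ P.n₃) fun z₃ => F (zeroConst g) s e z₁ z₂ z₃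

/-- Product of the rejection weights. -/
def wts (r : Fin P.n₃ → P.R) (v : P.R) (s : Fin P.n₁ → P.R) (e : Challenges P)
    (z₁ : Fin P.n₁ → Fin P.d → ℤ) (z₂ : Fin P.ν → Fin P.d → ℤ) (z₃ : Fin P.n₃ → Fin P.d → ℤ) :
    ℝ≥0∞ :=
  wt P.s₁ (fun j => lift (e .c * s j)) z₁ * wt P.s₂ (imageR e (binPoly v)) z₂
    * wt P.s₃ (fun j => lift (e .c * r j)) z₃

theorem Params.s₁_pos (P : Params) : 0 < P.s₁ := by
  have h1 := P.ω_pos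
  have h2 := P.d_pos
  unfold Params.s₁ Params.n₁
  positivity

theorem Params.s₂_pos (P : Params) : 0 < P.s₂ := by
  have h1 := P.β_pos
  have h2 := P.d_pos
  unfold Params.s₂
  positivity

theorem Params.s₃_pos (P : Params) : 0 < P.s₃ := by
  have h1 := P.ω_pos
  have h2 := P.d_pos
  unfold Params.s₃ Params.n₃
  positivity

/-- Each of the three masks is integrated against its rejection step by `ev_gaussVec_rej`, which
replaces it by a centred Gaussian opening with weight `wt` at the cost of a factor `1/3`. -/
theorem ev_honestRun (S : Setup P) (x : Stmt P) (K : AuxKey P) (r : Fin P.n₃ → P.R)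
    (m : Fin 3 → P.R) (hx : Opens x r m) (F : Option (Transcript P) → ℝ≥0∞) (hF : F none = 0) :
    ev (honestRun S x K r (m 2)) F = ENNReal.ofReal (1 / 27) *
      evHybrid S fun g s e z₁ z₂ z₃ => wts r (m 2) s e z₁ z₂ z₃ *
        F (some (hybrid x K r (m 2) g e (fun i => K i ⬝ᵥ s) (redV z₁) (redV z₂) (redV z₃))) := by
  have h27 : ENNReal.ofReal (1 / 27)
      = ENNReal.ofReal (1 / 3) * (ENNReal.ofReal (1 / 3) * ENNReal.ofReal (1 / 3)) := by
    rw [← ENNReal.ofReal_mul (by norm_num), ← ENNReal.ofReal_mul (by norm_num)]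
    norm_num
  unfold honestRun evHybrid
  simp only [ev_do_bind, ev_do_pure]
  rw [← ev_mul_left]
  congr 1
  funext g
  rw [← ev_mul_left]
  congr 1
  funext s
  -- The challenges are drawn before the masks: once they and `s` are fixed, the three shifts are
  -- constants.
  simp only [ev_comm (gaussVec P _ _) S.challenges]
  rw [← ev_mul_left]
  refine ev_congr_support _ fun e he => ?_
  have hc := S.C_conj _ (c_mem S he)
  obtain ⟨G, hG⟩ : ∃ G : (Fin P.n₁ → Fin P.d → ℤ) → (Fin P.ν → Fin P.d → ℤ) →
      (Fin P.n₃ → Fin P.d → ℤ) → ℝ≥0∞, G = fun z₁ z₂ z₃ => F (some (hybrid x K r (m 2)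
        (zeroConst g) e (fun i => K i ⬝ᵥ s) (redV z₁) (redV z₂) (redV z₃))) := ⟨_, rfl⟩
  have hgoal : ∀ (y₁ : Fin P.n₁ → Fin P.d → ℤ) (y₂ : Fin P.ν → Fin P.d → ℤ)
      (y₃ : Fin P.n₃ → Fin P.d → ℤ),
      F (some ⟨e, honestReply x K r (m 2) (g - scal (coeff g 0)) s y₁ y₂ y₃ e⟩)
      = G (y₁ + fun j => lift (e .c * s j)) (y₂ + imageR e (binPoly (m 2)))
          (y₃ + fun j => lift (e .c * r j)) := by
    intro y₁ y₂ y₃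
    rw [hG, honestReply_eq x K r m hx _ s y₁ y₂ y₃ e hc]
    have e1 : (redV (y₁ + fun j => lift (e .c * s j)) : Fin P.n₁ → P.R)
        = fun j => red (y₁ j) + e .c * s j := by
      funext j; rw [redV, Pi.add_apply, red_add, red_lift]
    have e3 : (redV (y₃ + fun j => lift (e .c * r j)) : Fin P.n₃ → P.R)
        = fun j => red (y₃ j) + e .c * r j := by
      funext j; rw [redV, Pi.add_apply, red_add, red_lift]
    have e2 : (fun b => redV (y₂ + imageR e (binPoly (m 2))) b
        - redV (imageR e (binPoly (m 2))) b : Fin P.ν → P.R) = fun b => red (y₂ b) := by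
      funext j; rw [redV, redV, Pi.add_apply, red_add, add_sub_cancel_right]
    simp only [hybrid, e1, e2, e3]
    rfl
  simp only [ev_rej, Bool.and_true, Bool.true_and, Bool.and_false, Bool.false_and, if_true,
    Bool.false_eq_true, if_false, hF, mul_zero, add_zero, hgoal]
  have step3 : ∀ (y₁ : Fin P.n₁ → Fin P.d → ℤ) (y₂ : Fin P.ν → Fin P.d → ℤ),
      ev (gaussVec P P.s₃ P.n₃) (fun y₃ => rejAcc P.s₂ (y₂ + imageR e (binPoly (m 2)))
          (imageR e (binPoly (m 2))) * (rejAcc P.s₁ (y₁ + fun j => lift (e .c * s j))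
          (fun j => lift (e .c * s j)) * (rejAcc P.s₃ (y₃ + fun j => lift (e .c * r j))
          (fun j => lift (e .c * r j)) * G (y₁ + fun j => lift (e .c * s j))
            (y₂ + imageR e (binPoly (m 2))) (y₃ + fun j => lift (e .c * r j)))))
      = rejAcc P.s₂ (y₂ + imageR e (binPoly (m 2))) (imageR e (binPoly (m 2))) *
        (rejAcc P.s₁ (y₁ + fun j => lift (e .c * s j)) (fun j => lift (e .c * s j)) *
        (ENNReal.ofReal (1 / 3) * ev (gaussVec P P.s₃ P.n₃) fun z₃ =>
          wt P.s₃ (fun j => lift (e .c * r j)) z₃ * G (y₁ + fun j => lift (e .c * s j))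
            (y₂ + imageR e (binPoly (m 2))) z₃)) := by
    intro y₁ y₂
    rw [ev_mul_left, ev_mul_left]
    congr 2
    exact ev_gaussVec_rej P.s₃_pos (fun j => lift (e .c * r j)) fun z₃ =>
      G (y₁ + fun j => lift (e .c * s j)) (y₂ + imageR e (binPoly (m 2))) z₃
  simp only [step3]
  have step2 := fun y₁ : Fin P.n₁ → Fin P.d → ℤ =>
    ev_gaussVec_rej P.s₂_pos (imageR e (binPoly (m 2))) fun z₂ =>
      (rejAcc P.s₁ (y₁ + fun j => lift (e .c * s j)) (fun j => lift (e .c * s j)) *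
        (ENNReal.ofReal (1 / 3) * ev (gaussVec P P.s₃ P.n₃) fun z₃ =>
          wt P.s₃ (fun j => lift (e .c * r j)) z₃ * G (y₁ + fun j => lift (e .c * s j)) z₂ z₃))
  beta_reduce at step2
  simp only [step2]
  simp only [mul_left_comm (wt P.s₂ _ _) (rejAcc P.s₁ _ _), ev_mul_left]
  have step1 := ev_gaussVec_rej P.s₁_pos (fun j => lift (e .c * s j)) fun z₁ =>
    ev (gaussVec P P.s₂ P.ν) fun z₂ =>
      wt P.s₂ (imageR e (binPoly (m 2))) z₂ * (ENNReal.ofReal (1 / 3) *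
        ev (gaussVec P P.s₃ P.n₃) fun z₃ => wt P.s₃ (fun j => lift (e .c * r j)) z₃ * G z₁ z₂ z₃)
  refine (congrArg (ENNReal.ofReal (1 / 3) * ·) step1).trans ?_
  rw [h27]
  simp only [← ev_mul_left]
  refine congrArg _ (funext fun z₁ => congrArg _ (funext fun z₂ => congrArg _ (funext fun z₃ => ?_)))
  rw [wts, hG]
  ring

end Hybrid


/-! ### The probability that no rejection step aborts -/

section Weights

variable {P : Params}

theorem nrm_ternary_le (S : Setup P) {n : ℕ} {s : Fin n → P.R}
    (hs : s ∈ (piPMF fun _ : Fin n => (polyPMF S.χ : PMF P.R)).support) :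
    nrm s ≤ √(n * P.d) := by
  refine Real.sqrt_le_sqrt ?_
  calc ∑ i, ∑ k, (lift (s i) k : ℝ) ^ 2 ≤ ∑ _i : Fin n, ∑ _k : Fin P.d, (1 : ℝ) := by
        refine Finset.sum_le_sum fun i _ => Finset.sum_le_sum fun k _ => ?_
        have h := (mem_support_piPMF _ _).mp hs i
        rw [polyPMF, PMF.mem_support_map_iff] at h
        obtain ⟨f, hf, hfs⟩ := h
        have h1 := S.χ_supp _ ((mem_support_piPMF _ _).mp hf k)
        have h2 : |lift (s i) k| ≤ 1 := by
          rw [← hfs]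
          refine (abs_lift_red_le f k).trans ?_
          rcases h1 with h | h | h <;> rw [h] <;> norm_num
        have h3 : |(lift (s i) k : ℝ)| ≤ 1 := by exact_mod_cast h2
        rw [← sq_abs]
        exact pow_le_one₀ (abs_nonneg _) h3
    _ = _ := by simp

theorem sqn_lift {n : ℕ} (x : Fin n → P.R) : sqn (fun j => lift (x j)) = nrm x ^ 2 :=
  (nrm_sq x).symm

theorem sqn_mul_le {n : ℕ} (c : P.R) (x : Fin n → P.R) (w B : ℝ) (hw : nrm1 c ≤ w)
    (hB : nrm x ≤ B) : sqn (fun j => lift (c * x j)) ≤ (w * B) ^ 2 := by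
  rw [sqn_lift fun j => c * x j]
  have h0 : 0 ≤ nrm1 c := Finset.sum_nonneg fun _ _ => abs_nonneg _
  exact pow_le_pow_left₀ (nrm_nonneg _)
    ((nrm_mul_le c x).trans (mul_le_mul hw hB (nrm_nonneg _) (h0.trans hw))) 2

/-- The exceptional event that the projection of the bits of `v` is long. -/
def LongImage (v : P.R) (e : Challenges P) : Prop :=
  337 * (P.β * P.d) < sqn (imageR e (binPoly v))

theorem ev_longImage (S : Setup P) (v : P.R) :
    ev S.challenges (fun e => ind (LongImage v e)) ≤ ENNReal.ofReal (1 / 2 ^ 102) := by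
  refine ev_imageR_tail S (binPoly v) (fun α t =>
    if (coeff v ((α : ℕ) * P.a + (t : ℕ) / P.β)).val.testBit ((t : ℕ) % P.β) then 1 else 0) ?_ ?_
  · intro α k
    split_ifs <;> simp
  · intro α k
    rw [coeff_binPoly]
    split_ifs <;> simp

/-- Each of the three rejection steps accepts with probability about `1/3`. -/
theorem one_le_wt₁ (S : Setup P) {s : Fin P.n₁ → P.R} {e : Challenges P}
    (hs : s ∈ (piPMF fun _ : Fin P.n₁ => (polyPMF S.χ : PMF P.R)).support)
    (he : e ∈ S.challenges.support) :
    1 ≤ ev (gaussVec P P.s₁ P.n₁) (wt P.s₁ fun j => lift (e .c * s j))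
      + ENNReal.ofReal (1 / 2 ^ 102) := by
  refine one_le_ev_wt P.s₁_pos _ ?_
  refine (sqn_mul_le _ _ _ _ (S.C_norm _ (c_mem S he)) (nrm_ternary_le S hs)).trans (le_of_eq ?_)
  rw [Params.s₁]
  ring

theorem one_le_wt₃ (S : Setup P) {r : Fin P.n₃ → P.R} {e : Challenges P}
    (hr : nrm r ≤ √(P.n₃ * P.d)) (he : e ∈ S.challenges.support) :
    1 ≤ ev (gaussVec P P.s₃ P.n₃) (wt P.s₃ fun j => lift (e .c * r j))
      + ENNReal.ofReal (1 / 2 ^ 102) := by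
  refine one_le_ev_wt P.s₃_pos _ ?_
  refine (sqn_mul_le _ _ _ _ (S.C_norm _ (c_mem S he)) hr).trans (le_of_eq ?_)
  rw [Params.s₃]
  ring

/-- No lower bound on the weight is claimed when the image is long; there the indicator alone pays.
-/
theorem one_le_wt₂ (v : P.R) (e : Challenges P) :
    1 ≤ ev (gaussVec P P.s₂ P.ν) (wt P.s₂ (imageR e (binPoly v)))
      + (ENNReal.ofReal (1 / 2 ^ 102) + ind (LongImage v e)) := by
  by_cases h : LongImage v e
  · rw [ind_true h]
    exact le_add_self.trans le_add_self
  · rw [ind_false h, add_zero]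
    refine one_le_ev_wt P.s₂_pos _ ?_
    rw [LongImage, not_lt] at h
    refine h.trans (le_of_eq ?_)
    rw [Params.s₂, mul_div_cancel_left₀ _ (by norm_num), Real.sq_sqrt (by positivity)]

/-- A union bound for a product of near-one quantities, in a form without subtraction. -/
theorem one_le_mul_add {a b x y : ℝ≥0∞} (ha : a ≤ 1) (hx : 1 ≤ a + x) (hy : 1 ≤ b + y) :
    1 ≤ a * b + (x + y) := by
  calc 1 ≤ a * 1 + x := by rwa [mul_one]
    _ ≤ a * (b + y) + x := by gcongr
    _ ≤ a * b + 1 * y + x := by rw [mul_add]; gcongr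
    _ = _ := by ring

theorem evHybrid_mono (S : Setup P) {F G : P.R → (Fin P.n₁ → P.R) → Challenges P →
      (Fin P.n₁ → Fin P.d → ℤ) → (Fin P.ν → Fin P.d → ℤ) → (Fin P.n₃ → Fin P.d → ℤ) → ℝ≥0∞}
    (h : ∀ g, ∀ s ∈ (piPMF fun _ : Fin P.n₁ => (polyPMF S.χ : PMF P.R)).support,
      ∀ e ∈ S.challenges.support, ∀ z₁ z₂ z₃,
      F (zeroConst g) s e z₁ z₂ z₃ ≤ G (zeroConst g) s e z₁ z₂ z₃) :
    evHybrid S F ≤ evHybrid S G :=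
  ev_mono _ fun g => ev_mono_support _ fun s hs => ev_mono_support _ fun e he =>
    ev_mono _ fun z₁ => ev_mono _ fun z₂ => ev_mono _ fun z₃ => h g s hs e he z₁ z₂ z₃

theorem evHybrid_add (S : Setup P) (F G : P.R → (Fin P.n₁ → P.R) → Challenges P →
      (Fin P.n₁ → Fin P.d → ℤ) → (Fin P.ν → Fin P.d → ℤ) → (Fin P.n₃ → Fin P.d → ℤ) → ℝ≥0∞) :
    evHybrid S (fun g s e z₁ z₂ z₃ => F g s e z₁ z₂ z₃ + G g s e z₁ z₂ z₃)
      = evHybrid S F + evHybrid S G := by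
  simp only [evHybrid, ev_add]

theorem evHybrid_const (S : Setup P) (c : ℝ≥0∞) : evHybrid S (fun _ _ _ _ _ _ => c) = c := by
  simp only [evHybrid, ev_const]

/-- The coins that are independent of the masks. -/
def evCoins (S : Setup P) (f : (Fin P.n₁ → P.R) → Challenges P → ℝ≥0∞) : ℝ≥0∞ :=
  ev (piPMF fun _ : Fin P.n₁ => (polyPMF S.χ : PMF P.R)) fun s => ev S.challenges fun e => f s e

theorem evCoins_mono (S : Setup P) {F G : (Fin P.n₁ → P.R) → Challenges P → ℝ≥0∞}
    (h : ∀ s ∈ (piPMF fun _ : Fin P.n₁ => (polyPMF S.χ : PMF P.R)).support,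
      ∀ e ∈ S.challenges.support, F s e ≤ G s e) : evCoins S F ≤ evCoins S G :=
  ev_mono_support _ fun s hs => ev_mono_support _ fun e he => h s hs e he

theorem evCoins_mul_left (S : Setup P) (c : ℝ≥0∞) (F : (Fin P.n₁ → P.R) → Challenges P → ℝ≥0∞) :
    evCoins S (fun s e => c * F s e) = c * evCoins S F := by
  simp only [evCoins, ev_mul_left]

/-- Product functions of the masked openings. -/
theorem evHybrid_prod (S : Setup P)
    (f₁ : (Fin P.n₁ → P.R) → Challenges P → (Fin P.n₁ → Fin P.d → ℤ) → ℝ≥0∞)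
    (f₂ : (Fin P.n₁ → P.R) → Challenges P → (Fin P.ν → Fin P.d → ℤ) → ℝ≥0∞)
    (f₃ : (Fin P.n₁ → P.R) → Challenges P → (Fin P.n₃ → Fin P.d → ℤ) → ℝ≥0∞) :
    evHybrid S (fun _ s e z₁ z₂ z₃ => f₁ s e z₁ * f₂ s e z₂ * f₃ s e z₃)
      = evCoins S fun s e => ev (gaussVec P P.s₁ P.n₁) (f₁ s e) *
        (ev (gaussVec P P.s₂ P.ν) (f₂ s e) * ev (gaussVec P P.s₃ P.n₃) (f₃ s e)) := by
  simp only [evHybrid, evCoins, mul_assoc, ev_mul_left, ev_mul_right, ev_const]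

/-- The honest prover does not abort with probability at least `(1 - 2⁻¹⁰⁰) / 27`. -/
theorem one_le_evHybrid_wts (S : Setup P) (r : Fin P.n₃ → P.R) (v : P.R)
    (hr : nrm r ≤ √(P.n₃ * P.d)) :
    1 ≤ evHybrid S (fun _ s e z₁ z₂ z₃ => wts r v s e z₁ z₂ z₃) + ENNReal.ofReal (1 / 2 ^ 100) := by
  have h1 := evHybrid_prod S (fun s e => wt P.s₁ fun j => lift (e .c * s j))
    (fun _ e => wt P.s₂ (imageR e (binPoly v))) (fun _ e => wt P.s₃ fun j => lift (e .c * r j))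
  simp only [wts]
  rw [h1]
  have h2 : evCoins S (fun _ _ => 1) ≤ evCoins S fun s e =>
      (ev (gaussVec P P.s₁ P.n₁) (wt P.s₁ fun j => lift (e .c * s j)) *
        (ev (gaussVec P P.s₂ P.ν) (wt P.s₂ (imageR e (binPoly v))) *
          ev (gaussVec P P.s₃ P.n₃) (wt P.s₃ fun j => lift (e .c * r j)))) +
      (ENNReal.ofReal (1 / 2 ^ 102) + ((ENNReal.ofReal (1 / 2 ^ 102) + ind (LongImage v e))
        + ENNReal.ofReal (1 / 2 ^ 102))) :=
    evCoins_mono S fun s hs e he => one_le_mul_add (ev_wt_le_one _) (one_le_wt₁ S hs he)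
      (one_le_mul_add (ev_wt_le_one _) (one_le_wt₂ v e) (one_le_wt₃ S hr he))
  simp only [evCoins, ev_const, ev_add] at h2 ⊢
  refine h2.trans ?_
  gcongr
  -- Four errors of `2⁻¹⁰²`: one for each rejection step and one for a long image.
  refine (add_le_add le_rfl (add_le_add (add_le_add le_rfl (ev_longImage S v)) le_rfl)).trans ?_
  rw [← ENNReal.ofReal_add (by positivity) (by positivity),
    ← ENNReal.ofReal_add (by positivity) (by positivity),
    ← ENNReal.ofReal_add (by positivity) (by positivity)]
  exact ENNReal.ofReal_le_ofReal (by norm_num)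

theorem Pr_isSome (S : Setup P) (x : Stmt P) (K : AuxKey P) (r : Fin P.n₃ → P.R)
    (m : Fin 3 → P.R) (hx : Opens x r m) :
    Pr (honestRun S x K r (m 2)) {o | o.isSome}
      = 1 / 27 * (evHybrid S fun _ s e z₁ z₂ z₃ => wts r (m 2) s e z₁ z₂ z₃).toReal := by
  rw [Pr_eq, ev_honestRun S x K r m hx _ (ind_false (by simp)), ENNReal.toReal_mul,
    ENNReal.toReal_ofReal (by norm_num)]
  congr 2
  simp [ind_true]

theorem wts_le_one (r : Fin P.n₃ → P.R) (v : P.R) (s : Fin P.n₁ → P.R) (e : Challenges P)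
    (z₁ : Fin P.n₁ → Fin P.d → ℤ) (z₂ : Fin P.ν → Fin P.d → ℤ) (z₃ : Fin P.n₃ → Fin P.d → ℤ) :
    wts r v s e z₁ z₂ z₃ ≤ 1 :=
  mul_le_one' (mul_le_one' (wt_le_one _ _ _) (wt_le_one _ _ _)) (wt_le_one _ _ _)

theorem evHybrid_le_one (S : Setup P) {F : P.R → (Fin P.n₁ → P.R) → Challenges P →
      (Fin P.n₁ → Fin P.d → ℤ) → (Fin P.ν → Fin P.d → ℤ) → (Fin P.n₃ → Fin P.d → ℤ) → ℝ≥0∞}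
    (h : ∀ g s e z₁ z₂ z₃, F g s e z₁ z₂ z₃ ≤ 1) : evHybrid S F ≤ 1 :=
  (evHybrid_mono S fun _ _ _ _ _ _ _ _ => h _ _ _ _ _ _).trans (evHybrid_const S 1).le

end Weights

/-! ### Completeness -/

section Completeness

variable {P : Params}

/-- The left side is the tail factor per coordinate at squared length `2 n s²`. The slack `0.94`
will be spent on conditioning on acceptance. -/
theorem tail_num : √2 * Real.exp (-2 / 4) ≤ 0.94 * (2 : ℝ) ^ (-(1 : ℝ) / 8) := by
  have h1 : (√2 * Real.exp (-2 / 4)) ^ 8 ≤ (0.94 * (2 : ℝ) ^ (-(1 : ℝ) / 8)) ^ 8 := by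
    rw [mul_pow, mul_pow, show (8 : ℕ) = 2 * 4 by norm_num, pow_mul √2, Real.sq_sqrt (by norm_num),
      ← Real.exp_nat_mul, ← Real.rpow_natCast ((2 : ℝ) ^ (-(1 : ℝ) / 8)),
      ← Real.rpow_mul (by norm_num)]
    norm_num
    rw [Real.exp_neg]
    have h2 : (2.7182 : ℝ) ^ 4 ≤ Real.exp 4 := by
      have h := Real.exp_one_gt_d9
      calc (2.7182 : ℝ) ^ 4 ≤ Real.exp 1 ^ 4 := by gcongr; linarith
        _ = _ := by rw [← Real.exp_nat_mul]; norm_num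
    rw [← div_eq_mul_inv, div_le_iff₀ (Real.exp_pos _)]
    norm_num at h2 ⊢
    linarith
  exact (pow_le_pow_iff_left₀ (by positivity) (by positivity) (by norm_num)).mp h1

theorem tail_pow_le {N : ℕ} (hN : 0 < N) :
    (√2 * Real.exp (-2 / 4)) ^ N ≤ 0.94 * (2 : ℝ) ^ (-((N : ℕ) : ℝ) / 8) := by
  calc (√2 * Real.exp (-2 / 4)) ^ N ≤ (0.94 * (2 : ℝ) ^ (-(1 : ℝ) / 8)) ^ N :=
        pow_le_pow_left₀ (by positivity) tail_num N
    _ = 0.94 ^ N * (2 : ℝ) ^ (-((N : ℕ) : ℝ) / 8) := by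
        rw [mul_pow, ← Real.rpow_natCast ((2 : ℝ) ^ (-(1 : ℝ) / 8)), ← Real.rpow_mul (by norm_num)]
        congr 2
        ring
    _ ≤ _ := by
        gcongr
        exact pow_le_of_le_one (by norm_num) (by norm_num) hN.ne'

/-- `256 * 1.64² / 4 > 172`, and `2¹²⁸ * e⁻¹⁷²` is below `2⁻¹⁰²`. -/
theorem tail_num₂ : (√2 * Real.exp (-(1.64 ^ 2) / 4)) ^ 256 ≤ 1 / 2 ^ 102 := by
  have h1 : (√2) ^ 256 = 2 ^ 128 := by
    rw [show 256 = 2 * 128 by norm_num, pow_mul, Real.sq_sqrt (by norm_num)]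
  rw [mul_pow, h1, ← Real.exp_nat_mul]
  have h2 : (2 : ℝ) ^ 230 ≤ Real.exp 172 := by
    have h := Real.exp_one_gt_d9
    calc (2 : ℝ) ^ 230 ≤ 2.7 ^ 172 := by norm_num
      _ ≤ Real.exp 1 ^ 172 := by gcongr; linarith
      _ = _ := by rw [← Real.exp_nat_mul]; norm_num
  have h3 : Real.exp (((256 : ℕ) : ℝ) * (-(1.64 ^ 2) / 4)) ≤ Real.exp (-172) :=
    Real.exp_le_exp.mpr (by norm_num)
  calc _ ≤ 2 ^ 128 * Real.exp (-172) := by gcongr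
    _ ≤ _ := by
      rw [Real.exp_neg, ← div_eq_mul_inv, div_le_iff₀ (Real.exp_pos _)]
      calc (2 : ℝ) ^ 128 = 1 / 2 ^ 102 * 2 ^ 230 := by norm_num
        _ ≤ _ := by gcongr

/-- Centred Gaussian vectors exceeding the verifier's bounds. -/
def Big₁ (z : Fin P.n₁ → Fin P.d → ℤ) : Prop := 2 * ((P.n₁ * P.d : ℕ) : ℝ) * P.s₁ ^ 2 < sqn z

def Big₂ (z : Fin P.ν → Fin P.d → ℤ) : Prop := 1.64 ^ 2 * ((P.ν * P.d : ℕ) : ℝ) * P.s₂ ^ 2 < sqn z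

def Big₃ (z : Fin P.n₃ → Fin P.d → ℤ) : Prop := 2 * ((P.n₃ * P.d : ℕ) : ℝ) * P.s₃ ^ 2 < sqn z

theorem nrm_redV_le {n : ℕ} (z : Fin n → Fin P.d → ℤ) : nrm (redV z : Fin n → P.R) ≤ √(sqn z) :=
  nrm_red_le z

theorem accepts_hybrid (S : Setup P) (x : Stmt P) (K : AuxKey P) (r : Fin P.n₃ → P.R)
    (m : Fin 3 → P.R) (hm : InRange (m 2)) (g : P.R) {e : Challenges P}
    (he : e ∈ S.challenges.support) (t : Row P → P.R) (z₁ : Fin P.n₁ → Fin P.d → ℤ)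
    (z₂ : Fin P.ν → Fin P.d → ℤ) (z₃ : Fin P.n₃ → Fin P.d → ℤ)
    (h₁ : ¬ Big₁ z₁) (h₂ : ¬ Big₂ z₂) (h₃ : ¬ Big₃ z₃) :
    Accepts x K (hybrid x K r (m 2) (zeroConst g) e t (redV z₁) (redV z₂) (redV z₃)) := by
  rw [Big₁, not_lt] at h₁
  rw [Big₂, not_lt] at h₂
  rw [Big₃, not_lt] at h₃
  unfold hybrid
  rw [accepts_masked]
  refine ⟨(nrm_redV_le z₁).trans ?_, (nrm_redV_le z₃).trans ?_, (nrm_redV_le z₂).trans ?_, ?_⟩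
  · refine Real.sqrt_le_iff.mpr ⟨mul_nonneg P.s₁_pos.le (Real.sqrt_nonneg _), h₁.trans (le_of_eq ?_)⟩
    rw [Params.bound₁, mul_pow, Real.sq_sqrt (by positivity)]
    push_cast
    ring
  · refine Real.sqrt_le_iff.mpr ⟨mul_nonneg P.s₃_pos.le (Real.sqrt_nonneg _), h₃.trans (le_of_eq ?_)⟩
    rw [Params.bound₃, mul_pow, Real.sq_sqrt (by positivity)]
    push_cast
    ring
  · refine Real.sqrt_le_iff.mpr ⟨mul_nonneg (mul_nonneg (by norm_num) P.s₂_pos.le)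
      (Real.sqrt_nonneg _), h₂.trans (le_of_eq ?_)⟩
    rw [Params.bound₂, mul_pow, mul_pow, Real.sq_sqrt (by positivity), ν_mul_d]
    push_cast
    ring
  · rw [coeff_add, coeff_zeroConst, zero_add, relVal, coeff_relation e (scalarChal_of_mem S he)]
    have hY : ∀ j, gapY e (binPoly (m 2)) (fun b => redV z₂ b - redV (imageR e (binPoly (m 2))) b)
        (redV z₂) j = 0 := by
      intro j
      rw [gapY, coeff_sub, redV, redV, coeff_red, coeff_red, imageR, ZMod.coe_valMinAbs]
      ring
    simp [hY, gapBin_binPoly, gapVal_binPoly _ hm]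

/-- The bound is relative to the total weight because completeness is conditional on not aborting.
If `z₁` or `z₃` is too long, its own weight is discarded, the Gaussian tail is used, and the missing
weight is restored from its mean, which is at least `0.94`. -/
theorem wts_bad_le (S : Setup P) (r : Fin P.n₃ → P.R) (v : P.R) (hr : nrm r ≤ √(P.n₃ * P.d)) :
    evHybrid S (fun _ s e z₁ z₂ z₃ => wts r v s e z₁ z₂ z₃ * ind (Big₁ z₁ ∨ Big₂ z₂ ∨ Big₃ z₃))
      ≤ (ENNReal.ofReal ((2 : ℝ) ^ (-((P.n₁ * P.d : ℕ) : ℝ) / 8))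
        + ENNReal.ofReal ((2 : ℝ) ^ (-((P.n₃ * P.d : ℕ) : ℝ) / 8)) + ENNReal.ofReal (1 / 2 ^ 100))
        * evHybrid S fun _ s e z₁ z₂ z₃ => wts r v s e z₁ z₂ z₃ := by
  set a₁ : (Fin P.n₁ → P.R) → Challenges P → ℝ≥0∞ := fun s e =>
    ev (gaussVec P P.s₁ P.n₁) (wt P.s₁ fun j => lift (e .c * s j)) with ha₁
  set a₂ : (Fin P.n₁ → P.R) → Challenges P → ℝ≥0∞ := fun _ e =>
    ev (gaussVec P P.s₂ P.ν) (wt P.s₂ (imageR e (binPoly v))) with ha₂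
  set a₃ : (Fin P.n₁ → P.R) → Challenges P → ℝ≥0∞ := fun _ e =>
    ev (gaussVec P P.s₃ P.n₃) (wt P.s₃ fun j => lift (e .c * r j)) with ha₃
  set W := evHybrid S fun _ s e z₁ z₂ z₃ => wts r v s e z₁ z₂ z₃ with hW
  have hWp : W = evCoins S fun s e => a₁ s e * (a₂ s e * a₃ s e) :=
    evHybrid_prod S (fun s e => wt P.s₁ fun j => lift (e .c * s j))
      (fun _ e => wt P.s₂ (imageR e (binPoly v))) (fun _ e => wt P.s₃ fun j => lift (e .c * r j))
  have hd := P.d_pos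
  have hlow : ∀ a : ℝ≥0∞, 1 ≤ a + ENNReal.ofReal (1 / 2 ^ 102) → ENNReal.ofReal 0.94 ≤ a := by
    intro a ha
    have h1 : ENNReal.ofReal 0.94 + ENNReal.ofReal (1 / 2 ^ 102) ≤ a + ENNReal.ofReal (1 / 2 ^ 102) := by
      refine le_trans ?_ ha
      rw [← ENNReal.ofReal_add (by norm_num) (by norm_num), ← ENNReal.ofReal_one]
      exact ENNReal.ofReal_le_ofReal (by norm_num)
    exact (ENNReal.add_le_add_iff_right ENNReal.ofReal_ne_top).mp h1
  -- For `z₂` all three weights are discarded, since the mean of its weight has no lower bound when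
  -- the image is long.
  have hsplit : ∀ (s : Fin P.n₁ → P.R) (e : Challenges P) z₁ z₂ z₃,
      wts r v s e z₁ z₂ z₃ * ind (Big₁ z₁ ∨ Big₂ z₂ ∨ Big₃ z₃)
      ≤ (ind (Big₁ z₁) * wt P.s₂ (imageR e (binPoly v)) z₂ * wt P.s₃ (fun j => lift (e .c * r j)) z₃
        + wt P.s₁ (fun j => lift (e .c * s j)) z₁ * wt P.s₂ (imageR e (binPoly v)) z₂ * ind (Big₃ z₃))
        + 1 * ind (Big₂ z₂) * 1 := by
    intro s e z₁ z₂ z₃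
    by_cases h1 : Big₁ z₁
    · refine le_trans ?_ (le_self_add.trans le_self_add)
      rw [ind_true h1, ind_true (Or.inl h1), mul_one, wts]
      gcongr
      exact wt_le_one _ _ _
    by_cases h2 : Big₂ z₂
    · refine le_trans ?_ le_add_self
      rw [ind_true h2]
      simpa using mul_le_one' (wts_le_one r v s e z₁ z₂ z₃) (ind_le_one _)
    by_cases h3 : Big₃ z₃
    · refine le_trans ?_ (le_add_self.trans le_self_add)
      rw [ind_true h3]
      have := mul_le_mul_right (wt_le_one P.s₃ (fun j => lift (e .c * r j)) z₃)
        (wt P.s₁ (fun j => lift (e .c * s j)) z₁ * wt P.s₂ (imageR e (binPoly v)) z₂)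
      exact (mul_le_mul_right (ind_le_one _) _).trans (by rw [mul_one]; exact this)
    · rw [ind_false (by tauto)]
      simp
  refine (evHybrid_mono S (G := fun _ s e z₁ z₂ z₃ =>
      (ind (Big₁ z₁) * wt P.s₂ (imageR e (binPoly v)) z₂ * wt P.s₃ (fun j => lift (e .c * r j)) z₃
        + wt P.s₁ (fun j => lift (e .c * s j)) z₁ * wt P.s₂ (imageR e (binPoly v)) z₂ * ind (Big₃ z₃))
        + 1 * ind (Big₂ z₂) * 1) fun g s hs e he z₁ z₂ z₃ => hsplit s e z₁ z₂ z₃).trans ?_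
  rw [evHybrid_add, evHybrid_add, add_mul, add_mul,
    evHybrid_prod S (fun _ _ z₁ => ind (Big₁ z₁)) (fun _ e => wt P.s₂ (imageR e (binPoly v)))
      (fun _ e => wt P.s₃ fun j => lift (e .c * r j)),
    evHybrid_prod S (fun s e => wt P.s₁ fun j => lift (e .c * s j))
      (fun _ e => wt P.s₂ (imageR e (binPoly v))) (fun _ _ z₃ => ind (Big₃ z₃)),
    evHybrid_prod S (fun _ _ _ => 1) (fun _ _ z₂ => ind (Big₂ z₂)) (fun _ _ _ => 1)]
  refine add_le_add (add_le_add ?_ ?_) ?_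
  · have ht := ev_gaussVec_tail (P := P) P.s₁_pos P.n₁ 2
    have ht2 := ht.trans (ENNReal.ofReal_le_ofReal
      (tail_pow_le (Nat.mul_pos (by simp [Params.n₁]) hd : 0 < P.n₁ * P.d)))
    rw [hWp, ← evCoins_mul_left]
    refine evCoins_mono S fun s hs e he => ?_
    refine (mul_le_mul_left ht2 _).trans ?_
    rw [mul_comm (0.94 : ℝ), ENNReal.ofReal_mul (by positivity), mul_assoc]
    gcongr
    exact hlow _ (one_le_wt₁ S hs he)
  · have ht := ev_gaussVec_tail (P := P) P.s₃_pos P.n₃ 2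
    have ht2 := ht.trans (ENNReal.ofReal_le_ofReal
      (tail_pow_le (Nat.mul_pos (by simp [Params.n₃]) hd : 0 < P.n₃ * P.d)))
    rw [hWp, ← evCoins_mul_left]
    refine evCoins_mono S fun s hs e he => ?_
    refine (mul_le_mul_right (mul_le_mul_right ht2 _) _).trans ?_
    rw [mul_comm (0.94 : ℝ), ENNReal.ofReal_mul (by positivity)]
    have h5 := hlow _ (one_le_wt₃ S hr he)
    calc _ = ENNReal.ofReal ((2 : ℝ) ^ (-((P.n₃ * P.d : ℕ) : ℝ) / 8))
          * (a₁ s e * (a₂ s e * ENNReal.ofReal 0.94)) := by ring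
      _ ≤ _ := by gcongr
  · have ht := ev_gaussVec_tail (P := P) P.s₂_pos P.ν (1.64 ^ 2)
    rw [ν_mul_d] at ht
    have ht2 := ht.trans (ENNReal.ofReal_le_ofReal tail_num₂)
    have hW1 := one_le_evHybrid_wts S r v hr
    -- A crude bound suffices: the absolute tail `2⁻¹⁰²` is `2⁻¹⁰⁰ * (1/4)`.
    have hW2 : ENNReal.ofReal (1 / 4) ≤ W := by
      have h1 : ENNReal.ofReal (1 / 4) + ENNReal.ofReal (1 / 2 ^ 100) ≤ W + ENNReal.ofReal (1 / 2 ^ 100) := by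
        refine le_trans ?_ hW1
        rw [← ENNReal.ofReal_add (by norm_num) (by norm_num), ← ENNReal.ofReal_one]
        exact ENNReal.ofReal_le_ofReal (by norm_num)
      exact (ENNReal.add_le_add_iff_right ENNReal.ofReal_ne_top).mp h1
    have h3 : ev (gaussVec P P.s₂ P.ν) (fun z₂ => ind (Big₂ z₂)) ≤ ENNReal.ofReal (1 / 2 ^ 102) := by
      refine le_trans (le_of_eq ?_) ht2
      simp only [Big₂, ν_mul_d]
    simp only [ev_const, one_mul, mul_one, evCoins]
    calc _ ≤ ENNReal.ofReal (1 / 2 ^ 102) := h3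
      _ = ENNReal.ofReal (1 / 2 ^ 100) * ENNReal.ofReal (1 / 4) := by
        rw [← ENNReal.ofReal_mul (by positivity)]; norm_num
      _ ≤ _ := by gcongr

theorem toReal_le_add_mul {W A : ℝ≥0∞} (hW : W ≠ ⊤) (hA : A ≠ ⊤) {a b c : ℝ} (ha : 0 ≤ a)
    (hb : 0 ≤ b) (hc : 0 ≤ c)
    (h : W ≤ A + (ENNReal.ofReal a + ENNReal.ofReal b + ENNReal.ofReal c) * W) :
    W.toReal ≤ A.toReal + (a + b + c) * W.toReal := by
  have h3 := ENNReal.toReal_mono (by finiteness) h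
  rwa [ENNReal.toReal_add (by finiteness) (by finiteness), ENNReal.toReal_mul,
    ENNReal.toReal_add (by finiteness) (by finiteness),
    ENNReal.toReal_add (by finiteness) (by finiteness), ENNReal.toReal_ofReal ha,
    ENNReal.toReal_ofReal hb, ENNReal.toReal_ofReal hc] at h3

theorem complete (S : Setup P) : Complete S := by
  intro x K r m ⟨hr, hx, hm⟩
  set W := evHybrid S fun _ s e z₁ z₂ z₃ => wts r (m 2) s e z₁ z₂ z₃ with hW
  have hW1 : W ≤ 1 := evHybrid_le_one S fun _ _ _ _ _ _ => wts_le_one _ _ _ _ _ _ _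
  have hWt : W ≠ ⊤ := ne_top_of_le_ne_top ENNReal.one_ne_top hW1
  have hPr := Pr_isSome S x K r m hx
  rw [hPr, ← hW]
  constructor
  · have h1 := ENNReal.toReal_mono (by finiteness) (one_le_evHybrid_wts S r (m 2) hr)
    rw [ENNReal.toReal_add hWt ENNReal.ofReal_ne_top, ENNReal.toReal_ofReal (by positivity),
      ENNReal.toReal_one] at h1
    norm_num at h1 ⊢
    linarith
  · set Acc := evHybrid S fun g s e z₁ z₂ z₃ => wts r (m 2) s e z₁ z₂ z₃ *
      ind (Accepts x K (hybrid x K r (m 2) g e (fun i => K i ⬝ᵥ s) (redV z₁) (redV z₂) (redV z₃)))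
      with hAcc
    have hAcc1 : Acc ≤ 1 := evHybrid_le_one S fun _ _ _ _ _ _ =>
      mul_le_one' (wts_le_one _ _ _ _ _ _ _) (ind_le_one _)
    have hPa : Pr (honestRun S x K r (m 2)) {o | ∃ t, o = some t ∧ Accepts x K t}
        = 1 / 27 * Acc.toReal := by
      rw [Pr_eq, ev_honestRun S x K r m hx _ (ind_false (by simp)), ENNReal.toReal_mul,
        ENNReal.toReal_ofReal (by norm_num)]
      simp [hAcc]
    have hsum : W ≤ Acc + evHybrid S fun _ s e z₁ z₂ z₃ =>
        wts r (m 2) s e z₁ z₂ z₃ * ind (Big₁ z₁ ∨ Big₂ z₂ ∨ Big₃ z₃) := by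
      rw [hAcc, ← evHybrid_add]
      refine evHybrid_mono S fun g s hs e he z₁ z₂ z₃ => ?_
      by_cases h : Big₁ z₁ ∨ Big₂ z₂ ∨ Big₃ z₃
      · rw [ind_true h, mul_one]
        exact le_add_self
      · push Not at h
        rw [ind_true (accepts_hybrid S x K r m hm g he _ z₁ z₂ z₃ h.1 h.2.1 h.2.2), mul_one]
        exact le_self_add
    have h2 := hsum.trans (add_le_add le_rfl (wts_bad_le S r (m 2) hr))
    rw [← hW] at h2
    have h3 := toReal_le_add_mul hWt (ne_top_of_le_ne_top ENNReal.one_ne_top hAcc1)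
      (by positivity) (by positivity) (by positivity) h2
    rw [hPa]
    have e1 : ((2 : ℝ) ^ (-100 : ℤ)) = 1 / 2 ^ 100 := by norm_num
    rw [e1]
    nlinarith
end Completeness


/-! ### Functions computed by short programs -/

section Comp

variable {P : Params} {V W : Type}

/-- Renaming of variables. -/
def Expr.rename (g : V → W) : Expr P V → Expr P W
  | .var x => .var (g x)
  | .const r => .const r
  | .add e f => .add (e.rename g) (f.rename g)
  | .mul e f => .mul (e.rename g) (f.rename g)
  | .conj e => .conj (e.rename g)
  | .inv e => .inv (e.rename g)
  | .coeff i e => .coeff i (e.rename g)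
  | .bit i e => .bit i (e.rename g)

theorem Expr.size_rename (g : V → W) (e : Expr P V) : (e.rename g).size = e.size := by
  induction e <;> simp_all [Expr.rename, Expr.size]

theorem Expr.eval_rename (g : V → W) (e : Expr P V) (ρ : W → P.R) :
    (e.rename g).eval ρ = e.eval fun x => ρ (g x) := by
  induction e <;> simp_all [Expr.rename, Expr.eval]

/-- `F` is computed by a formula of size at most `len ^ k`. -/
def Comp (k : ℕ) (F : (V → P.R) → P.R) : Prop :=
  ∃ e : Expr P V, e.size ≤ P.len ^ k ∧ ∀ ρ, e.eval ρ = F ρ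

theorem three_le_len (P : Params) : 259 ≤ P.len := by
  unfold Params.len Params.n₁
  omega

namespace Comp

variable {F G : (V → P.R) → P.R} {a b k : ℕ}

theorem one_le_pow (k : ℕ) : 1 ≤ P.len ^ k :=
  Nat.one_le_pow _ _ (by have := three_le_len P; omega)

theorem mono (h : Comp a F) (hab : a ≤ b) : Comp b F := by
  obtain ⟨e, h1, h2⟩ := h
  exact ⟨e, h1.trans (Nat.pow_le_pow_right (by have := three_le_len P; omega) hab), h2⟩

theorem congr (h : Comp a F) (hFG : ∀ ρ, F ρ = G ρ) : Comp a G := by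
  rwa [← funext hFG]

theorem rename (h : Comp a F) (g : V → W) : Comp a fun ρ : W → P.R => F fun x => ρ (g x) := by
  obtain ⟨e, h1, h2⟩ := h
  exact ⟨e.rename g, by rwa [Expr.size_rename], fun ρ => by rw [Expr.eval_rename, h2]⟩

theorem var (x : V) : Comp 0 fun ρ : V → P.R => ρ x := ⟨.var x, le_rfl, fun _ => rfl⟩

theorem const (r : P.R) : Comp 0 fun _ : V → P.R => r := ⟨.const r, le_rfl, fun _ => rfl⟩

/-- As `len ≥ 3`, one more gate raises the exponent by at most one. Sizes are tracked only through
such exponents. -/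
theorem pow_step {s t : ℕ} (hs : s ≤ P.len ^ a) (ht : t ≤ P.len ^ b) :
    s + t + 1 ≤ P.len ^ (max a b + 1) := by
  have h0 := three_le_len P
  have h1 := hs.trans (Nat.pow_le_pow_right (by omega) (le_max_left a b))
  have h2 := ht.trans (Nat.pow_le_pow_right (by omega) (le_max_right a b))
  have h3 := one_le_pow (P := P) (max a b)
  rw [pow_succ]
  nlinarith

theorem add (hF : Comp a F) (hG : Comp b G) : Comp (max a b + 1) fun ρ => F ρ + G ρ := by
  obtain ⟨e, h1, h2⟩ := hF
  obtain ⟨f, h3, h4⟩ := hG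
  exact ⟨.add e f, pow_step h1 h3, fun ρ => by simp [Expr.eval, h2, h4]⟩

theorem mul (hF : Comp a F) (hG : Comp b G) : Comp (max a b + 1) fun ρ => F ρ * G ρ := by
  obtain ⟨e, h1, h2⟩ := hF
  obtain ⟨f, h3, h4⟩ := hG
  exact ⟨.mul e f, pow_step h1 h3, fun ρ => by simp [Expr.eval, h2, h4]⟩

theorem succ_le {s : ℕ} (hs : s ≤ P.len ^ a) : s + 1 ≤ P.len ^ (a + 1) := by
  have h := pow_step (P := P) (b := a) hs (Nat.zero_le _)
  simpa using h

theorem conj (hF : Comp a F) : Comp (a + 1) fun ρ => PoA.conj (F ρ) := by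
  obtain ⟨e, h1, h2⟩ := hF
  exact ⟨.conj e, succ_le h1, fun ρ => by simp [Expr.eval, h2]⟩

theorem inv (hF : Comp a F) : Comp (a + 1) fun ρ => Ring.inverse (F ρ) := by
  obtain ⟨e, h1, h2⟩ := hF
  exact ⟨.inv e, succ_le h1, fun ρ => by simp [Expr.eval, h2]⟩

theorem coeff (i : ℕ) (hF : Comp a F) : Comp (a + 1) fun ρ => scal (PoA.coeff (F ρ) i) := by
  obtain ⟨e, h1, h2⟩ := hF
  exact ⟨.coeff i e, succ_le h1, fun ρ => by simp [Expr.eval, h2]⟩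

theorem bit (i : ℕ) (hF : Comp a F) :
    Comp (a + 1) fun ρ => if (PoA.coeff (F ρ) 0).val.testBit i then 1 else 0 := by
  obtain ⟨e, h1, h2⟩ := hF
  exact ⟨.bit i e, succ_le h1, fun ρ => by simp [Expr.eval, h2]⟩

theorem neg (hF : Comp a F) : Comp (a + 1) fun ρ => -F ρ :=
  (((const (-1)).mul hF).mono (by simp)).congr fun ρ => by ring

theorem sub (hF : Comp a F) (hG : Comp b G) : Comp (max a b + 2) fun ρ => F ρ - G ρ :=
  ((hF.add hG.neg).mono (by omega)).congr fun ρ => by ring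

/-- A sum of at most `len` terms costs one level for the number of terms and one for the additions.
-/
theorem sum_finset {ι : Type} (s : Finset ι) (hs : s.card ≤ P.len) {F : ι → (V → P.R) → P.R}
    (hF : ∀ i, Comp a (F i)) : Comp (a + 2) fun ρ => ∑ i ∈ s, F i ρ := by
  choose e h1 h2 using hF
  have key : ∀ l : List ι, ∃ f : Expr P V, f.size ≤ l.length * (P.len ^ a + 1) + 1 ∧
      ∀ ρ, f.eval ρ = (l.map fun i => F i ρ).sum := by
    intro l
    induction l with
    | nil => exact ⟨.const 0, by simp [Expr.size], fun ρ => by simp [Expr.eval]⟩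
    | cons i l ih =>
      obtain ⟨f, hf1, hf2⟩ := ih
      refine ⟨.add (e i) f, ?_, fun ρ => by simp [Expr.eval, h2, hf2]⟩
      have := h1 i
      simp only [Expr.size, List.length_cons]
      nlinarith
  obtain ⟨f, hf1, hf2⟩ := key s.toList
  refine ⟨f, hf1.trans ?_, fun ρ => by rw [hf2, Finset.sum_map_toList]⟩
  rw [Finset.length_toList]
  have h3 := one_le_pow (P := P) a
  have h4 := three_le_len P
  have h5 : s.card * (P.len ^ a + 1) ≤ P.len * (P.len ^ a + 1) := Nat.mul_le_mul_right _ hs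
  have h6 : P.len ≤ P.len * P.len ^ a := Nat.le_mul_of_pos_right _ (by omega)
  have h7 : P.len ^ (a + 2) = P.len * (P.len * P.len ^ a) := by ring
  rw [h7]
  nlinarith

theorem sum {ι : Type} [Fintype ι] (hs : Fintype.card ι ≤ P.len) {F : ι → (V → P.R) → P.R}
    (hF : ∀ i, Comp a (F i)) : Comp (a + 2) fun ρ => ∑ i, F i ρ :=
  sum_finset Finset.univ hs hF

theorem dot {n : ℕ} (hn : n ≤ P.len) {F G : Fin n → (V → P.R) → P.R}
    (hF : ∀ i, Comp a (F i)) (hG : ∀ i, Comp b (G i)) :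
    Comp (max a b + 3) fun ρ => (fun i => F i ρ) ⬝ᵥ fun i => G i ρ :=
  sum (by simpa using hn) fun i => (hF i).mul (hG i)

end Comp

theorem β_le_d (P : Params) : P.β ≤ P.d := Nat.le_mul_of_pos_right _ P.a_pos

theorem ν_le (P : Params) : P.ν ≤ 256 := by
  rw [← ν_mul_d P]
  exact Nat.le_mul_of_pos_right _ P.d_pos

/-! ### Construction of programs -/

/-- A program given by its coins and by the functions that it computes. -/
theorem exists_prog {inp query ans out I J : Type} [Fintype query] [Fintype out] [Fintype I]
    [Fintype J] (coin : I → Sampler) (Q : J → query → ((inp ⊕ I) → P.R) → P.R)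
    (O : out → (((inp ⊕ I) ⊕ (J × ans)) → P.R) → P.R) (k : ℕ)
    (hQ : ∀ j i, Comp k (Q j i)) (hO : ∀ o, Comp k (O o)) :
    ∃ A : Prog P inp query ans out,
      A.size ≤ Fintype.card I + Fintype.card J + Fintype.card J * (Fintype.card query * P.len ^ k)
        + Fintype.card out * P.len ^ k ∧
      ∀ (S : Setup P) (oracle : (query → P.R) → ans → P.R) (x : inp → P.R)
        (f : (out → P.R) → ℝ≥0∞),
        ev (A.run S oracle x) f = ev (piPMF fun i => S.sample (coin i)) fun w =>
          f fun o => O o (Sum.elim (Sum.elim x w) fun p =>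
            oracle (fun q => Q p.1 q (Sum.elim x w)) p.2) := by
  let eI := Fintype.equivFin I
  let eJ := Fintype.equivFin J
  choose q hq1 hq2 using fun j i => (hQ j i).rename (Sum.map id eI)
  choose o ho1 ho2 using fun i => (hO i).rename (Sum.map (Sum.map id eI) (Prod.map eJ id))
  refine ⟨⟨Fintype.card I, fun i => coin (eI.symm i), Fintype.card J, fun j => q (eJ.symm j), o⟩,
    ?_, ?_⟩
  · unfold Prog.size
    refine Nat.add_le_add (Nat.add_le_add le_rfl ?_) ?_
    · refine (Finset.sum_le_card_nsmul _ _ (Fintype.card query * P.len ^ k) fun j _ => ?_).trans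
        (by simp)
      exact (Finset.sum_le_card_nsmul _ _ _ fun i _ => hq1 _ _).trans (by simp)
    · exact (Finset.sum_le_card_nsmul _ _ _ fun i _ => ho1 _).trans (by simp)
  · intro S oracle x f
    unfold Prog.run
    rw [ev_map]
    simp only [ho2, hq2]
    rw [ev_pi_equiv eI]
    simp only [Equiv.symm_apply_apply]
    refine congrArg _ (funext fun w => congrArg f (funext fun i => congrArg (O i) (funext fun v => ?_)))
    have h1 : ∀ v : inp ⊕ I, (Sum.elim x fun k => w (eI.symm k) : inp ⊕ Fin (Fintype.card I) → P.R)
        (Sum.map id eI v) = Sum.elim x w v := by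
      rintro (v | v) <;> simp
    rcases v with v | v
    · exact h1 v
    · simp only [Sum.map_inr, Sum.elim_inr, Prod.map, Equiv.symm_apply_apply, id]
      simp only [h1]

theorem card_chal_le (P : Params) : Fintype.card (ChalIdx P) ≤ P.len ^ 2 := by
  let φ : ChalIdx P → ((Fin P.ν × Fin P.d) × Fin P.β) ⊕ (Fin P.ν × Fin P.d) ⊕ Fin P.β ⊕ Fin P.d ⊕ Unit
    | .R j α => .inl (j, α)
    | .dy j => .inr (.inl j)
    | .dbin α => .inr (.inr (.inl α))
    | .dval j => .inr (.inr (.inr (.inl j)))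
    | .c => .inr (.inr (.inr (.inr ())))
  have h := Fintype.card_le_of_injective φ fun x y hxy => by
    cases x <;> cases y <;> simp_all [φ]
  refine h.trans ?_
  simp only [Fintype.card_sum, Fintype.card_prod, Fintype.card_fin, Fintype.card_unit, ν_mul_d]
  have h1 := β_le_d P
  have h2 : P.d + 256 ≤ P.len := by unfold Params.len; omega
  have h3 : (P.d + 256) ^ 2 ≤ P.len ^ 2 := Nat.pow_le_pow_left h2 2
  nlinarith

theorem card_resp_le (P : Params) : Fintype.card (RespIdx P) ≤ P.len ^ 2 := by
  let φ : RespIdx P → Fin P.κ ⊕ Fin P.ν ⊕ Fin P.β ⊕ Fin P.ν ⊕ Fin P.κ ⊕ Fin P.κ ⊕ Fin P.n₁ ⊕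
      Fin P.n₃ ⊕ Fin 4
    | .u₀ i => .inl i
    | .uy₂ b => .inr (.inl b)
    | .ubin α => .inr (.inr (.inl α))
    | .z₂ b => .inr (.inr (.inr (.inl b)))
    | .w₁ i => .inr (.inr (.inr (.inr (.inl i))))
    | .w₂ i => .inr (.inr (.inr (.inr (.inr (.inl i)))))
    | .z₁ i => .inr (.inr (.inr (.inr (.inr (.inr (.inl i))))))
    | .z₃ i => .inr (.inr (.inr (.inr (.inr (.inr (.inr (.inl i)))))))
    | .ug => .inr (.inr (.inr (.inr (.inr (.inr (.inr (.inr 0)))))))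
    | .h => .inr (.inr (.inr (.inr (.inr (.inr (.inr (.inr 1)))))))
    | .v => .inr (.inr (.inr (.inr (.inr (.inr (.inr (.inr 2)))))))
    | .ug₁ => .inr (.inr (.inr (.inr (.inr (.inr (.inr (.inr 3)))))))
  have h := Fintype.card_le_of_injective φ fun x y hxy => by
    cases x <;> cases y <;> simp_all [φ]
  refine h.trans ?_
  simp only [Fintype.card_sum, Fintype.card_fin]
  have h1 := β_le_d P
  have h2 : P.κ + P.lam + 3 + P.β + P.d + 256 = P.len := rfl
  have h3 := ν_le P
  have h4 : 259 * P.len ≤ P.len ^ 2 := by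
    rw [pow_two]; exact Nat.mul_le_mul_right _ (three_le_len P)
  simp only [Params.n₁, Params.n₃]
  omega

theorem card_ext_le (P : Params) : Fintype.card (ExtIdx P) ≤ P.len ^ 2 := by
  let φ : ExtIdx P → Fin P.n₃ ⊕ Fin 3 ⊕ Fin P.n₁ ⊕ Fin P.n₃ ⊕ Unit
    | .r i => .inl i
    | .m k => .inr (.inl k)
    | .sis₁ j => .inr (.inr (.inl j))
    | .sis₃ j => .inr (.inr (.inr (.inl j)))
    | .cbar => .inr (.inr (.inr (.inr ())))
  have h := Fintype.card_le_of_injective φ fun x y hxy => by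
    cases x <;> cases y <;> simp_all [φ]
  refine h.trans ?_
  simp only [Fintype.card_sum, Fintype.card_fin, Fintype.card_unit]
  have h2 : P.κ + P.lam + 3 + P.β + P.d + 256 = P.len := rfl
  have h4 : 259 * P.len ≤ P.len ^ 2 := by
    rw [pow_two]; exact Nat.mul_le_mul_right _ (three_le_len P)
  simp only [Params.n₁, Params.n₃]
  omega

theorem card_row_le (P : Params) : Fintype.card (Row P) ≤ P.len := by
  let φ : Row P → Fin P.κ ⊕ Fin P.ν ⊕ Fin P.β ⊕ Fin 2
    | .a i => .inl i
    | .y₂ k => .inr (.inl k)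
    | .bin j => .inr (.inr (.inl j))
    | .g => .inr (.inr (.inr 0))
    | .g₁ => .inr (.inr (.inr 1))
  have h := Fintype.card_le_of_injective φ fun x y hxy => by
    cases x <;> cases y <;> simp_all [φ]
  refine h.trans ?_
  simp only [Fintype.card_sum, Fintype.card_fin]
  have h2 : P.κ + P.lam + 3 + P.β + P.d + 256 = P.len := rfl
  have h3 := ν_le P
  omega

end Comp


/-! ### Extraction from accepting transcripts -/

section Extraction

variable {P : Params}

/-- Replacement of the last challenge. -/
def setC (e : Challenges P) (c : P.R) : Challenges P
  | .R j α => e (.R j α)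
  | .dy j => e (.dy j)
  | .dbin α => e (.dbin α)
  | .dval j => e (.dval j)
  | .c => c

theorem setC_setC (e : Challenges P) (c c' : P.R) : setC (setC e c) c' = setC e c' := by
  funext i; cases i <;> rfl

/-- Only `z₁` and `z₃` are sent after the last challenge, so rewinding it leaves every other message
unchanged. -/
theorem reply_setC (σ : Strategy P) (e : Challenges P) (c : P.R) (i : RespIdx P)
    (hi : i.round ≤ 3) : σ.reply (setC e c) i = σ.reply e i := by
  refine σ.causal _ _ _ fun j hj => ?_
  cases j <;> first | rfl | (simp only [ChalIdx.round] at hj; omega)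

theorem reply_const (σ : Strategy P) (e e' : Challenges P) (i : RespIdx P)
    (hi : i.round ≤ 1) : σ.reply e i = σ.reply e' i := by
  refine σ.causal _ _ _ fun j hj => ?_
  cases j <;> (simp only [ChalIdx.round] at hj; omega)

/-- The verifier accepts the prover on challenges `e`. -/
def Wins (x : Stmt P) (K : AuxKey P) (σ : Strategy P) (e : Challenges P) : Prop :=
  Accepts x K ⟨e, σ.reply e⟩

/-- Two accepting transcripts that differ in the last challenge. -/
def GoodPair (x : Stmt P) (K : AuxKey P) (σ : Strategy P) (e : Challenges P) (c : P.R) : Prop :=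
  Wins x K σ e ∧ Wins x K σ (setC e c) ∧ IsUnit (e .c - c)

/-- Differences of the masked openings of the auxiliary commitment. -/
def diff₁ (σ : Strategy P) (e : Challenges P) (c : P.R) (j : Fin P.n₁) : P.R :=
  σ.reply e (.z₁ j) - σ.reply (setC e c) (.z₁ j)

/-- Differences of the masked openings of the input commitment. -/
def diff₃ (σ : Strategy P) (e : Challenges P) (c : P.R) (j : Fin P.n₃) : P.R :=
  σ.reply e (.z₃ j) - σ.reply (setC e c) (.z₃ j)

/-- Extracted randomness of the auxiliary commitment. -/
def ext₁ (σ : Strategy P) (e : Challenges P) (c : P.R) (j : Fin P.n₁) : P.R :=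
  Ring.inverse (e .c - c) * diff₁ σ e c j

/-- Extracted randomness of the input commitment. -/
def ext₃ (σ : Strategy P) (e : Challenges P) (c : P.R) (j : Fin P.n₃) : P.R :=
  Ring.inverse (e .c - c) * diff₃ σ e c j

theorem dot_sub' {n : ℕ} (a y z : Fin n → P.R) :
    a ⬝ᵥ (fun j => y j - z j) = a ⬝ᵥ y - a ⬝ᵥ z := dotProduct_sub a y z

theorem dot_mul' {n : ℕ} (a z : Fin n → P.R) (c : P.R) :
    a ⬝ᵥ (fun j => c * z j) = c * (a ⬝ᵥ z) := by
  simp only [dotProduct, Finset.mul_sum]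
  exact Finset.sum_congr rfl fun i _ => by ring

theorem dot_add' {n : ℕ} (a y z : Fin n → P.R) :
    a ⬝ᵥ (fun j => y j + z j) = a ⬝ᵥ y + a ⬝ᵥ z := dotProduct_add a y z

variable {x : Stmt P} {K : AuxKey P} {σ : Strategy P} {e e' : Challenges P} {c c' : P.R}

theorem GoodPair.mul_ext₁ (h : GoodPair x K σ e c) (j) : (e .c - c) * ext₁ σ e c j = diff₁ σ e c j := by
  rw [ext₁, ← mul_assoc, Ring.mul_inverse_cancel _ h.2.2, one_mul]

theorem GoodPair.mul_ext₃ (h : GoodPair x K σ e c) (j) : (e .c - c) * ext₃ σ e c j = diff₃ σ e c j := by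
  rw [ext₃, ← mul_assoc, Ring.mul_inverse_cancel _ h.2.2, one_mul]

theorem GoodPair.dot_diff₁ (h : GoodPair x K σ e c) (i) :
    K (.a i) ⬝ᵥ diff₁ σ e c = (e .c - c) * σ.reply e (.u₀ i) := by
  have h1 := h.1.2.2.2.1.1 i
  have h2 := h.2.1.2.2.2.1.1 i
  simp only [reply_setC σ e c (.w₁ i) le_rfl, reply_setC σ e c (.u₀ i) (by simp [RespIdx.round])] at h2
  unfold diff₁
  rw [dot_sub', h1, h2]
  change _ - (_ + c * _) = _
  ring

theorem GoodPair.dot_diff₃ (h : GoodPair x K σ e c) (i) :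
    (fun j => x (.A i j)) ⬝ᵥ diff₃ σ e c = (e .c - c) * x (.com₀ i) := by
  have h1 := h.1.2.2.2.1.2 i
  have h2 := h.2.1.2.2.2.1.2 i
  simp only [reply_setC σ e c (.w₂ i) le_rfl] at h2
  unfold diff₃
  rw [dot_sub', h1, h2]
  change _ - (_ + c * _) = _
  ring

theorem GoodPair.nrm_diff₁ (h : GoodPair x K σ e c) : nrm (diff₁ σ e c) ≤ 2 * P.bound₁ := by
  have h1 := h.1.1.1
  have h2 := h.2.1.1.1
  have h3 := nrm_sub_le (fun j => σ.reply e (.z₁ j)) fun j => σ.reply (setC e c) (.z₁ j)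
  have h4 : nrm (diff₁ σ e c) ≤ _ := h3
  simp only at h1 h2
  linarith

theorem GoodPair.nrm_diff₃ (h : GoodPair x K σ e c) : nrm (diff₃ σ e c) ≤ 2 * P.bound₃ := by
  have h1 := h.1.1.2
  have h2 := h.2.1.1.2
  have h3 := nrm_sub_le (fun j => σ.reply e (.z₃ j)) fun j => σ.reply (setC e c) (.z₃ j)
  have h4 : nrm (diff₃ σ e c) ≤ _ := h3
  simp only at h1 h2
  linarith

/-- A cross difference of two weak openings of the same commitment solves Module-SIS. -/
theorem isMSIS_cross {n : ℕ} (M : Fin P.κ → Fin n → P.R) (u : Fin P.κ → P.R) {B ω : ℝ}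
    {a a' : P.R} {z z' s s' : Fin n → P.R} (ha : IsUnit a) (ha' : IsUnit a')
    (hz : ∀ j, a * s j = z j) (hz' : ∀ j, a' * s' j = z' j) (hne : s ≠ s')
    (hM : ∀ i, M i ⬝ᵥ z = a * u i) (hM' : ∀ i, M i ⬝ᵥ z' = a' * u i)
    (hn : nrm z ≤ 2 * B) (hn' : nrm z' ≤ 2 * B) (h1 : nrm1 a ≤ 2 * ω) (h1' : nrm1 a' ≤ 2 * ω) :
    IsMSIS M (8 * ω * B) fun j => a' * z j - a * z' j := by
  refine ⟨?_, ?_, ?_⟩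
  · obtain ⟨j, hj⟩ := Function.ne_iff.mp hne
    intro h
    apply hj
    have h2 := congrFun h j
    simp only [Pi.zero_apply, ← hz, ← hz'] at h2
    have h3 : (a' * a) * (s j - s' j) = 0 := by linear_combination h2
    exact sub_eq_zero.mp (((ha'.mul ha).mul_right_eq_zero).mp h3)
  -- Each of the two terms has norm at most `2 ω * 2 B`, whence the factor `8 ω` after adding them.
  · refine (nrm_sub_le (fun j => a' * z j) fun j => a * z' j).trans ?_
    have h2 := nrm_mul_le a' z
    have h3 := nrm_mul_le a z'
    have h4 : nrm1 a' * nrm z ≤ 2 * ω * (2 * B) :=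
      mul_le_mul h1' hn (nrm_nonneg _) (le_trans (Finset.sum_nonneg fun _ _ => abs_nonneg _) h1')
    have h5 : nrm1 a * nrm z' ≤ 2 * ω * (2 * B) :=
      mul_le_mul h1 hn' (nrm_nonneg _) (le_trans (Finset.sum_nonneg fun _ _ => abs_nonneg _) h1)
    linarith
  · intro i
    rw [dot_sub' (M i) (fun j => a' * z j) fun j => a * z' j, dot_mul', dot_mul', hM, hM']
    ring

theorem nrm1_sub_le_two (S : Setup P) {c c' : P.R} (hc : c ∈ S.C.support) (hc' : c' ∈ S.C.support) :
    nrm1 (c - c') ≤ 2 * P.ω := by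
  have h1 := nrm1_sub_le c c'
  have h2 := S.C_norm _ hc
  have h3 := S.C_norm _ hc'
  linarith

/-- Values computed by the extractor from two pairs of transcripts. -/
def extOut (x : Stmt P) (a a' : P.R) (z₁ z₁' : Fin P.n₁ → P.R) (z₃ z₃' : Fin P.n₃ → P.R) :
    ExtIdx P → P.R
  | .cbar => a
  | .r j => Ring.inverse a * z₃ j
  | .m k => x (.com k) - (fun j => x (.b k j)) ⬝ᵥ fun j => Ring.inverse a * z₃ j
  | .sis₁ j => a' * z₁ j - a * z₁' j
  | .sis₃ j => a' * z₃ j - a * z₃' j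

/-- The two pairs may have unrelated challenges, yet they open the same commitments: `u₀` is the
first message of a fixed strategy and `com₀` is public. -/
theorem breaksBinding_of_ne (S : Setup P) (h : GoodPair x K σ e c) (h' : GoodPair x K σ e' c')
    (hc : c ∈ S.C.support) (hc' : c' ∈ S.C.support) (he : e .c ∈ S.C.support)
    (he' : e' .c ∈ S.C.support)
    (hne : ext₁ σ e c ≠ ext₁ σ e' c' ∨ ext₃ σ e c ≠ ext₃ σ e' c') :
    BreaksBinding x K (extOut x (e .c - c) (e' .c - c') (diff₁ σ e c) (diff₁ σ e' c')
      (diff₃ σ e c) (diff₃ σ e' c')) := by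
  rcases hne with hne | hne
  · refine Or.inl (isMSIS_cross _ (fun i => σ.reply e (.u₀ i)) h.2.2 h'.2.2 h.mul_ext₁ h'.mul_ext₁ hne
      h.dot_diff₁ (fun i => ?_) h.nrm_diff₁ h'.nrm_diff₁ (nrm1_sub_le_two S he hc)
      (nrm1_sub_le_two S he' hc'))
    rw [h'.dot_diff₁, reply_const σ e' e _ (by simp [RespIdx.round])]
  · exact Or.inr (isMSIS_cross _ (fun i => x (.com₀ i)) h.2.2 h'.2.2 h.mul_ext₃ h'.mul_ext₃ hne
      h.dot_diff₃ h'.dot_diff₃ h.nrm_diff₃ h'.nrm_diff₃ (nrm1_sub_le_two S he hc)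
      (nrm1_sub_le_two S he' hc'))

/-- The extracted assets. -/
def extVal (x : Stmt P) (r : Fin P.n₃ → P.R) : P.R := x (.com 2) - (fun j => x (.b 2 j)) ⬝ᵥ r

theorem extracted_of_inRange (S : Setup P) (h : GoodPair x K σ e c) (hc : c ∈ S.C.support)
    (he : e .c ∈ S.C.support) (hr : InRange (extVal x (ext₃ σ e c))) (a' : P.R)
    (z₁ z₁' : Fin P.n₁ → P.R) (z₃' : Fin P.n₃ → P.R) :
    Extracted x (extOut x (e .c - c) a' z₁ z₁' (diff₃ σ e c) z₃') := by
  refine ⟨h.2.2, nrm1_sub_le_two S he hc, ?_, ⟨fun i => ?_, fun k => ?_⟩, hr⟩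
  · refine le_trans (le_of_eq ?_) h.nrm_diff₃
    congr 1
    funext j
    exact h.mul_ext₃ j
  · have h1 := h.dot_diff₃ i
    have h2 : diff₃ σ e c = fun j => (e .c - c) * ext₃ σ e c j := funext fun j => (h.mul_ext₃ j).symm
    rw [h2, dot_mul'] at h1
    exact (h.2.2.mul_left_cancel h1).symm
  · simp [extOut]

/-! ### The relation between the extracted messages -/

/-- Extracted binary polynomials. -/
def extBin (K : AuxKey P) (m : Replies P) (s : Fin P.n₁ → P.R) (α : Fin P.β) : P.R :=
  m (.ubin α) - K (.bin α) ⬝ᵥ s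

/-- Extracted mask of the range proof. -/
def extY (K : AuxKey P) (m : Replies P) (s : Fin P.n₁ → P.R) (b : Fin P.ν) : P.R :=
  m (.uy₂ b) - K (.y₂ b) ⬝ᵥ s

/-- The left-hand side of the relation proved by the protocol. -/
def extRel (x : Stmt P) (K : AuxKey P) (e : Challenges P) (m : Replies P) (s : Fin P.n₁ → P.R)
    (r : Fin P.n₃ → P.R) : P.R :=
  (m .ug - K .g ⬝ᵥ s) + (lin e (extBin K m s) (extY K m s) (extVal x r)
    + quad e (extBin K m s) (extBin K m s) - cst e fun b => m (.z₂ b))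

/-- The verification equation as a polynomial in the last challenge. -/
theorem verify_poly {m : Replies P} (h : Accepts x K ⟨e, m⟩) (hc : conj (e .c) = e .c)
    (y s : Fin P.n₁ → P.R) (y' r : Fin P.n₃ → P.R) (hz : ∀ j, m (.z₁ j) = y j + e .c * s j)
    (hz' : ∀ j, m (.z₃ j) = y' j + e .c * r j) :
    e .c ^ 2 * (extRel x K e m s r - m .h)
      + e .c * (quad e (extBin K m s) (fun α => -(K (.bin α) ⬝ᵥ y))
        + quad e (fun α => -(K (.bin α) ⬝ᵥ y)) (extBin K m s)
        + lin e (fun α => -(K (.bin α) ⬝ᵥ y)) (fun b => -(K (.y₂ b) ⬝ᵥ y))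
          (-((fun j => x (.b 2 j)) ⬝ᵥ y')) - K .g ⬝ᵥ y - (m .ug₁ - K .g₁ ⬝ᵥ s))
      + (quad e (fun α => -(K (.bin α) ⬝ᵥ y)) (fun α => -(K (.bin α) ⬝ᵥ y)) + K .g₁ ⬝ᵥ y - m .v)
      = 0 := by
  have hv := h.2.2.2.2
  have hd : ∀ {n : ℕ} (a y s : Fin n → P.R) (c u : P.R),
      c * u - a ⬝ᵥ (fun j => y j + c * s j) = c * (u - a ⬝ᵥ s) + -(a ⬝ᵥ y) := fun a y s c u => by
    rw [dot_add' a y fun j => c * s j, dot_mul']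
    ring
  simp only [hz, hz', hd] at hv
  have e1 : ∀ α, m (.ubin α) - K (.bin α) ⬝ᵥ s = extBin K m s α := fun _ => rfl
  have e2 : ∀ b, m (.uy₂ b) - K (.y₂ b) ⬝ᵥ s = extY K m s b := fun _ => rfl
  have e3 : x (.com 2) - (fun j => x (.b 2 j)) ⬝ᵥ r = extVal x r := rfl
  simp only [e1, e2, e3, lin_comb, quad_comb e _ hc] at hv
  rw [hv, extRel]
  ring

/-- Divided differences, as for a Vandermonde system; over a ring with zero divisors the differences
of the nodes must be units. -/
theorem eq_zero_of_three_roots {a b d p₀ p₁ p₂ : P.R} (hab : IsUnit (a - b)) (had : IsUnit (a - d))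
    (hbd : IsUnit (b - d)) (ha : a ^ 2 * p₂ + a * p₁ + p₀ = 0) (hb : b ^ 2 * p₂ + b * p₁ + p₀ = 0)
    (hd : d ^ 2 * p₂ + d * p₁ + p₀ = 0) : p₂ = 0 := by
  have h1 : (a + b) * p₂ + p₁ = 0 := hab.mul_right_eq_zero.mp (by linear_combination ha - hb)
  have h2 : (a + d) * p₂ + p₁ = 0 := had.mul_right_eq_zero.mp (by linear_combination ha - hd)
  exact hbd.mul_right_eq_zero.mp (by linear_combination h1 - h2)

/-- Three accepting transcripts with consistent extracted randomness prove the relation. -/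
theorem relation_of_triple {c₂ c₃ : P.R} (h₂ : GoodPair x K σ e c₂) (h₃ : GoodPair x K σ e c₃)
    (h₂₃ : IsUnit (c₂ - c₃)) (hc : conj (e .c) = e .c) (hc₂ : conj c₂ = c₂) (hc₃ : conj c₃ = c₃)
    {s : Fin P.n₁ → P.R} {r : Fin P.n₃ → P.R} (hs₂ : ext₁ σ e c₂ = s) (hs₃ : ext₁ σ e c₃ = s)
    (hr₂ : ext₃ σ e c₂ = r) (hr₃ : ext₃ σ e c₃ = r) :
    extRel x K e (σ.reply e) s r = σ.reply e .h := by
  -- The common opening defines one mask for all three transcripts: equality of the extracted `s`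
  -- says that `z₁ = y + c' s` also holds for the other two challenges.
  set y : Fin P.n₁ → P.R := fun j => σ.reply e (.z₁ j) - e .c * s j with hy
  set y' : Fin P.n₃ → P.R := fun j => σ.reply e (.z₃ j) - e .c * r j with hy'
  have key : ∀ c', GoodPair x K σ e c' → conj c' = c' → ext₁ σ e c' = s → ext₃ σ e c' = r →
      c' ^ 2 * (extRel x K e (σ.reply e) s r - σ.reply e .h)
      + c' * (quad e (extBin K (σ.reply e) s) (fun α => -(K (.bin α) ⬝ᵥ y))
        + quad e (fun α => -(K (.bin α) ⬝ᵥ y)) (extBin K (σ.reply e) s)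
        + lin e (fun α => -(K (.bin α) ⬝ᵥ y)) (fun b => -(K (.y₂ b) ⬝ᵥ y))
          (-((fun j => x (.b 2 j)) ⬝ᵥ y')) - K .g ⬝ᵥ y - (σ.reply e .ug₁ - K .g₁ ⬝ᵥ s))
      + (quad e (fun α => -(K (.bin α) ⬝ᵥ y)) (fun α => -(K (.bin α) ⬝ᵥ y)) + K .g₁ ⬝ᵥ y
        - σ.reply e .v) = 0 := by
    intro c' h hc' hs hr
    have h1 := verify_poly h.2.1 hc' y s y' r (fun j => ?_) (fun j => ?_)
    · have e1 : extBin K (σ.reply (setC e c')) s = extBin K (σ.reply e) s := by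
        funext α; rw [extBin, extBin, reply_setC _ _ _ _ (by simp [RespIdx.round])]
      have e2 : extY K (σ.reply (setC e c')) s = extY K (σ.reply e) s := by
        funext α; rw [extY, extY, reply_setC _ _ _ _ (by simp [RespIdx.round])]
      have e3 : extRel x K (setC e c') (σ.reply (setC e c')) s r = extRel x K e (σ.reply e) s r := by
        simp only [extRel, e1, e2, reply_setC _ _ _ (.z₂ _) (by simp [RespIdx.round]),
          reply_setC _ _ _ .ug (by simp [RespIdx.round])]
        rfl
      rw [e1, e3, reply_setC _ _ _ _ (by simp [RespIdx.round]),
        reply_setC _ _ _ _ (by simp [RespIdx.round]),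
        reply_setC _ _ _ _ (by simp [RespIdx.round])] at h1
      exact h1
    · have h2 := h.mul_ext₁ j
      rw [hs, diff₁] at h2
      change _ = y j + c' * s j
      rw [hy]
      linear_combination h2
    · have h2 := h.mul_ext₃ j
      rw [hr, diff₃] at h2
      change _ = y' j + c' * r j
      rw [hy']
      linear_combination h2
  have key1 := verify_poly h₂.1 hc y s y' r (fun j => by rw [hy]; ring) (fun j => by rw [hy']; ring)
  exact sub_eq_zero.mp (eq_zero_of_three_roots h₂.2.2 h₃.2.2 h₂₃ key1 (key c₂ h₂ hc₂ hs₂ hr₂)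
    (key c₃ h₃ hc₃ hs₃ hr₃))

/-! ### Range of the extracted assets -/

/-- For integers `x (x - 1) ≥ 0`. The sum of these terms is zero modulo `q` and below `q` by
`NoWrap`, so it is zero and every term vanishes: the coefficients are bits. The other gaps then
write each asset as a sum of bits times powers of two. -/
theorem inRange_of_gaps (hq : P.NoWrap) {b : Fin P.β → P.R} {v : P.R}
    (hb : ∀ α (k : Fin P.d), |(((coeff (b α) k).valMinAbs : ℤ) : ℝ)| ≤ 2 * P.bound₂)
    (hbin : ∀ α, gapBin b α = 0) (hval : ∀ j, gapVal b v j = 0) : InRange v := by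
  have hbit : ∀ α (k : Fin P.d), coeff (b α) k = 0 ∨ coeff (b α) k = 1 := by
    intro α
    set w : Fin P.d → ℤ := fun k => (coeff (b α) k).valMinAbs with hw
    have hpos : ∀ k, 0 ≤ w k * w k - w k := fun k => by
      rcases le_or_gt (w k) 0 with h | h <;> nlinarith
    have hsum : ((∑ k, (w k * w k - w k) : ℤ) : ZMod P.q) = 0 := by
      rw [← hbin α, gapBin]
      push_cast
      simp [hw]
    have hlt : ∑ k, (w k * w k - w k) < P.q := by
      have h1 : ((∑ k, (w k * w k - w k) : ℤ) : ℝ) < P.q := by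
        refine lt_of_le_of_lt ?_ hq
        push_cast
        calc ∑ k, ((w k : ℝ) * w k - w k) ≤ ∑ _k : Fin P.d, (2 * P.bound₂) * (2 * P.bound₂ + 1) := by
              refine Finset.sum_le_sum fun k _ => ?_
              have h2 := hb α k
              have h3 := neg_abs_le (w k : ℝ)
              have h4 := abs_mul_abs_self (w k : ℝ)
              have h5 := abs_nonneg (w k : ℝ)
              simp only [hw] at h3 h4 h5 ⊢
              nlinarith
          _ = _ := by
              simp only [Finset.sum_const, Finset.card_univ, Fintype.card_fin, nsmul_eq_mul]
              push_cast
              ring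
      exact_mod_cast h1
    have hzero : ∑ k, (w k * w k - w k) = 0 := by
      refine Int.eq_zero_of_dvd_of_nonneg_of_lt (Finset.sum_nonneg fun k _ => hpos k) hlt ?_
      exact (ZMod.intCast_zmod_eq_zero_iff_dvd _ _).mp hsum
    intro k
    have h1 := (Finset.sum_eq_zero_iff_of_nonneg fun k _ => hpos k).mp hzero k (Finset.mem_univ k)
    have h2 : w k * (w k - 1) = 0 := by linear_combination h1
    have h3 : ((w k : ℤ) : ZMod P.q) = coeff (b α) k := ZMod.coe_valMinAbs _
    rcases mul_eq_zero.mp h2 with h | h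
    · left; rw [← h3, h]; simp
    · right; rw [← h3, sub_eq_zero.mp h]; simp
  intro j
  have h1 := hval j
  rw [gapVal, sub_eq_zero] at h1
  have h2 : ∀ i ∈ Finset.range P.β, ∃ n : ℕ, n ≤ 1 ∧
      coeff (b (Fin.divNat j)) (i + (Fin.modNat j : Fin P.a) * P.β) = (n : ZMod P.q) := by
    intro i hi
    rcases hbit (Fin.divNat j) ⟨_, idx_lt i (Fin.modNat j) (Finset.mem_range.mp hi)⟩ with h | h
    · exact ⟨0, by simp, by simpa using h⟩
    · exact ⟨1, le_rfl, by simpa using h⟩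
  choose! n hn1 hn2 using h2
  have h3 : coeff v j = ((∑ i ∈ Finset.range P.β, 2 ^ i * n i : ℕ) : ZMod P.q) := by
    rw [← h1]
    push_cast
    exact Finset.sum_congr rfl fun i hi => by rw [hn2 i hi]
  -- Reduction modulo `q` can only decrease the natural number, so `2 ^ β` need not be compared with
  -- `q`.
  rw [h3, ZMod.val_natCast]
  refine (Nat.mod_le _ _).trans_lt ?_
  calc ∑ i ∈ Finset.range P.β, 2 ^ i * n i ≤ ∑ i ∈ Finset.range P.β, 2 ^ i :=
        Finset.sum_le_sum fun i hi => (Nat.mul_le_mul_left _ (hn1 i hi)).trans (by simp)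
    _ < 2 ^ P.β := Nat.geomSum_lt le_rfl fun i hi => Finset.mem_range.mp hi

end Extraction


/-! ### Soundness probabilities -/

section SoundProb

variable {P : Params}

theorem ev_setC (S : Setup P) (f : Challenges P → ℝ≥0∞) :
    ev S.challenges f = ev S.challenges fun e => ev S.C fun c => f (setC e c) := by
  classical
  have h : ∀ (e : Challenges P) (c : P.R), Function.update e .c c = setC e c := by
    intro e c
    funext i
    cases i <;> simp [setC]
  rw [challenges_eq, ev_pi_update .c]
  congr 1
  funext e
  show ev S.C _ = _
  congr 1
  funext c
  rw [← h]

theorem exists_sum_update {I α M : Type} [Fintype I] {_ : DecidableEq I} [AddCommMonoid M]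
    (F : I → α → M) (w : I → α) (i₀ : I) :
    ∃ m, ∀ t, ∑ i, F i (Function.update w i₀ t i) = F i₀ t + m := by
  refine ⟨∑ i ∈ Finset.univ.erase i₀, F i (w i), fun t => ?_⟩
  rw [← Finset.add_sum_erase _ _ (Finset.mem_univ i₀), Function.update_self]
  congr 1
  refine Finset.sum_congr rfl fun i hi => ?_
  rw [Function.update_of_ne (Finset.ne_of_mem_erase hi)]

theorem ev_scal_root {a : ZMod P.q} (ha : a ≠ 0) (b : ZMod P.q) :
    ev (scalPMF P) (fun x => ind (b + coeff x 0 * a = 0)) ≤ (P.q : ℝ≥0∞)⁻¹ := by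
  rw [scalPMF, ev_map, ev_uniform, ZMod.card]
  simp only [coeff_scal]
  have h : ∑ t : ZMod P.q, ind (b + t * a = 0) = 1 := by
    rw [Finset.sum_eq_single (-b / a)]
    · exact ind_true (by field_simp; ring)
    · intro t _ ht
      refine ind_false fun h => ht ?_
      field_simp
      linear_combination h
    · simp
  rw [h, mul_one]

/-- With the other coordinates fixed, the form is affine in coordinate `i₀` with nonzero slope, and
over a field it has exactly one root. -/
theorem ev_linear_form {I : Type} [Fintype I] (a : I → ZMod P.q) (b : ZMod P.q) {i₀ : I}
    (ha : a i₀ ≠ 0) :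
    ev (piPMF fun _ : I => scalPMF P) (fun w => ind (b + ∑ i, coeff (w i) 0 * a i = 0))
      ≤ (P.q : ℝ≥0∞)⁻¹ := by
  classical
  rw [ev_pi_update i₀]
  refine ev_le_const _ fun w _ => ?_
  obtain ⟨m, hm⟩ := exists_sum_update (fun i t => coeff t 0 * a i) w i₀
  refine le_trans (ev_mono _ fun t => ind_mono ?_) (ev_scal_root ha (b + m))
  rw [hm]
  intro h
  linear_combination h

/-- Indices of the scalar challenges. -/
abbrev ScalIdx (P : Params) : Type := (Fin P.ν × Fin P.d) ⊕ (Fin P.β ⊕ Fin P.d)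

/-- Scalar challenges among all challenges. -/
def scalIdx : ScalIdx P → ChalIdx P
  | .inl j => .dy j
  | .inr (.inl α) => .dbin α
  | .inr (.inr j) => .dval j

theorem scalIdx_injective : Function.Injective (scalIdx (P := P)) := by
  rintro (i | i | i) (j | j | j) h <;> simp_all [scalIdx]

/-- A nontrivial linear relation between the scalar challenges holds with probability `1 / q`. -/
theorem ev_scalar_relation (S : Setup P) (gap : Challenges P → ScalIdx P → ZMod P.q)
    (hgap : ∀ e e', (∀ j α, e (.R j α) = e' (.R j α)) → gap e = gap e') (b : ZMod P.q) :
    ev S.challenges (fun e => ind (b + ∑ i, coeff (e (scalIdx i)) 0 * gap e i = 0 ∧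
      ∃ i, gap e i ≠ 0)) ≤ (P.q : ℝ≥0∞)⁻¹ := by
  classical
  -- The gaps depend on `R` alone, so they are constants when the scalar challenges are redrawn.
  rw [challenges_eq, ev_pi_resample (Set.range scalIdx)]
  refine ev_le_const _ fun x _ => ?_
  by_cases hx : ∃ i, gap x i ≠ 0
  · obtain ⟨i₀, hi₀⟩ := hx
    have h1 := ev_pi_marginal S.chalDist scalIdx scalIdx_injective
      (fun w => ind (b + ∑ i, coeff (w i) 0 * gap x i = 0))
    have h2 : (fun i => S.chalDist (scalIdx i)) = fun _ => scalPMF P := by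
      funext i
      rcases i with i | i | i <;> rfl
    rw [h2] at h1
    refine le_trans (le_trans (ev_mono _ fun y => ind_mono ?_) h1.le) (ev_linear_form _ b hi₀)
    rintro ⟨h, -⟩
    rw [hgap _ x fun j α => if_neg (by rintro ⟨i | i | i, hi⟩ <;> simp [scalIdx] at hi)] at h
    simpa using h
  · refine le_trans (ev_le_const (c := 0) _ fun y _ => ?_) zero_le
    rw [ind_false]
    rintro ⟨-, h⟩
    rw [hgap _ x fun j α => if_neg (by rintro ⟨i | i | i, hi⟩ <;> simp [scalIdx] at hi)] at h
    exact hx h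

/-- Two residues that differ by `w` cannot both lie in the window. So either the middle outcome, of
mass `1/2`, is alone in it, or only the two outer outcomes, of total mass `1/2`, can be. -/
theorem ev_bin_window {q : ℕ} [NeZero q] {w : ZMod q} {B : ℝ} (hw : 2 * B < |(w.valMinAbs : ℝ)|)
    (b : ZMod q) :
    ev binPMF (fun t => ind (|((b + (t : ZMod q) * w).valMinAbs : ℝ)| ≤ B)) ≤ 2⁻¹ := by
  have key : ∀ u u' : ZMod q, (u - u' = w ∨ u' - u = w) → |(u.valMinAbs : ℝ)| ≤ B →
      ¬ |(u'.valMinAbs : ℝ)| ≤ B := by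
    intro u u' h h1 h2
    have h3 : |w.valMinAbs| ≤ |u.valMinAbs| + |u'.valMinAbs| := by
      rcases h with h | h
      · exact (abs_valMinAbs_le w (u.valMinAbs - u'.valMinAbs) (by simp [h])).trans (abs_sub _ _)
      · refine (abs_valMinAbs_le w (u'.valMinAbs - u.valMinAbs) (by simp [h])).trans ?_
        rw [add_comm]
        exact abs_sub _ _
    have h4 : |(w.valMinAbs : ℝ)| ≤ |(u.valMinAbs : ℝ)| + |(u'.valMinAbs : ℝ)| := by
      exact_mod_cast h3
    linarith
  rw [ev_bin]
  have h4 : (4 : ℝ≥0∞)⁻¹ * 2 = 2⁻¹ := by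
    rw [show (4 : ℝ≥0∞) = 2 * 2 by norm_num, ENNReal.mul_inv (by simp) (by simp), mul_assoc,
      ENNReal.inv_mul_cancel (by simp) (by simp), mul_one]
  rw [← h4]
  gcongr
  by_cases h0 : |((b + ((0 : ℤ) : ZMod q) * w).valMinAbs : ℝ)| ≤ B
  · have h5 := key _ (b + ((-1 : ℤ) : ZMod q) * w) (Or.inl (by push_cast; ring)) h0
    have h6 := key _ (b + ((1 : ℤ) : ZMod q) * w) (Or.inr (by push_cast; ring)) h0
    rw [ind_false h5, ind_false h6, ind_true h0]
    norm_num
  · rw [ind_false h0, add_zero, add_zero, ← one_add_one_eq_two]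
    exact add_le_add (ind_le_one _) (ind_le_one _)

theorem ev_polyPMF_window {w : Fin P.d → ZMod P.q} {B : ℝ} {k₀ : Fin P.d}
    (hw : 2 * B < |((w k₀).valMinAbs : ℝ)|) (b : ZMod P.q) :
    ev (polyPMF binPMF : PMF P.R)
      (fun x => ind (|((b + ∑ k : Fin P.d, coeff x k * w k).valMinAbs : ℝ)| ≤ B)) ≤ 2⁻¹ := by
  classical
  rw [polyPMF, ev_map, ev_pi_update k₀]
  refine ev_le_const _ fun x _ => ?_
  obtain ⟨m, hm⟩ := exists_sum_update (fun k (t : ℤ) => (t : ZMod P.q) * w k) x k₀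
  refine le_trans (ev_mono _ fun t => ind_mono ?_) (ev_bin_window hw (b + m))
  simp only [coeff_red]
  rw [hm]
  intro h
  rwa [add_assoc, add_comm m]

theorem ind_le_prod {I : Type} [Fintype I] {A : Prop} {B : I → Prop} (h : A → ∀ j, B j) :
    ind A ≤ ∏ j, ind (B j) := by
  by_cases hA : A
  · rw [Finset.prod_eq_one fun j _ => ind_true (h hA j)]
    exact ind_le_one _
  · rw [ind_false hA]
    exact zero_le

/-- The projection of a vector with a large coefficient is short with small probability. -/
theorem ev_window (S : Setup P) {b : Fin P.β → P.R} {B : ℝ} {α₀ : Fin P.β} {k₀ : Fin P.d}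
    (hb : 2 * B < |((coeff (b α₀) k₀).valMinAbs : ℝ)|) (y : Fin P.ν → P.R) :
    ev S.challenges (fun e => ind (∀ j : Fin P.ν × Fin P.d,
      |((ip (fun α => e (.R j α)) b + coeff (y j.1) j.2).valMinAbs : ℝ)| ≤ B)) ≤ 2⁻¹ ^ 256 := by
  classical
  -- Only the column of `R` that meets the large coefficient is redrawn; each of its 256 entries
  -- gives an independent factor `1/2`.
  set φ : Fin P.ν × Fin P.d → ChalIdx P := fun j => .R j α₀ with hφ
  rw [challenges_eq, ev_pi_resample (Set.range φ)]
  refine ev_le_const _ fun x _ => ?_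
  set τ : Fin P.ν × Fin P.d → ZMod P.q := fun j => coeff (y j.1) j.2
    + ∑ α ∈ Finset.univ.erase α₀, ∑ k : Fin P.d, coeff (x (.R j α)) k * coeff (b α) k with hτ
  have h1 := ev_pi_marginal S.chalDist φ (fun i j h => by simpa [hφ] using h)
    (fun w => ∏ j, ind (|((τ j + ∑ k : Fin P.d, coeff (w j) k * coeff (b α₀) k).valMinAbs : ℝ)| ≤ B))
  refine le_trans (le_trans (ev_mono _ fun z => ?_) h1.le) ?_
  · beta_reduce
    refine ind_le_prod fun h j => ?_
    have h2 := h j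
    rw [ip, ← Finset.add_sum_erase _ _ (Finset.mem_univ α₀), if_pos ⟨j, rfl⟩] at h2
    convert h2 using 4
    simp only [hτ]
    rw [add_right_comm, add_comm (coeff (y j.1) _), add_right_comm, add_left_inj]
    congr 1
    refine Finset.sum_congr rfl fun α hα => Finset.sum_congr rfl fun k _ => ?_
    rw [if_neg]
    rintro ⟨j', hj'⟩
    simp only [hφ, ChalIdx.R.injEq] at hj'
    exact Finset.ne_of_mem_erase hα hj'.2.symm
  · rw [ev_piPMF_prod _ fun j x =>
      ind (|((τ j + ∑ k : Fin P.d, coeff x k * coeff (b α₀) k).valMinAbs : ℝ)| ≤ B)]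
    refine (Finset.prod_le_prod' fun j _ => ev_polyPMF_window hb (τ j)).trans (le_of_eq ?_)
    rw [Finset.prod_const, Finset.card_univ, Fintype.card_prod, Fintype.card_fin, Fintype.card_fin,
      ν_mul_d]

theorem abs_lift_le_nrm {ι : Type} [Fintype ι] (x : ι → P.R) (i : ι) (k : Fin P.d) :
    |(lift (x i) k : ℝ)| ≤ nrm x := by
  refine Real.le_sqrt_of_sq_le ?_
  rw [sq_abs]
  refine le_trans ?_ (Finset.single_le_sum (f := fun i => ∑ k, (lift (x i) k : ℝ) ^ 2)
    (fun _ _ => Finset.sum_nonneg fun _ _ => sq_nonneg _) (Finset.mem_univ i))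
  exact Finset.single_le_sum (f := fun k => (lift (x i) k : ℝ) ^ 2) (fun _ _ => sq_nonneg _)
    (Finset.mem_univ k)

/-- The challenges for which a proof of a false statement may be completed. -/
def Lucky (x : Stmt P) (K : AuxKey P) (σ : Strategy P) (s : Fin P.n₁ → P.R) (r : Fin P.n₃ → P.R)
    (e : Challenges P) : Prop :=
  coeff (extRel x K e (σ.reply e) s r) 0 = 0 ∧ nrm (fun b => σ.reply e (.z₂ b)) ≤ P.bound₂

/-- If some gap is nonzero, the relation holds with probability at most `1/q`. If all gaps vanish
and an extracted coefficient exceeds `2 * bound₂`, then `z₂` equals the projection plus a fixed mask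
and is short with probability at most `2⁻²⁵⁶`. All gaps zero with small coefficients would put the
assets in range. -/
theorem ev_lucky_le (S : Setup P) (hq : P.NoWrap) (x : Stmt P) (K : AuxKey P) (σ : Strategy P)
    (s : Fin P.n₁ → P.R) (r : Fin P.n₃ → P.R) (hr : ¬ InRange (extVal x r)) :
    ev S.challenges (fun e => ind (Lucky x K σ s r e)) ≤ (P.q : ℝ≥0∞)⁻¹ + 2⁻¹ ^ 256 := by
  -- First-round messages do not depend on the challenges, so they may be read off at the dummy
  -- challenges `0`; the extracted bits and masks are thereby fixed before `R` is drawn.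
  set b := extBin K (σ.reply 0) s with hb
  set y := extY K (σ.reply 0) s with hy
  set g := σ.reply 0 .ug - K .g ⬝ᵥ s with hg
  set gap : Challenges P → ScalIdx P → ZMod P.q := fun e =>
    Sum.elim (gapY e b y fun k => σ.reply e (.z₂ k)) (Sum.elim (gapBin b) (gapVal b (extVal x r)))
    with hgap
  have hgapc : ∀ e e', (∀ j α, e (.R j α) = e' (.R j α)) → gap e = gap e' := by
    intro e e' h
    have h1 : ∀ k, σ.reply e (.z₂ k) = σ.reply e' (.z₂ k) := fun k =>
      σ.causal _ _ _ fun j hj => by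
        cases j <;> first | exact h _ _ | (simp [ChalIdx.round, RespIdx.round] at hj)
    simp only [hgap]
    congr 1
    funext j
    simp only [gapY, h, h1]
  have hrel : ∀ e ∈ S.challenges.support, coeff (extRel x K e (σ.reply e) s r) 0
      = coeff g 0 + ∑ i, coeff (e (scalIdx i)) 0 * gap e i := by
    intro e he
    have e1 : extBin K (σ.reply e) s = b := by
      funext α; rw [extBin, reply_const σ e 0 _ (by simp [RespIdx.round])]; rfl
    have e2 : extY K (σ.reply e) s = y := by
      funext α; rw [extY, reply_const σ e 0 _ (by simp [RespIdx.round])]; rfl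
    rw [extRel, e1, e2, reply_const σ e 0 .ug (by simp [RespIdx.round]), coeff_add,
      coeff_relation e (scalarChal_of_mem S he)]
    simp only [Fintype.sum_sum_type, hgap, Sum.elim_inl, Sum.elim_inr, scalIdx]
    ring
  have hlin := ev_scalar_relation S gap hgapc (coeff g 0)
  by_cases hbig : ∃ α, ∃ k : Fin P.d, 2 * P.bound₂ < |((coeff (b α) k).valMinAbs : ℝ)|
  · obtain ⟨α₀, k₀, hbig⟩ := hbig
    have hwin := ev_window S hbig y
    refine le_trans ?_ (add_le_add hlin hwin)
    rw [← ev_add]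
    refine ev_mono_support _ fun e he => ?_
    refine le_trans (ind_mono fun hT => ?_) (ind_or_le _ _)
    rw [Lucky, hrel e he] at hT
    refine or_iff_not_imp_left.mpr fun hno j => ?_
    have h0 : gap e (.inl j) = 0 := by
      by_contra h
      exact hno ⟨hT.1, _, h⟩
    have h1 : ip (fun α => e (.R j α)) b + coeff (y j.1) j.2 = coeff (σ.reply e (.z₂ j.1)) j.2 :=
      sub_eq_zero.mp h0
    rw [h1]
    exact (abs_lift_le_nrm (fun k => σ.reply e (.z₂ k)) j.1 j.2).trans hT.2
  · push Not at hbig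
    refine le_trans ?_ (hlin.trans le_self_add)
    refine ev_mono_support _ fun e he => ind_mono fun hT => ?_
    rw [Lucky, hrel e he] at hT
    refine ⟨hT.1, ?_⟩
    by_contra hno
    push Not at hno
    exact hr (inRange_of_gaps hq hbig (fun α => hno (.inr (.inl α))) fun j => hno (.inr (.inr j)))

end SoundProb


/-! ### Success probability of the extractor -/

section Extractor

variable {P : Params}

/-- Largest probability that a difference with a fresh challenge is not invertible. -/
def nonInv (S : Setup P) : ℝ≥0∞ :=
  ⨆ c ∈ S.C.support, S.C.toOuterMeasure {c' | ¬ IsUnit (c - c')}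

theorem toOuterMeasure_eq_ev {α : Type} (p : PMF α) (E : Set α) :
    p.toOuterMeasure E = ev p fun x => ind (x ∈ E) := by
  classical
  unfold ev ind
  rw [PMF.toOuterMeasure_apply]
  refine tsum_congr fun x => ?_
  by_cases hx : x ∈ E <;> simp [hx]

theorem ev_nonunit_le (S : Setup P) {c : P.R} (hc : c ∈ S.C.support) :
    ev S.C (fun c' => ind (¬ IsUnit (c - c'))) ≤ nonInv S := by
  have h := le_iSup₂ (f := fun c (_ : c ∈ S.C.support) =>
    S.C.toOuterMeasure {c' | ¬ IsUnit (c - c')}) c hc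
  rwa [toOuterMeasure_eq_ev] at h

theorem nonInv_le_one (S : Setup P) : nonInv S ≤ 1 := by
  refine iSup₂_le fun c _ => ?_
  rw [toOuterMeasure_eq_ev]
  exact ev_le_const _ fun _ _ => ind_le_one _

/-- Draw the three points successively. The winning set has mass `2 δ + h`, and at most `2 δ` of it
is excluded by the one or two points already drawn, so each draw succeeds with probability at least
`h`. -/
theorem ev_three_distinct {α : Type} (p : PMF α) (W : α → Prop) (U : α → α → Prop) {δ h : ℝ≥0∞}
    (hδ : δ ≠ ⊤) (hU : ∀ c ∈ p.support, ev p (fun c' => ind (¬ U c c')) ≤ δ)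
    (hW : 2 * δ + h ≤ ev p fun c => ind (W c)) :
    h ^ 3 ≤ ev p fun a => ev p fun b => ev p fun c =>
      ind (W a ∧ (W b ∧ U a b) ∧ W c ∧ U a c ∧ U b c) := by
  have h1 : ∀ a ∈ p.support, h ≤ ev p fun b => ind (W b ∧ U a b) := by
    intro a ha
    refine ENNReal.le_of_add_le_add_left (a := 2 * δ) (by finiteness) (hW.trans ?_)
    calc ev p (fun c => ind (W c)) ≤ ev p fun b => ind (¬ U a b) + ind (W b ∧ U a b) :=
          ev_mono p fun b => by
            by_cases h1 : W b <;> by_cases h2 : U a b <;> simp [ind, h1, h2]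
      _ ≤ 2 * δ + _ := by
          rw [ev_add, two_mul]
          exact add_le_add ((hU a ha).trans le_self_add) le_rfl
  have h2 : ∀ a ∈ p.support, ∀ b ∈ p.support, h ≤ ev p fun c => ind (W c ∧ U a c ∧ U b c) := by
    intro a ha b hb
    refine ENNReal.le_of_add_le_add_left (a := 2 * δ) (by finiteness) (hW.trans ?_)
    calc ev p (fun c => ind (W c))
        ≤ ev p fun c => (ind (¬ U a c) + ind (¬ U b c)) + ind (W c ∧ U a c ∧ U b c) :=
          ev_mono p fun c => by
            by_cases h1 : W c <;> by_cases h2 : U a c <;> by_cases h3 : U b c <;>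
              simp [ind, h1, h2, h3]
      _ ≤ 2 * δ + _ := by
          rw [ev_add, ev_add, two_mul]
          exact add_le_add (add_le_add (hU a ha) (hU b hb)) le_rfl
  calc h ^ 3 = h * (h * h) := by ring
    _ ≤ ev p (fun a => ind (W a)) * (h * h) := by
        gcongr
        exact le_add_self.trans hW
    _ = ev p fun a => ind (W a) * (h * h) := (ev_mul_right _ _ _).symm
    _ ≤ _ := by
        refine ev_mono_support _ fun a ha => ?_
        calc ind (W a) * (h * h) ≤ ind (W a) * (ev p (fun b => ind (W b ∧ U a b)) * h) := by
              gcongr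
              exact h1 a ha
          _ = ev p fun b => ind (W a) * (ind (W b ∧ U a b) * h) := by
              rw [ev_mul_left, ev_mul_right]
          _ ≤ _ := by
              refine ev_mono_support _ fun b hb => ?_
              calc ind (W a) * (ind (W b ∧ U a b) * h)
                  ≤ ind (W a) * (ind (W b ∧ U a b) * ev p fun c => ind (W c ∧ U a c ∧ U b c)) := by
                    gcongr
                    exact h2 a ha b hb
                _ = _ := by
                    simp only [ind_and (W a), ind_and (W b ∧ U a b), ev_mul_left]

/-- Challenges for which the prover convinces often enough, over the last challenge. -/
def Heavy (S : Setup P) (x : Stmt P) (K : AuxKey P) (σ : Strategy P) (h : ℝ≥0∞)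
    (e : Challenges P) : Prop :=
  2 * nonInv S + h ≤ ev S.C fun c => ind (Wins x K σ (setC e c))

variable {S : Setup P} {x : Stmt P} {K : AuxKey P} {σ : Strategy P} {h κ : ℝ≥0∞}

/-- Averaging: one `h` of the excess is kept as the conditional success level, the other as the mass
of heavy challenges beyond the statistical error `κ`. -/
theorem ev_heavy (hκ : 2 * nonInv S + κ + (h + h) ≤ ev S.challenges fun e => ind (Wins x K σ e))
    (hh : h ≠ ⊤) : κ + h ≤ ev S.challenges fun e => ind (Heavy S x K σ h e) := by
  have hδ := ne_top_of_le_ne_top ENNReal.one_ne_top (nonInv_le_one S)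
  refine ENNReal.le_of_add_le_add_left (a := 2 * nonInv S + h) (by finiteness) ?_
  calc 2 * nonInv S + h + (κ + h) = 2 * nonInv S + κ + (h + h) := by ring
    _ ≤ _ := hκ
    _ = ev S.challenges fun e => ev S.C fun c => ind (Wins x K σ (setC e c)) := ev_setC S _
    _ ≤ ev S.challenges fun e => (2 * nonInv S + h) + ind (Heavy S x K σ h e) := by
        refine ev_mono _ fun e => ?_
        by_cases he : Heavy S x K σ h e
        · rw [ind_true he]
          exact (ev_le_const _ fun _ _ => ind_le_one _).trans le_add_self
        · exact (lt_of_not_ge he).le.trans le_self_add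
    _ = _ := by rw [ev_add, ev_const]

/-- Three accepting transcripts that differ in the last challenge. -/
def Triple (x : Stmt P) (K : AuxKey P) (σ : Strategy P) (e : Challenges P) (a b c : P.R) : Prop :=
  Wins x K σ (setC e a) ∧ (Wins x K σ (setC e b) ∧ IsUnit (a - b)) ∧ Wins x K σ (setC e c) ∧
    IsUnit (a - c) ∧ IsUnit (b - c)

theorem Triple.left {e : Challenges P} {a b c : P.R} (ht : Triple x K σ e a b c) :
    GoodPair x K σ (setC e a) b :=
  ⟨ht.1, by rw [setC_setC]; exact ht.2.1.1, ht.2.1.2⟩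

theorem Triple.right {e : Challenges P} {a b c : P.R} (ht : Triple x K σ e a b c) :
    GoodPair x K σ (setC e a) c :=
  ⟨ht.1, by rw [setC_setC]; exact ht.2.2.1, ht.2.2.2.1⟩

/-- A factor `h` for hitting a heavy prefix with property `N`, and `h ^ 3` for three rewound last
challenges. -/
theorem ev_triple (N : Challenges P → Prop)
    (hN : h ≤ ev S.challenges fun e => ind (Heavy S x K σ h e ∧ N e)) :
    h ^ 4 ≤ ev S.challenges fun e => ev S.C fun a => ev S.C fun b => ev S.C fun c =>
      ind (N e ∧ Triple x K σ e a b c) := by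
  have hδ := ne_top_of_le_ne_top ENNReal.one_ne_top (nonInv_le_one S)
  calc h ^ 4 = h * h ^ 3 := by ring
    _ ≤ ev S.challenges (fun e => ind (Heavy S x K σ h e ∧ N e)) * h ^ 3 := by gcongr
    _ = ev S.challenges (fun e => ind (Heavy S x K σ h e ∧ N e) * h ^ 3) := (ev_mul_right _ _ _).symm
    _ ≤ _ := by
        refine ev_mono _ fun e => ?_
        by_cases he : Heavy S x K σ h e ∧ N e
        · rw [ind_true he, one_mul]
          refine (ev_three_distinct S.C (fun c => Wins x K σ (setC e c)) (fun a b => IsUnit (a - b))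
            hδ (fun c hc => ev_nonunit_le S hc) he.1).trans ?_
          exact ev_mono _ fun a => ev_mono _ fun b => ev_mono _ fun c => ind_mono fun ht => ⟨he.2, ht⟩
        · rw [ind_false he, zero_mul]
          exact zero_le

theorem ev_goodPair (hκ : 2 * nonInv S + κ + (h + h) ≤ ev S.challenges fun e => ind (Wins x K σ e))
    (hh : h ≠ ⊤) :
    h ^ 4 ≤ ev S.challenges fun e => ev S.C fun c => ind (GoodPair x K σ e c) := by
  refine (ev_triple (fun _ => True) (le_add_self.trans
    ((ev_heavy hκ hh).trans (ev_mono _ fun e => ind_mono fun he => ⟨he, trivial⟩)))).trans ?_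
  rw [ev_setC S fun e => ev S.C fun c => ind (GoodPair x K σ e c)]
  refine ev_mono _ fun e => ev_mono _ fun a => ev_mono _ fun b => ev_le_const _ fun c _ => ?_
  exact ind_mono fun ht => ht.2.left

/-- Luck is decided before the last challenge. -/
theorem lucky_setC {s : Fin P.n₁ → P.R} {r : Fin P.n₃ → P.R} {e : Challenges P} {c : P.R}
    (hl : Lucky x K σ s r (setC e c)) : Lucky x K σ s r e := by
  unfold Lucky at hl ⊢
  have e1 : extBin K (σ.reply (setC e c)) s = extBin K (σ.reply e) s := by
    funext α; rw [extBin, extBin, reply_setC _ _ _ _ (by simp [RespIdx.round])]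
  have e2 : extY K (σ.reply (setC e c)) s = extY K (σ.reply e) s := by
    funext α; rw [extY, extY, reply_setC _ _ _ _ (by simp [RespIdx.round])]
  have e3 : extRel x K (setC e c) (σ.reply (setC e c)) s r = extRel x K e (σ.reply e) s r := by
    simp only [extRel, e1, e2, reply_setC _ _ _ (.z₂ _) (by simp [RespIdx.round]),
      reply_setC _ _ _ .ug (by simp [RespIdx.round])]
    rfl
  rw [e3] at hl
  simpa only [reply_setC _ _ _ (.z₂ _) (by simp [RespIdx.round])] using hl

/-- A good pair whose extracted randomness differs from a given one. -/
def Differs (x : Stmt P) (K : AuxKey P) (σ : Strategy P) (s : Fin P.n₁ → P.R)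
    (r : Fin P.n₃ → P.R) (e : Challenges P) (c : P.R) : Prop :=
  GoodPair x K σ e c ∧ (s ≠ ext₁ σ e c ∨ r ≠ ext₃ σ e c)

/-- Heavy prefixes exceed lucky ones by `h`, so triples on unlucky heavy prefixes have probability
at least `h ^ 4`. If both pairs `(a, b)` and `(a, c)` extracted the given opening,
`relation_of_triple` would make the prefix lucky. Hence one of them differs, and each is distributed
as a fresh pair, whence the factor `2`. -/
theorem ev_differs (hq : P.NoWrap)
    (hκ : 2 * nonInv S + ((P.q : ℝ≥0∞)⁻¹ + 2⁻¹ ^ 256) + (h + h)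
      ≤ ev S.challenges fun e => ind (Wins x K σ e)) (hh : h ≠ ⊤)
    (s : Fin P.n₁ → P.R) (r : Fin P.n₃ → P.R) (hr : ¬ InRange (extVal x r)) :
    h ^ 4 ≤ 2 * ev S.challenges fun e => ev S.C fun c => ind (Differs x K σ s r e c) := by
  have hl := ev_lucky_le S hq x K σ s r hr
  have hlt : ev S.challenges (fun e => ind (Lucky x K σ s r e)) ≠ ⊤ :=
    ev_ne_top ENNReal.one_ne_top fun _ => ind_le_one _
  have h1 : h ≤ ev S.challenges fun e => ind (Heavy S x K σ h e ∧ ¬ Lucky x K σ s r e) := by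
    refine ENNReal.le_of_add_le_add_left hlt ?_
    refine (add_le_add hl le_rfl).trans ((ev_heavy hκ hh).trans ?_)
    rw [← ev_add]
    exact ev_mono _ fun e => ind_le_add_not _ _
  refine (ev_triple _ h1).trans ?_
  have h2 : ∀ e ∈ S.challenges.support, ∀ a ∈ S.C.support, ∀ b ∈ S.C.support, ∀ c ∈ S.C.support,
      ind (¬ Lucky x K σ s r e ∧ Triple x K σ e a b c)
        ≤ ind (Differs x K σ s r (setC e a) b) + ind (Differs x K σ s r (setC e a) c) := by
    intro e he a ha b hb c hc
    refine (ind_mono ?_).trans (ind_or_le _ _)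
    rintro ⟨hl, ht⟩
    by_contra hno
    simp only [Differs, ht.left, ht.right, true_and, not_or, not_not] at hno
    have h3 := relation_of_triple ht.left ht.right ht.2.2.2.2 (S.C_conj _ ha) (S.C_conj _ hb)
      (S.C_conj _ hc) hno.1.1.symm hno.2.1.symm hno.1.2.symm hno.2.2.symm
    refine hl (lucky_setC (c := a) ⟨?_, ht.1.2.1⟩)
    rw [h3]
    exact ht.1.2.2.1
  calc _ ≤ ev S.challenges fun e => ev S.C fun a => ev S.C fun b => ev S.C fun c =>
        (ind (Differs x K σ s r (setC e a) b) + ind (Differs x K σ s r (setC e a) c)) :=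
        ev_mono_support _ fun e he => ev_mono_support _ fun a ha => ev_mono_support _ fun b hb =>
          ev_mono_support _ fun c hc => h2 e he a ha b hb c hc
    _ = _ := by
        rw [ev_setC S fun e => ev S.C fun c => ind (Differs x K σ s r e c)]
        simp only [ev_add, ev_const, two_mul]

/-- Success of the extractor on two pairs of challenges. -/
def Succeeds (x : Stmt P) (K : AuxKey P) (σ : Strategy P) (e : Challenges P) (c : P.R)
    (e' : Challenges P) (c' : P.R) : Prop :=
  let o := extOut x (e .c - c) (e' .c - c') (diff₁ σ e c) (diff₁ σ e' c') (diff₃ σ e c)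
    (diff₃ σ e' c')
  Extracted x o ∨ BreaksBinding x K o

/-- Condition on the first pair. If it is good with assets in range, extraction has succeeded; if
they are out of range, its opening is fixed independently of the second pair and `ev_differs`
supplies a conflicting one. -/
theorem ev_succeeds (hq : P.NoWrap)
    (hκ : 2 * nonInv S + ((P.q : ℝ≥0∞)⁻¹ + 2⁻¹ ^ 256) + (h + h)
      ≤ ev S.challenges fun e => ind (Wins x K σ e)) (hh : h ≠ ⊤) :
    h ^ 8 ≤ 2 * ev S.challenges fun e => ev S.C fun c => ev S.challenges fun e' => ev S.C fun c' =>
      ind (Succeeds x K σ e c e' c') := by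
  have hg := ev_goodPair hκ hh
  -- Covers the in-range case, where success is certain and the bound to prove becomes `h ^ 4 ≤ 2 *
  -- 1`.
  have h1 : h ^ 4 ≤ 2 := hg.trans ((ev_le_const _ fun e _ => ev_le_const _ fun c _ =>
    ind_le_one _).trans (by norm_num))
  calc h ^ 8 = h ^ 4 * h ^ 4 := by ring
    _ ≤ (ev S.challenges fun e => ev S.C fun c => ind (GoodPair x K σ e c)) * h ^ 4 := by gcongr
    _ = ev S.challenges fun e => ev S.C fun c => ind (GoodPair x K σ e c) * h ^ 4 := by
        simp only [ev_mul_right]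
    _ ≤ ev S.challenges fun e => ev S.C fun c => 2 * ev S.challenges fun e' => ev S.C fun c' =>
        ind (Succeeds x K σ e c e' c') := by
        refine ev_mono_support _ fun e he => ev_mono_support _ fun c hc => ?_
        by_cases hp : GoodPair x K σ e c
        · rw [ind_true hp, one_mul]
          by_cases hr : InRange (extVal x (ext₃ σ e c))
          · have h2 : ∀ e' c', Succeeds x K σ e c e' c' := fun e' c' =>
              Or.inl (extracted_of_inRange S hp hc (c_mem S he) hr _ _ _ _)
            simp only [ind_true (h2 _ _), ev_const, mul_one]
            exact h1
          · refine (ev_differs hq hκ hh (ext₁ σ e c) _ hr).trans ?_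
            gcongr
            refine ev_mono_support _ fun e' he' => ev_mono_support _ fun c' hc' => ind_mono ?_
            rintro ⟨hp', hne⟩
            exact Or.inr (breaksBinding_of_ne S hp hp' hc hc' (c_mem S he) (c_mem S he') hne)
        · rw [ind_false hp, zero_mul]
          exact zero_le
    _ = _ := by simp only [ev_mul_left]

end Extractor

/-! ### The extractor as a program -/

section ExtractorProg

variable {P : Params}

/-- Samplers of the challenges. -/
def chalSampler : ChalIdx P → Sampler
  | .R _ _ => .bin
  | .dy _ => .scalar
  | .dbin _ => .scalar
  | .dval _ => .scalar
  | .c => .chal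

theorem sample_chalSampler (S : Setup P) (i : ChalIdx P) :
    S.sample (chalSampler i) = S.chalDist i := by
  cases i <;> rfl

/-- Coins for one pair of transcripts: the challenges, and another last challenge. -/
abbrev PairIdx (P : Params) : Type := ChalIdx P ⊕ Unit

/-- Coins of the extractor. -/
def pairCoin : Bool → PairIdx P → PairIdx P ⊕ PairIdx P
  | false => .inl
  | true => .inr

/-- The challenges of a call, as coins. -/
def callIdx : Bool → ChalIdx P → PairIdx P
  | true, .c => .inr ()
  | _, i => .inl i

/-- Four nonadaptive calls: the prover is run on `e`, `setC e c`, `e'` and `setC e' c'` with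
independent pairs, indexed by `Bool × Bool` as (pair, rewound or not). The same strategy answers all
calls, which models the fixed random tape. -/
theorem exists_extractor (P : Params) :
    ∃ E : Prog P (StmtIdx P ⊕ (Row P × Fin P.n₁)) (ChalIdx P) (RespIdx P) (ExtIdx P),
      E.size ≤ 1024 * P.len ^ 11 ∧
      ∀ (S : Setup P) (x : Stmt P) (K : AuxKey P) (σ : Strategy P),
        ev (E.run S σ.reply (Sum.elim x fun p => K p.1 p.2))
            (fun o => ind (Extracted x o ∨ BreaksBinding x K o))
          = ev S.challenges fun e => ev S.C fun c => ev S.challenges fun e' => ev S.C fun c' =>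
              ind (Succeeds x K σ e c e' c') := by
  let V := ((StmtIdx P ⊕ (Row P × Fin P.n₁)) ⊕ (PairIdx P ⊕ PairIdx P)) ⊕
    ((Bool × Bool) × RespIdx P)
  let cd : Bool → (V → P.R) → P.R := fun b ρ =>
    ρ (.inl (.inr (pairCoin b (.inl .c)))) - ρ (.inl (.inr (pairCoin b (.inr ()))))
  let zd : Bool → RespIdx P → (V → P.R) → P.R := fun b i ρ =>
    ρ (.inr ((b, false), i)) - ρ (.inr ((b, true), i))
  have hcd : ∀ b, Comp 2 (cd b) := fun b => ((Comp.var _).sub (Comp.var _)).mono (by simp)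
  have hzd : ∀ b i, Comp 2 (zd b i) := fun b i => ((Comp.var _).sub (Comp.var _)).mono (by simp)
  let O : ExtIdx P → (V → P.R) → P.R := fun o ρ =>
    extOut (fun i => ρ (.inl (.inl (.inl i)))) (cd false ρ) (cd true ρ)
      (fun j => zd false (.z₁ j) ρ) (fun j => zd true (.z₁ j) ρ) (fun j => zd false (.z₃ j) ρ)
      (fun j => zd true (.z₃ j) ρ) o
  have hr : ∀ j, Comp 4 fun ρ => Ring.inverse (cd false ρ) * zd false (.z₃ j) ρ := fun j =>
    ((hcd false).inv.mul (hzd false _)).mono (by omega)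
  -- The deepest output is the message: level 4 for the randomness, 3 for the inner product, 2 for
  -- the subtraction. There are at most `len ^ 2` outputs and as many entries per query, hence the
  -- final exponent `11`.
  have hO : ∀ o, Comp 9 (O o) := by
    rintro (_ | j | k | j | j)
    · exact (hcd false).mono (by omega)
    · exact (hr j).mono (by omega)
    · have hd : P.n₃ ≤ P.len := by unfold Params.len Params.n₁ Params.n₃; omega
      have h1 := (Comp.var (P := P) (V := V) (.inl (.inl (.inl (.com k))))).sub
        (Comp.dot hd (fun j => Comp.var (P := P) (V := V) (.inl (.inl (.inl (.b k j))))) hr)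
      exact (h1.mono (by simp)).congr fun _ => rfl
    · exact (((hcd true).mul (hzd false _)).sub ((hcd false).mul (hzd true _))).mono (by omega)
    · exact (((hcd true).mul (hzd false _)).sub ((hcd false).mul (hzd true _))).mono (by omega)
  obtain ⟨E, hE1, hE2⟩ := exists_prog (P := P) (inp := StmtIdx P ⊕ (Row P × Fin P.n₁))
    (query := ChalIdx P) (ans := RespIdx P) (J := Bool × Bool)
    (Sum.elim (Sum.elim chalSampler fun _ => .chal) (Sum.elim chalSampler fun _ => .chal))
    (fun p i ρ => ρ (.inr (pairCoin p.1 (callIdx p.2 i)))) O 9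
    (fun p i => (Comp.var _).mono (by omega)) hO
  refine ⟨E, hE1.trans ?_, fun S x K σ => ?_⟩
  · have h1 := card_chal_le P
    have h2 := card_ext_le P
    have h3 := three_le_len P
    have h4 : P.len ^ 2 ≤ P.len ^ 11 := Nat.pow_le_pow_right (by omega) (by omega)
    have h5 : P.len ^ 11 = P.len ^ 2 * P.len ^ 9 := by ring
    have h6 := Nat.mul_le_mul_right (P.len ^ 9) h1
    have h7 := Nat.mul_le_mul_right (P.len ^ 9) h2
    have h8 : 1 ≤ P.len ^ 2 := Nat.one_le_pow _ _ (by omega)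
    simp only [Fintype.card_sum, Fintype.card_prod, Fintype.card_bool, Fintype.card_unit]
    rw [← h5] at h6 h7
    omega
  · rw [hE2]
    simp only [ev_pi_sum, ev_pi_unit, Sum.elim_inl, Sum.elim_inr, sample_chalSampler,
      challenges_eq]
    refine congrArg _ (funext fun e => congrArg _ (funext fun c => congrArg _ (funext fun e' =>
      congrArg _ (funext fun c' => ?_))))
    have h1 : (fun p : (Bool × Bool) × RespIdx P => σ.reply (fun q =>
        Sum.elim (Sum.elim e fun _ => c) (Sum.elim e' fun _ => c') (pairCoin p.1.1 (callIdx p.1.2 q)))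
          p.2) = fun p => σ.reply (bif p.1.1 then (bif p.1.2 then setC e' c' else e')
            else (bif p.1.2 then setC e c else e)) p.2 := by
      funext ⟨⟨b, b'⟩, i⟩
      refine congrArg (fun e => σ.reply e i) (funext fun q => ?_)
      cases b <;> cases b' <;> cases q <;> rfl
    rw [h1]
    rfl

end ExtractorProg


/-! ### Knowledge soundness -/

section KnowledgeSoundness

variable {P : Params}

theorem nonInvProb_nonneg (S : Setup P) : 0 ≤ nonInvProb S := ENNReal.toReal_nonneg

theorem ofReal_nonInvProb (S : Setup P) : ENNReal.ofReal (nonInvProb S) = nonInv S :=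
  ENNReal.ofReal_toReal (ne_top_of_le_ne_top ENNReal.one_ne_top (nonInv_le_one S))

/-- Puts the success probability in the form required by `ev_succeeds`, with the excess `η` split
into two equal parts `h = η / 2`. -/
theorem ofReal_knowledgeError_add (S : Setup P) {η : ℝ} (hη : 0 ≤ η) :
    ENNReal.ofReal (knowledgeError S + η) = 2 * nonInv S + ((P.q : ℝ≥0∞)⁻¹ + 2⁻¹ ^ 256)
      + (ENNReal.ofReal (η / 2) + ENNReal.ofReal (η / 2)) := by
  have hq : (0 : ℝ) < P.q := by exact_mod_cast P.prime.pos
  have h0 := nonInvProb_nonneg S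
  have h1 : (P.q : ℝ≥0∞)⁻¹ = ENNReal.ofReal (1 / P.q) := by
    rw [one_div, ENNReal.ofReal_inv_of_pos hq, ENNReal.ofReal_natCast]
  have h2 : (2⁻¹ : ℝ≥0∞) ^ 256 = ENNReal.ofReal (2 ^ (-256 : ℤ)) := by
    rw [zpow_neg, show ((2 : ℝ) ^ (256 : ℤ))⁻¹ = (2⁻¹ : ℝ) ^ 256 by rw [inv_pow]; norm_cast,
      ENNReal.ofReal_pow (by norm_num), ENNReal.ofReal_inv_of_pos (by norm_num)]
    simp
  have h3 : (2 : ℝ≥0∞) = ENNReal.ofReal 2 := by simp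
  have h4 : (0 : ℝ) ≤ 2 ^ (-256 : ℤ) := by positivity
  have h5 : 0 ≤ 1 / (P.q : ℝ) := by positivity
  rw [h1, h2, h3, ← ofReal_nonInvProb, ← ENNReal.ofReal_mul (by norm_num),
    ← ENNReal.ofReal_add h5 h4, ← ENNReal.ofReal_add (by positivity) (by positivity),
    ← ENNReal.ofReal_add (by positivity) (by positivity),
    ← ENNReal.ofReal_add (by positivity) (by positivity)]
  congr 1
  rw [knowledgeError]
  ring

/-- The convex function `t ^ 8` lies above its tangent at `a`; Bernoulli's inequality after scaling
by `a`. -/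
theorem pow_eight_tangent {a t : ℝ} (ha : 0 ≤ a) (ht : 0 ≤ t) : 8 * a ^ 7 * t ≤ t ^ 8 + 7 * a ^ 8 := by
  rcases ha.eq_or_lt with rfl | ha
  · simp only [ne_eq, OfNat.ofNat_ne_zero, not_false_eq_true, zero_pow, mul_zero, zero_mul, add_zero]
    positivity
  have h := one_add_mul_le_pow (a := t / a - 1) (by have := div_nonneg ht ha.le; linarith) 8
  have h1 := mul_le_mul_of_nonneg_left h (pow_nonneg ha.le 8)
  have h2 : a ^ 8 * (1 + (t / a - 1)) ^ 8 = t ^ 8 := by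
    rw [← mul_pow]
    congr 1
    field_simp
    ring
  have h3 : a ^ 8 * (1 + (8 : ℕ) * (t / a - 1)) = 8 * a ^ 7 * t - 7 * a ^ 8 := by
    field_simp
    push_cast
    ring
  rw [h2, h3] at h1
  linarith

theorem acceptProb_eq (S : Setup P) (x : Stmt P) (K : AuxKey P) (A : PMF (Strategy P)) :
    ENNReal.ofReal (acceptProb S x K A)
      = ev A fun σ => ev S.challenges fun e => ind (Wins x K σ e) := by
  rw [acceptProb, ofReal_Pr]
  simp only [ev_do_bind, ev_do_pure]
  rfl

/-- A bound affine in the success probability of a deterministic prover can be averaged over random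
tapes, as in Jensen's inequality. It holds trivially for tapes below the knowledge error. The
constant is `512 = 2 * 2 ^ 8`, from `h = t / 2` and the factor `2` in `ev_succeeds`. -/
theorem tangent_succeeds (S : Setup P) (hq : P.NoWrap) (x : Stmt P) (K : AuxKey P) (σ : Strategy P)
    {a : ℝ} (ha : 0 ≤ a) :
    ENNReal.ofReal (8 * a ^ 7) * ev S.challenges (fun e => ind (Wins x K σ e))
      ≤ 512 * (ev S.challenges fun e => ev S.C fun c => ev S.challenges fun e' =>
          ev S.C fun c' => ind (Succeeds x K σ e c e' c'))
        + ENNReal.ofReal (8 * a ^ 7 * knowledgeError S + 7 * a ^ 8) := by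
  obtain ⟨ε, hε⟩ : ∃ ε : ℝ, ε = (ev S.challenges fun e => ind (Wins x K σ e)).toReal := ⟨_, rfl⟩
  have hεt : ev S.challenges (fun e => ind (Wins x K σ e)) = ENNReal.ofReal ε := by
    rw [hε, ENNReal.ofReal_toReal (ev_ne_top ENNReal.one_ne_top fun _ => ind_le_one _)]
  have hε0 : 0 ≤ ε := hε ▸ ENNReal.toReal_nonneg
  have hκ0 : 0 ≤ knowledgeError S := by
    have := nonInvProb_nonneg S
    unfold knowledgeError
    positivity
  rw [hεt, ← ENNReal.ofReal_mul (by positivity)]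
  rcases le_or_gt ε (knowledgeError S) with h | h
  · refine le_trans (ENNReal.ofReal_le_ofReal ?_) le_add_self
    have h1 : 8 * a ^ 7 * ε ≤ 8 * a ^ 7 * knowledgeError S := by gcongr
    have h2 : 0 ≤ 7 * a ^ 8 := by positivity
    linarith
  · obtain ⟨t, ht⟩ : ∃ t, t = ε - knowledgeError S := ⟨_, rfl⟩
    have ht0 : 0 ≤ t := by linarith
    have h1 := ev_succeeds (S := S) (x := x) (K := K) (σ := σ) (h := ENNReal.ofReal (t / 2)) hq
      (by rw [← ofReal_knowledgeError_add S ht0, hεt]; exact ENNReal.ofReal_le_ofReal (by linarith))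
      ENNReal.ofReal_ne_top
    have h2 : ENNReal.ofReal (t ^ 8) = 256 * ENNReal.ofReal (t / 2) ^ 8 := by
      rw [← ENNReal.ofReal_pow (by positivity), show (256 : ℝ≥0∞) = ENNReal.ofReal 256 by simp,
        ← ENNReal.ofReal_mul (by norm_num)]
      congr 1
      ring
    have h3 := pow_eight_tangent ha ht0
    calc ENNReal.ofReal (8 * a ^ 7 * ε)
        ≤ ENNReal.ofReal (t ^ 8 + (8 * a ^ 7 * knowledgeError S + 7 * a ^ 8)) := by
          refine ENNReal.ofReal_le_ofReal ?_
          rw [show ε = t + knowledgeError S by linarith]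
          linarith
      _ = 256 * ENNReal.ofReal (t / 2) ^ 8
          + ENNReal.ofReal (8 * a ^ 7 * knowledgeError S + 7 * a ^ 8) := by
          rw [ENNReal.ofReal_add (by positivity) (by positivity), h2]
      _ ≤ _ := by
          refine add_le_add ((mul_le_mul_right h1 256).trans (le_of_eq ?_)) le_rfl
          rw [← mul_assoc]
          norm_num

/-- Average the tangent inequality over the tape, with tangency point `a` equal to the mean excess
over the knowledge error; it collapses to `a ^ 8 ≤ 512 * π`. -/
theorem knowledgeSound (S : Setup P) (hq : P.NoWrap) {k : ℕ} (hk : 11 ≤ k) :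
    KnowledgeSound S 1024 k 8 := by
  obtain ⟨E, hE1, hE2⟩ := exists_extractor P
  have hpow : P.len ^ 11 ≤ P.len ^ k :=
    Nat.pow_le_pow_right (by have := three_le_len P; omega) hk
  refine ⟨E, hE1.trans (Nat.mul_le_mul_left _ hpow), fun x K A hA => ?_⟩
  obtain ⟨a, ha⟩ : ∃ a, a = acceptProb S x K A - knowledgeError S := ⟨_, rfl⟩
  have ha0 : 0 < a := by linarith
  have hκ0 : 0 ≤ knowledgeError S := by
    have := nonInvProb_nonneg S
    unfold knowledgeError
    positivity
  rw [← ha]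
  obtain ⟨π, hπ⟩ : ∃ π, π = Pr (do
      let σ ← A
      E.run S σ.reply (Sum.elim x fun p => K p.1 p.2))
      {o | Extracted x o ∨ BreaksBinding x K o} := ⟨_, rfl⟩
  rw [← hπ]
  have hπ0 : 0 ≤ π := hπ ▸ Pr_nonneg _ _
  have hπ1 : ENNReal.ofReal π = ev A fun σ => ev S.challenges fun e => ev S.C fun c =>
      ev S.challenges fun e' => ev S.C fun c' => ind (Succeeds x K σ e c e' c') := by
    rw [hπ, ofReal_Pr, ev_do_bind]
    exact congrArg _ (funext fun σ => hE2 S x K σ)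
  have h1 := ev_mono A fun σ => tangent_succeeds S hq x K σ ha0.le
  rw [ev_mul_left, ev_add, ev_mul_left, ev_const, ← acceptProb_eq, ← hπ1,
    ← ENNReal.ofReal_mul (by positivity), show (512 : ℝ≥0∞) = ENNReal.ofReal 512 by simp,
    ← ENNReal.ofReal_mul (by norm_num), ← ENNReal.ofReal_add (by positivity) (by positivity),
    ENNReal.ofReal_le_ofReal_iff (by positivity)] at h1
  have h2 : a ^ 8 ≤ 512 * π := by
    rw [show acceptProb S x K A = a + knowledgeError S by linarith] at h1
    nlinarith
  refine h2.trans (mul_le_mul_of_nonneg_right ?_ hπ0)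
  have h3 : 512 ≤ 1024 * P.len ^ k := by
    have := Comp.one_le_pow (P := P) k
    omega
  exact_mod_cast h3

end KnowledgeSoundness


/-! ### Transcripts computed by programs -/

section TranscriptComp

variable {P : Params} {V : Type} {k : ℕ}

namespace Comp

theorem add_same {F G : (V → P.R) → P.R} (hF : Comp k F) (hG : Comp k G) :
    Comp (k + 1) fun ρ => F ρ + G ρ := (hF.add hG).mono (by omega)

theorem mul_same {F G : (V → P.R) → P.R} (hF : Comp k F) (hG : Comp k G) :
    Comp (k + 1) fun ρ => F ρ * G ρ := (hF.mul hG).mono (by omega)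

theorem sub_same {F G : (V → P.R) → P.R} (hF : Comp k F) (hG : Comp k G) :
    Comp (k + 2) fun ρ => F ρ - G ρ := (hF.sub hG).mono (by omega)

theorem const_mul (r : P.R) {F : (V → P.R) → P.R} (hF : Comp k F) :
    Comp (k + 1) fun ρ => r * F ρ := ((const r).mul hF).mono (by omega)

theorem dot_same {n : ℕ} (hn : n ≤ P.len) {F G : Fin n → (V → P.R) → P.R}
    (hF : ∀ i, Comp k (F i)) (hG : ∀ i, Comp k (G i)) :
    Comp (k + 3) fun ρ => (fun i => F i ρ) ⬝ᵥ fun i => G i ρ := (dot hn hF hG).mono (by omega)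

theorem card_β_le (P : Params) : Fintype.card (Fin P.β) ≤ P.len := by
  simp only [Fintype.card_fin, Params.len, Params.n₁]
  omega

theorem card_ν_le (P : Params) : Fintype.card (Fin P.ν) ≤ P.len := by
  have := ν_le P
  simp only [Fintype.card_fin, Params.len]
  omega

theorem card_d_le (P : Params) : Fintype.card (Fin P.d) ≤ P.len := by
  simp only [Fintype.card_fin, Params.len]
  omega

theorem card_νd_le (P : Params) : Fintype.card (Fin P.ν × Fin P.d) ≤ P.len := by
  rw [Fintype.card_prod, Fintype.card_fin, Fintype.card_fin, ν_mul_d, Params.len]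
  omega

theorem n₁_le (P : Params) : P.n₁ ≤ P.len := by
  unfold Params.len
  omega

theorem n₃_le (P : Params) : P.n₃ ≤ P.len := by
  unfold Params.len Params.n₁ Params.n₃
  omega

variable {e : ChalIdx P → (V → P.R) → P.R}

theorem lin (he : ∀ i, Comp k (e i)) {b : Fin P.β → (V → P.R) → P.R} (hb : ∀ α, Comp k (b α))
    {y : Fin P.ν → (V → P.R) → P.R} (hy : ∀ i, Comp k (y i)) {v : (V → P.R) → P.R}
    (hv : Comp k v) :
    Comp (k + 10) fun ρ => PoA.lin (fun i => e i ρ) (fun α => b α ρ) (fun i => y i ρ) (v ρ) := by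
  have h1 : ∀ j, Comp (k + 6) fun ρ => e (.dy j) ρ *
      (∑ α, PoA.conj (e (.R j α) ρ) * b α ρ + ∑ i, PoA.conj (unitVec j i) * y i ρ) := fun j =>
    mul_same ((he _).mono (by omega)) (add_same
      (sum (card_β_le P) fun α => mul_same (he _).conj ((hb α).mono (by omega)))
      ((sum (card_ν_le P) fun i => const_mul _ (hy i)).mono (by omega)))
  have h2 : ∀ α, Comp (k + 2) fun ρ => e (.dbin α) ρ * (PoA.conj (negOnes P) * b α ρ) := fun α =>
    mul_same ((he _).mono (by omega)) (const_mul _ (hb α))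
  have h3 : ∀ j : Fin P.d, Comp (k + 4) fun ρ => e (.dval j) ρ *
      (PoA.conj (powPoly P (j.modNat : Fin P.a)) * b j.divNat ρ
        - PoA.conj (Xbar ^ (j : ℕ)) * v ρ) := fun j =>
    mul_same ((he _).mono (by omega)) (sub_same (const_mul _ (hb _)) (const_mul _ hv))
  exact (add_same (add_same (sum (card_νd_le P) h1) ((sum (card_β_le P) h2).mono (by omega)))
    ((sum (card_d_le P) h3).mono (by omega))).congr fun ρ => rfl

theorem quad (he : ∀ i, Comp k (e i)) {x y : Fin P.β → (V → P.R) → P.R} (hx : ∀ α, Comp k (x α))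
    (hy : ∀ α, Comp k (y α)) :
    Comp (k + 5) fun ρ => PoA.quad (fun i => e i ρ) (fun α => x α ρ) fun α => y α ρ :=
  sum (card_β_le P) fun α => mul_same ((he _).mono (by omega))
    (mul_same (hx α).conj ((hy α).mono (by omega)))

theorem cst (he : ∀ i, Comp k (e i)) {z : Fin P.ν → (V → P.R) → P.R} (hz : ∀ i, Comp k (z i)) :
    Comp (k + 6) fun ρ => PoA.cst (fun i => e i ρ) fun i => z i ρ :=
  sum (card_νd_le P) fun _ => mul_same ((he _).mono (by omega))
    (sum (card_ν_le P) fun i => const_mul _ (hz i))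

theorem ofCoeffs_scal (f : Fin P.d → ZMod P.q) :
    PoA.ofCoeffs f = ∑ i : Fin P.d, Xbar ^ (i : ℕ) * scal (f i) :=
  Finset.sum_congr rfl fun _ _ => mul_comm _ _

theorem binPoly {v : (V → P.R) → P.R} (hv : Comp k v) (α : Fin P.β) :
    Comp (k + 5) fun ρ => PoA.binPoly (v ρ) α := by
  refine ((sum (card_d_le P) fun t : Fin P.d => const_mul (Xbar ^ (t : ℕ))
    ((hv.coeff ((α : ℕ) * P.a + (t : ℕ) / P.β)).bit ((t : ℕ) % P.β))).mono (by omega)).congr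
    fun ρ => ?_
  rw [PoA.binPoly, ofCoeffs_scal]
  refine Finset.sum_congr rfl fun t _ => ?_
  rw [coeff_scal]
  split_ifs
  · rw [scal_one]
  · rw [scal_zero]

theorem redV_imageR (e : Challenges P) (b : Fin P.β → P.R) (i : Fin P.ν) :
    redV (imageR e b) i = ∑ t : Fin P.d, Xbar ^ (t : ℕ) *
      scal (PoA.coeff (∑ α, PoA.conj (e (.R (i, t) α)) * b α) 0) := by
  rw [redV, red, ofCoeffs_scal]
  refine Finset.sum_congr rfl fun t _ => ?_
  rw [sum_conj_eq_ip (fun α => e (.R (i, t) α)) b, imageR, ZMod.coe_valMinAbs]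

theorem imageR (he : ∀ i, Comp k (e i)) {b : Fin P.β → (V → P.R) → P.R} (hb : ∀ α, Comp k (b α))
    (i : Fin P.ν) :
    Comp (k + 8) fun ρ => redV (PoA.imageR (fun i => e i ρ) fun α => b α ρ) i := by
  have h1 : ∀ (t : Fin P.d) (α : Fin P.β),
      Comp (k + 2) fun ρ => PoA.conj (e (.R (i, t) α) ρ) * b α ρ := fun t α =>
    mul_same (he _).conj ((hb α).mono (by omega))
  have h2 : ∀ t : Fin P.d, Comp (k + 6) fun ρ => Xbar ^ (t : ℕ) *
      scal (PoA.coeff (∑ α, PoA.conj (e (.R (i, t) α) ρ) * b α ρ) 0) := fun t =>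
    const_mul _ ((sum (card_β_le P) (h1 t)).coeff 0)
  refine (sum (card_d_le P) h2).congr fun ρ => ?_
  rw [redV_imageR]

end Comp

/-- Transcript as a family of ring elements. -/
def Transcript.out (t : Transcript P) : ChalIdx P ⊕ RespIdx P → P.R := Sum.elim t.chal t.resp

namespace Comp

variable {x : StmtIdx P → (V → P.R) → P.R} {K : Row P → Fin P.n₁ → (V → P.R) → P.R}
  {e : ChalIdx P → (V → P.R) → P.R} {u : Row P → (V → P.R) → P.R} {h v g : (V → P.R) → P.R}
  {z₁ : Fin P.n₁ → (V → P.R) → P.R} {z₂ : Fin P.ν → (V → P.R) → P.R}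
  {z₃ : Fin P.n₃ → (V → P.R) → P.R} {r : Fin P.n₃ → (V → P.R) → P.R}

theorem maskedReply (hx : ∀ i, Comp k (x i)) (hK : ∀ i j, Comp k (K i j)) (he : ∀ i, Comp k (e i))
    (hu : ∀ i, Comp k (u i)) (hh : Comp k h) (hz₁ : ∀ i, Comp k (z₁ i)) (hz₂ : ∀ i, Comp k (z₂ i))
    (hz₃ : ∀ i, Comp k (z₃ i)) (i : RespIdx P) :
    Comp (k + 25) fun ρ => PoA.maskedReply (fun i => x i ρ) (fun i j => K i j ρ) (fun i => e i ρ)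
      (fun i => u i ρ) (h ρ) (fun i => z₁ i ρ) (fun i => z₂ i ρ) (fun i => z₃ i ρ) i := by
  have hd : ∀ i, Comp (k + 3) fun ρ => (fun j => K i j ρ) ⬝ᵥ fun j => z₁ j ρ := fun i =>
    dot_same (n₁_le P) (hK i) hz₁
  have hd₃ : ∀ f : Fin P.n₃ → StmtIdx P,
      Comp (k + 3) fun ρ => (fun j => x (f j) ρ) ⬝ᵥ fun j => z₃ j ρ := fun f =>
    dot_same (n₃_le P) (fun j => hx (f j)) hz₃
  have hzu : ∀ i, Comp (k + 5) fun ρ => e .c ρ * u i ρ - (fun j => K i j ρ) ⬝ᵥ fun j => z₁ j ρ :=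
    fun i => sub_same ((mul_same (he _) (hu i)).mono (by omega)) (hd i)
  cases i with
  | u₀ i => exact (hu (.a i)).mono (by omega)
  | uy₂ b => exact (hu (.y₂ b)).mono (by omega)
  | ug => exact (hu .g).mono (by omega)
  | ubin α => exact (hu (.bin α)).mono (by omega)
  | z₂ b => exact (hz₂ b).mono (by omega)
  | h => exact hh.mono (by omega)
  | w₁ i =>
    exact (sub_same (hd (.a i)) ((mul_same (he .c) (hu (.a i))).mono (by omega))).mono
      (by omega)
  | w₂ i =>
    exact (sub_same (hd₃ (StmtIdx.A i)) ((mul_same (he .c) (hx (.com₀ i))).mono (by omega))).mono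
      (by omega)
  | ug₁ => exact (hu .g₁).mono (by omega)
  | z₁ j => exact (hz₁ j).mono (by omega)
  | z₃ j => exact (hz₃ j).mono (by omega)
  | v =>
    have he' : ∀ i, Comp (k + 5) (e i) := fun i => (he i).mono (by omega)
    have hq := quad he' (fun α => hzu (.bin α)) fun α => hzu (.bin α)
    have hv : Comp (k + 5) fun ρ => e .c ρ * x (.com 2) ρ
        - (fun j => x (.b 2 j) ρ) ⬝ᵥ fun j => z₃ j ρ :=
      sub_same ((mul_same (he _) (hx _)).mono (by omega)) (hd₃ (StmtIdx.b 2))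
    have hl := mul_same ((he' .c).mono (by omega)) (lin he' (fun α => hzu (.bin α))
      (fun b => hzu (.y₂ b)) hv)
    have hg := mul_same (he' .c) (hzu .g)
    have hc := mul_same (mul_same ((he .c).mono (by omega)) ((he .c).mono (by omega)))
      (add_same (hh.mono (by omega : k ≤ k + 6)) (cst he hz₂))
    refine ((sub_same (sub_same (add_same (add_same (hq.mono (by omega : _ ≤ k + 16)) hl)
      (hg.mono (by omega))) (hc.mono (by omega))) ((hzu .g₁).mono (by omega))).mono
      (by omega)).congr fun ρ => ?_
    simp only [PoA.maskedReply, verifyRhs, pow_two]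

theorem zeroConst (hg : Comp k g) : Comp (k + 3) fun ρ => PoA.zeroConst (g ρ) :=
  sub_same (hg.mono (by omega)) (hg.coeff 0)

theorem payload (hx : ∀ i, Comp k (x i)) (hK : ∀ i j, Comp k (K i j)) (hr : ∀ i, Comp k (r i))
    (hv : Comp k v) (hg : Comp k g) (he : ∀ i, Comp k (e i)) (hu : ∀ i, Comp k (u i))
    (hz₁ : ∀ i, Comp k (z₁ i)) (hz₂ : ∀ i, Comp k (z₂ i)) (hz₃ : ∀ i, Comp k (z₃ i)) (i : Row P) :
    Comp (k + 20) fun ρ => PoA.payload (fun i => x i ρ) (fun i j => K i j ρ) (fun i => r i ρ) (v ρ)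
      (g ρ) (fun i => e i ρ) (fun i => u i ρ) (fun i => z₁ i ρ) (fun i => z₂ i ρ)
      (fun i => z₃ i ρ) i := by
  have hd : ∀ i, Comp (k + 3) fun ρ => (fun j => K i j ρ) ⬝ᵥ fun j => z₁ j ρ := fun i =>
    dot_same (n₁_le P) (hK i) hz₁
  have hzu : ∀ i, Comp (k + 6) fun ρ => e .c ρ * u i ρ - (fun j => K i j ρ) ⬝ᵥ fun j => z₁ j ρ :=
    fun i => (sub_same ((mul_same (he _) (hu i)).mono (by omega)) (hd i)).mono (by omega)
  have hb : ∀ α, Comp (k + 6) fun ρ => PoA.binPoly (v ρ) α := fun α => (binPoly hv α).mono (by omega)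
  cases i with
  | a i => exact (const 0).mono (by omega)
  | y₂ b => exact (hz₂ b).mono (by omega)
  | g => exact hg.mono (by omega)
  | bin α => exact (hb α).mono (by omega)
  | g₁ =>
    have he' : ∀ i, Comp (k + 6) (e i) := fun i => (he i).mono (by omega)
    have hyv : Comp (k + 6) fun ρ => e .c ρ * ((fun j => x (.b 2 j) ρ) ⬝ᵥ fun j => r j ρ)
        - (fun j => x (.b 2 j) ρ) ⬝ᵥ fun j => z₃ j ρ :=
      sub_same (mul_same ((he _).mono (by omega))
        (dot_same (n₃_le P) (fun j => hx (StmtIdx.b 2 j)) hr))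
        ((dot_same (n₃_le P) (fun j => hx (StmtIdx.b 2 j)) hz₃).mono (by omega))
    have hl := lin he' (fun α => hzu (.bin α)) (fun b => hzu (.y₂ b)) hyv
    have hq := quad he' hb fun α => hzu (.bin α)
    have hq' := quad he' (fun α => hzu (.bin α)) hb
    exact ((add_same (add_same (add_same hl (hq.mono (by omega))) (hq'.mono (by omega)))
      ((hzu .g).mono (by omega))).mono (by omega)).congr fun ρ => rfl

/-- Inputs are allowed level 3 because the garbage polynomial is `zeroConst` of a coin. The bits
then reach level 8, the unmasked `y₂` level 18, the payload 38 and the replies 64, rounded up to 70.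
-/
theorem hybrid (hx : ∀ i, Comp 3 (x i)) (hK : ∀ i j, Comp 3 (K i j)) (hr : ∀ i, Comp 3 (r i))
    (hv : Comp 3 v) (hg : Comp 3 g) (he : ∀ i, Comp 3 (e i)) (hu : ∀ i, Comp 3 (u i))
    (hz₁ : ∀ i, Comp 3 (z₁ i)) (hz₂ : ∀ i, Comp 3 (z₂ i)) (hz₃ : ∀ i, Comp 3 (z₃ i))
    (i : ChalIdx P ⊕ RespIdx P) :
    Comp 70 fun ρ => (PoA.hybrid (fun i => x i ρ) (fun i j => K i j ρ) (fun i => r i ρ) (v ρ)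
      (g ρ) (fun i => e i ρ) (fun i => u i ρ) (fun i => z₁ i ρ) (fun i => z₂ i ρ)
      (fun i => z₃ i ρ)).out i := by
  rcases i with i | i
  · exact (he i).mono (by omega)
  have hb : ∀ α, Comp 8 fun ρ => PoA.binPoly (v ρ) α := binPoly hv
  have hY : ∀ i, Comp 18 fun ρ => z₂ i ρ
      - redV (PoA.imageR (fun i => e i ρ) fun α => PoA.binPoly (v ρ) α) i := fun i =>
    sub_same ((hz₂ i).mono (by omega)) (imageR (fun i => (he i).mono (by omega)) hb i)
  have h18 : ∀ {F : (V → P.R) → P.R}, Comp 3 F → Comp 18 F := fun h => h.mono (by omega)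
  have hpl := payload (fun i => h18 (hx i)) (fun i j => h18 (hK i j)) (fun i => h18 (hr i)) (h18 hv)
    (h18 hg) (fun i => h18 (he i)) (fun i => h18 (hu i)) (fun i => h18 (hz₁ i)) hY
    (fun i => h18 (hz₃ i))
  have hu' := fun i => add_same ((hu i).mono (by omega : 3 ≤ 38)) (hpl i)
  have hrel := sub_same (add_same (lin (fun i => h18 (he i)) (fun α => (hb α).mono (by omega)) hY
    (h18 hv)) ((quad (fun i => h18 (he i)) (fun α => (hb α).mono (by omega : 8 ≤ 18))
      fun α => (hb α).mono (by omega)).mono (by omega)))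
    ((cst (fun i => h18 (he i)) fun i => h18 (hz₂ i)).mono (by omega))
  have hh := add_same (hg.mono (by omega)) hrel
  have h39 : ∀ {F : (V → P.R) → P.R}, Comp 3 F → Comp 39 F := fun h => h.mono (by omega)
  exact ((maskedReply (fun i => h39 (hx i)) (fun i j => h39 (hK i j)) (fun i => h39 (he i)) hu'
    (hh.mono (by omega)) (fun i => h39 (hz₁ i)) (fun i => h39 (hz₂ i)) (fun i => h39 (hz₃ i)) i).mono
    (by omega)).congr fun ρ => rfl

end Comp

end TranscriptComp


/-! ### Uniform masks -/

section Uniform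

variable {P : Params}

theorem PMF_ext_ev {α : Type} {p q : PMF α} (h : ∀ f, ev p f = ev q f) : p = q := by
  have key : ∀ (p : PMF α) (x : α), ev p (fun y => ind (y = x)) = p x := by
    intro p x
    rw [ev, tsum_eq_single x]
    · rw [ind_true rfl, mul_one]
    · intro y hy
      rw [ind_false hy, mul_zero]
  ext x
  rw [← key p, ← key q, h]

theorem ev_unif_add (a : P.R) (f : P.R → ℝ≥0∞) :
    ev (unifPMF P) (fun x => f (x + a)) = ev (unifPMF P) f := by
  have h : ∀ c : Fin P.d → ZMod P.q,
      (ofCoeffs c : P.R) + a = ofCoeffs (c + fun i : Fin P.d => coeff a i) := fun c => by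
    rw [ofCoeffs_add, ofCoeffs_coeff]
  rw [unifPMF, ev_map, ev_map]
  simp only [h]
  exact ev_uniform_equiv (Equiv.addRight fun i : Fin P.d => coeff a i) fun c => f (ofCoeffs c)

theorem ev_unif_pi_add {ι : Type} [Fintype ι] (a : ι → P.R) (f : (ι → P.R) → ℝ≥0∞) :
    ev (piPMF fun _ : ι => unifPMF P) (fun u => f fun i => u i + a i)
      = ev (piPMF fun _ : ι => unifPMF P) f := by
  have h : ∀ i, (unifPMF P).map (fun x => x + a i) = unifPMF P := fun i =>
    PMF_ext_ev fun f => by rw [ev_map, ev_unif_add]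
  have h1 := piPMF_map (fun _ : ι => unifPMF P) fun i x => x + a i
  simp only [h] at h1
  conv_rhs => rw [h1, ev_map]

/-- Shifts that depend, in one coordinate, on the other coordinates. -/
theorem ev_unif_pi_shift {ι : Type} [Fintype ι] (i₀ : ι) (p : (ι → P.R) → ι → P.R)
    (hp : ∀ u u', (∀ i, i ≠ i₀ → u i = u' i) → p u = p u')
    (hc : ∀ u u' i, i ≠ i₀ → p u i = p u' i) (f : (ι → P.R) → ℝ≥0∞) :
    ev (piPMF fun _ : ι => unifPMF P) (fun u => f fun i => u i + p u i)
      = ev (piPMF fun _ : ι => unifPMF P) f := by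
  classical
  -- First shift by the part of `p` that is constant, leaving out coordinate `i₀`. With the other
  -- coordinates fixed, the remaining shift of coordinate `i₀` is a constant too.
  set a : ι → P.R := fun i => if i = i₀ then 0 else p 0 i with ha
  rw [← ev_unif_pi_add a f, ev_pi_update i₀, ev_pi_update i₀ _ fun u => f fun i => u i + a i]
  congr 1
  funext u
  conv_rhs => rw [← ev_unif_add (p u i₀)]
  congr 1
  funext x
  congr 1
  funext i
  rw [hp (Function.update u i₀ x) u fun i hi => Function.update_of_ne hi _ _]
  by_cases hi : i = i₀
  · subst hi
    simp [ha]
  · rw [Function.update_of_ne hi, Function.update_of_ne hi, hc u 0 i hi]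
    simp [ha, hi]

end Uniform

/-! ### Simulation -/

section Simulation

variable {P : Params}

theorem coeff_relVal (v : P.R) (hv : InRange v) (e : Challenges P) (he : ScalarChal e)
    (z₂ : Fin P.ν → P.R) :
    coeff (relVal v e (fun b => z₂ b - redV (imageR e (binPoly v)) b) z₂) 0 = 0 := by
  rw [relVal, coeff_relation e he]
  have h1 : ∀ j, gapY e (binPoly v) (fun b => z₂ b - redV (imageR e (binPoly v)) b) z₂ j = 0 := by
    intro j
    rw [gapY, coeff_sub, redV, coeff_red, imageR, ZMod.coe_valMinAbs]
    ring
  simp only [h1, gapBin_binPoly, gapVal_binPoly v hv, mul_zero, Finset.sum_const_zero, add_zero]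

/-- Expectation over the garbage polynomial, the challenges and Gaussian masked openings. -/
def evMasked (S : Setup P)
    (F : P.R → Challenges P → (Fin P.n₁ → P.R) → (Fin P.ν → P.R) → (Fin P.n₃ → P.R) → ℝ≥0∞) :
    ℝ≥0∞ :=
  ev (unifPMF P) fun g => ev S.challenges fun e =>
    ev (piPMF fun _ : Fin P.n₁ => (polyPMF (gaussPMF P.s₁) : PMF P.R)) fun z₁ =>
      ev (piPMF fun _ : Fin P.ν => (polyPMF (gaussPMF P.s₂) : PMF P.R)) fun z₂ =>
        ev (piPMF fun _ : Fin P.n₃ => (polyPMF (gaussPMF P.s₃) : PMF P.R)) fun z₃ =>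
          F (zeroConst g) e z₁ z₂ z₃

/-- The garbage polynomial is drawn last, when the value of the relation that it must absorb is
already fixed. -/
theorem evMasked_eq (S : Setup P)
    (F : P.R → Challenges P → (Fin P.n₁ → P.R) → (Fin P.ν → P.R) → (Fin P.n₃ → P.R) → ℝ≥0∞) :
    evMasked S F = ev S.challenges fun e =>
      ev (piPMF fun _ : Fin P.n₁ => (polyPMF (gaussPMF P.s₁) : PMF P.R)) fun z₁ =>
        ev (piPMF fun _ : Fin P.ν => (polyPMF (gaussPMF P.s₂) : PMF P.R)) fun z₂ =>
          ev (piPMF fun _ : Fin P.n₃ => (polyPMF (gaussPMF P.s₃) : PMF P.R)) fun z₃ =>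
            ev (unifPMF P) fun g => F (zeroConst g) e z₁ z₂ z₃ := by
  rw [evMasked, ev_comm]
  refine congrArg _ (funext fun e => ?_)
  rw [ev_comm]
  refine congrArg _ (funext fun z₁ => ?_)
  rw [ev_comm]
  refine congrArg _ (funext fun z₂ => ?_)
  rw [ev_comm]

theorem zeroConst_add {a : P.R} (ha : coeff a 0 = 0) (g : P.R) :
    zeroConst (g + a) = zeroConst g + a := by
  rw [zeroConst, zeroConst, coeff_add, ha, add_zero]
  ring

/-- With a uniform Module-LWE sample, the transcript is simulated. -/
theorem ev_hybrid_uniform (S : Setup P) (x : Stmt P) (K : AuxKey P) (r : Fin P.n₃ → P.R) (v : P.R)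
    (hv : InRange v) (F : Transcript P → ℝ≥0∞) :
    (ev (piPMF fun _ : Row P => unifPMF P) fun u =>
      evMasked S fun g e z₁ z₂ z₃ => F (hybrid x K r v g e u z₁ z₂ z₃))
    = ev (piPMF fun _ : Row P => unifPMF P) fun u =>
      evMasked S fun g e z₁ z₂ z₃ => F ⟨e, maskedReply x K e u g z₁ z₂ z₃⟩ := by
  simp only [evMasked_eq]
  rw [ev_comm, ev_comm _ S.challenges]
  refine ev_congr_support _ fun e he => ?_
  rw [ev_comm, ev_comm (piPMF fun _ : Row P => unifPMF P)]
  refine congrArg _ (funext fun z₁ => ?_)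
  rw [ev_comm, ev_comm (piPMF fun _ : Row P => unifPMF P)]
  refine congrArg _ (funext fun z₂ => ?_)
  rw [ev_comm, ev_comm (piPMF fun _ : Row P => unifPMF P)]
  refine congrArg _ (funext fun z₃ => ?_)
  have hρ := coeff_relVal v hv e (scalarChal_of_mem S he) z₂
  set ρ := relVal v e (fun b => z₂ b - redV (imageR e (binPoly v)) b) z₂ with hρdef
  have h1 : ∀ g, ev (piPMF fun _ : Row P => unifPMF P)
      (fun u => F (hybrid x K r v (zeroConst g) e u z₁ z₂ z₃))
      = ev (piPMF fun _ : Row P => unifPMF P)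
        fun u => F ⟨e, maskedReply x K e u (zeroConst g + ρ) z₁ z₂ z₃⟩ := by
    intro g
    -- Only the message committed in row `g₁` depends on the sample, and only through the other
    -- rows.
    refine ev_unif_pi_shift Row.g₁ (fun u => payload x K r v (zeroConst g) e u z₁
      (fun b => z₂ b - redV (imageR e (binPoly v)) b) z₃) ?_ ?_
      fun u => F ⟨e, maskedReply x K e u (zeroConst g + ρ) z₁ z₂ z₃⟩
    · intro u u' h
      funext i
      have h1 : ∀ α, u (.bin α) = u' (.bin α) := fun α => h _ (by simp)
      have h2 : ∀ b, u (.y₂ b) = u' (.y₂ b) := fun b => h _ (by simp)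
      have h3 : u .g = u' .g := h _ (by simp)
      simp only [payload, h1, h2, h3]
    · intro u u' i hi
      cases i <;> first | rfl | exact absurd rfl hi
  rw [ev_comm]
  simp only [h1]
  rw [ev_comm]
  refine congrArg _ (funext fun u => ?_)
  -- The value of the relation has zero constant coefficient, so adding it commutes with
  -- `zeroConst`, and translation invariance of the uniform distribution removes it.
  simp only [← zeroConst_add hρ]
  exact ev_unif_add ρ fun g => F ⟨e, maskedReply x K e u (zeroConst g) z₁ z₂ z₃⟩

/-- Expected output of a distinguisher on transcripts made from a Module-LWE sample. -/
theorem ev_hybrid_mlwe (S : Setup P) (x : Stmt P) (K : AuxKey P) (r : Fin P.n₃ → P.R) (v : P.R)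
    (F : Transcript P → ℝ≥0∞) :
    (ev (piPMF fun _ : Fin P.n₁ => (polyPMF S.χ : PMF P.R)) fun s =>
      evMasked S fun g e z₁ z₂ z₃ => F (hybrid x K r v g e (fun i => K i ⬝ᵥ s) z₁ z₂ z₃))
    = evHybrid S fun g s e z₁ z₂ z₃ =>
        F (hybrid x K r v g e (fun i => K i ⬝ᵥ s) (redV z₁) (redV z₂) (redV z₃)) := by
  unfold evMasked evHybrid
  rw [ev_comm]
  simp only [ev_pi_poly]
  rfl

/-- Both `f / W` and `H` lie between `f` and `f + (1 - W)`. -/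
theorem abs_div_sub_le {f W H δ : ℝ} (hf : 0 ≤ f) (hW : 0 < W) (hW1 : W ≤ 1) (hfW : f ≤ W)
    (hfH : f ≤ H) (hsum : H + W ≤ f + 1) (hδ : 1 - W ≤ δ) :
    0 ≤ f / W ∧ f / W ≤ 1 ∧ |f / W - H| ≤ δ := by
  have hle : f / W ≤ 1 := div_le_one_of_le₀ hfW hW.le
  refine ⟨div_nonneg hf hW.le, hle, ?_⟩
  have h1 : f ≤ f / W := le_div_self hf hW hW1
  have h2 : f / W - f ≤ 1 - W := by
    have h3 : f / W - f = f / W * (1 - W) := by field_simp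
    rw [h3]
    exact mul_le_of_le_one_left (by linarith) hle
  rw [abs_le]
  constructor <;> linarith

/-- Conditioning on the rejection steps changes expectations by little. -/
theorem abs_honestExpect_sub_le (S : Setup P) (x : Stmt P) (K : AuxKey P) (r : Fin P.n₃ → P.R)
    (m : Fin 3 → P.R) (hr : nrm r ≤ √(P.n₃ * P.d)) (hx : Opens x r m) (D : Transcript P → ℝ)
    (hD : ∀ t, 0 ≤ D t ∧ D t ≤ 1) :
    0 ≤ honestExpect S x K r (m 2) D ∧ honestExpect S x K r (m 2) D ≤ 1 ∧
    |honestExpect S x K r (m 2) D - (evHybrid S fun g s e z₁ z₂ z₃ => ENNReal.ofReal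
      (D (hybrid x K r (m 2) g e (fun i => K i ⬝ᵥ s) (redV z₁) (redV z₂) (redV z₃)))).toReal|
      ≤ 2 ^ (-100 : ℤ) := by
  set W := evHybrid S fun _ s e z₁ z₂ z₃ => wts r (m 2) s e z₁ z₂ z₃ with hW
  set H := evHybrid S fun g s e z₁ z₂ z₃ => ENNReal.ofReal
      (D (hybrid x K r (m 2) g e (fun i => K i ⬝ᵥ s) (redV z₁) (redV z₂) (redV z₃))) with hH
  set f := evHybrid S fun g s e z₁ z₂ z₃ => wts r (m 2) s e z₁ z₂ z₃ * ENNReal.ofReal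
      (D (hybrid x K r (m 2) g e (fun i => K i ⬝ᵥ s) (redV z₁) (redV z₂) (redV z₃))) with hf
  have hD1 : ∀ t, ENNReal.ofReal (D t) ≤ 1 := fun t => by simpa using (hD t).2
  have hW1 : W ≤ 1 := evHybrid_le_one S fun _ _ _ _ _ _ => wts_le_one _ _ _ _ _ _ _
  have hH1 : H ≤ 1 := evHybrid_le_one S fun _ _ _ _ _ _ => hD1 _
  have hfW : f ≤ W := evHybrid_mono S fun _ _ _ _ _ _ _ _ => mul_le_of_le_one_right' (hD1 _)
  have hfH : f ≤ H := evHybrid_mono S fun _ _ _ _ _ _ _ _ =>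
    mul_le_of_le_one_left' (wts_le_one _ _ _ _ _ _ _)
  -- Pointwise this is `(1 - w) * (1 - D) ≥ 0`, with `w` the weight.
  have hsum : H + W ≤ f + 1 := by
    rw [hH, hW, hf, ← evHybrid_add, ← evHybrid_const S 1, ← evHybrid_add]
    refine evHybrid_mono S fun g s _ e _ z₁ z₂ z₃ => ?_
    have h1 := wts_le_one r (m 2) s e z₁ z₂ z₃
    have h2 := hD1 (hybrid x K r (m 2) (zeroConst g) e (fun i => K i ⬝ᵥ s) (redV z₁) (redV z₂)
      (redV z₃))
    revert h1 h2
    generalize wts r (m 2) s e z₁ z₂ z₃ = w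
    generalize ENNReal.ofReal _ = d
    intro h1 h2
    lift w to NNReal using ne_top_of_le_ne_top ENNReal.one_ne_top h1
    lift d to NNReal using ne_top_of_le_ne_top ENNReal.one_ne_top h2
    norm_cast at h1 h2 ⊢
    rw [← NNReal.coe_le_coe] at h1 h2 ⊢
    push_cast at h1 h2 ⊢
    nlinarith [w.coe_nonneg, d.coe_nonneg]
  have htop : ∀ {a : ℝ≥0∞}, a ≤ 1 → a ≠ ⊤ := fun h => ne_top_of_le_ne_top ENNReal.one_ne_top h
  have hWt := htop hW1
  have hHt := htop hH1
  have hft := htop (hfW.trans hW1)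
  have hW2 : 1 - 1 / 2 ^ 100 ≤ W.toReal := by
    have h1 := ENNReal.toReal_mono (by finiteness) (one_le_evHybrid_wts S r (m 2) hr)
    rw [ENNReal.toReal_add hWt (by finiteness), ENNReal.toReal_ofReal (by positivity),
      ENNReal.toReal_one] at h1
    linarith
  have hW3 : W.toReal ≤ 1 := by simpa using ENNReal.toReal_mono ENNReal.one_ne_top hW1
  have hfW' := ENNReal.toReal_mono hWt hfW
  have hfH' := ENNReal.toReal_mono hHt hfH
  have hsum' := ENNReal.toReal_mono (by finiteness) hsum
  rw [ENNReal.toReal_add hHt hWt, ENNReal.toReal_add hft (by finiteness), ENNReal.toReal_one]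
    at hsum'
  have hf0 : 0 ≤ f.toReal := ENNReal.toReal_nonneg
  have hWpos : 0 < W.toReal := lt_of_lt_of_le (by norm_num) hW2
  have hexp : honestExpect S x K r (m 2) D = f.toReal / W.toReal := by
    have h0 : ∀ o : Option (Transcript P), 0 ≤ o.elim 0 D := by
      rintro (_ | t)
      · exact le_rfl
      · exact (hD t).1
    rw [honestExpect, Pr_isSome S x K r m hx, expect_eq _ _ h0,
      ev_honestRun S x K r m hx _ (by simp), ENNReal.toReal_mul,
      ENNReal.toReal_ofReal (by norm_num), ← hW]
    simp only [Option.elim_some]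
    rw [← hf, mul_div_mul_left _ _ (by norm_num)]
  rw [hexp, show (2 : ℝ) ^ (-100 : ℤ) = 1 / 2 ^ 100 by norm_num]
  exact abs_div_sub_le hf0 hWpos hW3 hfW' hfH' hsum' (by linarith)

/-! ### Simulator and reduction as programs -/

/-- Coins shared by the simulator and the reduction. -/
abbrev CoinIdx (P : Params) : Type :=
  Unit ⊕ (ChalIdx P ⊕ (Fin P.n₁ ⊕ (Fin P.ν ⊕ Fin P.n₃)))

/-- Samplers of the shared coins. -/
def sharedCoin : CoinIdx P → Sampler :=
  Sum.elim (fun _ => .unif) (Sum.elim chalSampler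
    (Sum.elim (fun _ => .gauss₁) (Sum.elim (fun _ => .gauss₂) fun _ => .gauss₃)))

theorem ev_sharedCoin (S : Setup P) (f : (CoinIdx P → P.R) → ℝ≥0∞)
    (F : P.R → Challenges P → (Fin P.n₁ → P.R) → (Fin P.ν → P.R) → (Fin P.n₃ → P.R) → ℝ≥0∞)
    (hf : ∀ g e z₁ z₂ z₃, f (Sum.elim (fun _ => g) (Sum.elim e (Sum.elim z₁ (Sum.elim z₂ z₃))))
      = F (zeroConst g) e z₁ z₂ z₃) :
    ev (piPMF fun i => S.sample (sharedCoin i)) f = evMasked S F := by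
  simp only [ev_pi_sum, ev_pi_unit, sharedCoin, Sum.elim_inl, Sum.elim_inr, sample_chalSampler,
    evMasked, challenges_eq, hf]
  rfl

theorem card_coinIdx_le (P : Params) : Fintype.card (CoinIdx P) ≤ 2 * P.len ^ 2 := by
  have h1 := card_chal_le P
  have h2 : P.κ + P.lam + 3 + P.β + P.d + 256 = P.len := rfl
  have h3 := ν_le P
  have h4 : 259 * P.len ≤ P.len ^ 2 := by
    rw [pow_two]; exact Nat.mul_le_mul_right _ (three_le_len P)
  simp only [Fintype.card_sum, Fintype.card_fin, Fintype.card_unit, Params.n₁, Params.n₃]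
  omega

theorem transcript_size_le {s c : ℕ} (hc : c ≤ 3 * P.len ^ 2)
    (hs : s ≤ c + 0 + 0 * (Fintype.card Empty * P.len ^ 70)
      + Fintype.card (ChalIdx P ⊕ RespIdx P) * P.len ^ 70) : s ≤ 1024 * P.len ^ 72 := by
  have h1 := card_chal_le P
  have h2 := card_resp_le P
  have h3 := three_le_len P
  have h4 : P.len ^ 2 ≤ P.len ^ 72 := Nat.pow_le_pow_right (by omega) (by omega)
  have h5 : P.len ^ 72 = P.len ^ 2 * P.len ^ 70 := by ring
  have h6 := Nat.mul_le_mul_right (P.len ^ 70) h1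
  have h7 := Nat.mul_le_mul_right (P.len ^ 70) h2
  rw [Fintype.card_sum, add_mul] at hs
  rw [← h5] at h6 h7
  omega

theorem exists_reduction (P : Params) :
    ∃ T : TranscriptProg P ((StmtIdx P ⊕ (Row P × Fin P.n₁)) ⊕ (Row P ⊕ (Fin P.n₃ ⊕ Fin 3))),
      T.size ≤ 1024 * P.len ^ 72 ∧
      ∀ (S : Setup P) (x : Stmt P) (K : AuxKey P) (u : Row P → P.R) (r : Fin P.n₃ → P.R)
        (m : Fin 3 → P.R) (F : Transcript P → ℝ≥0∞),
        ev (T.run S (fun _ i => i.elim)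
            (Sum.elim (Sum.elim x fun p => K p.1 p.2) (Sum.elim u (Sum.elim r m))))
          (fun o => F ⟨fun i => o (.inl i), fun i => o (.inr i)⟩)
        = evMasked S fun g e z₁ z₂ z₃ => F (hybrid x K r (m 2) g e u z₁ z₂ z₃) := by
  let V := ((((StmtIdx P ⊕ (Row P × Fin P.n₁)) ⊕ (Row P ⊕ (Fin P.n₃ ⊕ Fin 3))) ⊕ CoinIdx P)
    ⊕ (Empty × Empty))
  have hvar : ∀ x : V, Comp 3 fun ρ : V → P.R => ρ x := fun x => (Comp.var x).mono (by omega)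
  have hO := Comp.hybrid (P := P) (V := V)
    (x := fun i ρ => ρ (.inl (.inl (.inl (.inl i)))))
    (K := fun i j ρ => ρ (.inl (.inl (.inl (.inr (i, j))))))
    (r := fun i ρ => ρ (.inl (.inl (.inr (.inr (.inl i))))))
    (v := fun ρ => ρ (.inl (.inl (.inr (.inr (.inr 2))))))
    (g := fun ρ => zeroConst (ρ (.inl (.inr (.inl ())))))
    (e := fun i ρ => ρ (.inl (.inr (.inr (.inl i)))))
    (u := fun i ρ => ρ (.inl (.inl (.inr (.inl i)))))
    (z₁ := fun i ρ => ρ (.inl (.inr (.inr (.inr (.inl i))))))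
    (z₂ := fun i ρ => ρ (.inl (.inr (.inr (.inr (.inr (.inl i)))))))
    (z₃ := fun i ρ => ρ (.inl (.inr (.inr (.inr (.inr (.inr i)))))))
    (fun _ => hvar _) (fun _ _ => hvar _) (fun _ => hvar _) (hvar _)
    (Comp.zeroConst (Comp.var _)) (fun _ => hvar _) (fun _ => hvar _) (fun _ => hvar _)
    (fun _ => hvar _) (fun _ => hvar _)
  obtain ⟨T, hT1, hT2⟩ := exists_prog (P := P) (query := Empty) (ans := Empty) (J := Empty)
    (sharedCoin (P := P)) (fun j _ _ => j.elim) _ 70 (fun j => j.elim) hO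
  refine ⟨T, transcript_size_le ((card_coinIdx_le P).trans (by omega)) hT1,
    fun S x K u r m F => ?_⟩
  rw [hT2]
  refine ev_sharedCoin S _ _ fun g e z₁ z₂ z₃ => ?_
  rfl

theorem exists_simulator (P : Params) :
    ∃ Sim : TranscriptProg P (StmtIdx P ⊕ (Row P × Fin P.n₁)),
      Sim.size ≤ 1024 * P.len ^ 72 ∧
      ∀ (S : Setup P) (x : Stmt P) (K : AuxKey P) (F : Transcript P → ℝ≥0∞),
        ev (Sim.run S (fun _ i => i.elim) (Sum.elim x fun p => K p.1 p.2))
          (fun o => F ⟨fun i => o (.inl i), fun i => o (.inr i)⟩)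
        = ev (piPMF fun _ : Row P => unifPMF P) fun u =>
          evMasked S fun g e z₁ z₂ z₃ => F ⟨e, maskedReply x K e u g z₁ z₂ z₃⟩ := by
  let V := (((StmtIdx P ⊕ (Row P × Fin P.n₁)) ⊕ (Row P ⊕ CoinIdx P)) ⊕ (Empty × Empty))
  have hvar : ∀ x : V, Comp 3 fun ρ : V → P.R => ρ x := fun x => (Comp.var x).mono (by omega)
  have hm := Comp.maskedReply (P := P) (V := V)
    (x := fun i ρ => ρ (.inl (.inl (.inl i))))
    (K := fun i j ρ => ρ (.inl (.inl (.inr (i, j)))))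
    (e := fun i ρ => ρ (.inl (.inr (.inr (.inr (.inl i))))))
    (u := fun i ρ => ρ (.inl (.inr (.inl i))))
    (h := fun ρ => zeroConst (ρ (.inl (.inr (.inr (.inl ()))))))
    (z₁ := fun i ρ => ρ (.inl (.inr (.inr (.inr (.inr (.inl i)))))))
    (z₂ := fun i ρ => ρ (.inl (.inr (.inr (.inr (.inr (.inr (.inl i))))))))
    (z₃ := fun i ρ => ρ (.inl (.inr (.inr (.inr (.inr (.inr (.inr i))))))))
    (fun _ => hvar _) (fun _ _ => hvar _) (fun _ => hvar _) (fun _ => hvar _)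
    (Comp.zeroConst (Comp.var _)) (fun _ => hvar _) (fun _ => hvar _) (fun _ => hvar _)
  let O : ChalIdx P ⊕ RespIdx P → (V → P.R) → P.R := fun i ρ =>
    (⟨fun i => ρ (.inl (.inr (.inr (.inr (.inl i))))),
      maskedReply (fun i => ρ (.inl (.inl (.inl i)))) (fun i j => ρ (.inl (.inl (.inr (i, j)))))
        (fun i => ρ (.inl (.inr (.inr (.inr (.inl i)))))) (fun i => ρ (.inl (.inr (.inl i))))
        (zeroConst (ρ (.inl (.inr (.inr (.inl ()))))))
        (fun i => ρ (.inl (.inr (.inr (.inr (.inr (.inl i)))))))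
        (fun i => ρ (.inl (.inr (.inr (.inr (.inr (.inr (.inl i))))))))
        (fun i => ρ (.inl (.inr (.inr (.inr (.inr (.inr (.inr i))))))))⟩ : Transcript P).out i
  have hO : ∀ i, Comp 70 (O i) := by
    rintro (i | i)
    · exact (Comp.var _).mono (by omega)
    · exact (hm i).mono (by omega)
  obtain ⟨T, hT1, hT2⟩ := exists_prog (P := P) (inp := StmtIdx P ⊕ (Row P × Fin P.n₁))
    (query := Empty) (ans := Empty) (J := Empty) (Sum.elim (fun _ : Row P => .unif) sharedCoin)
    (fun j _ _ => j.elim) O 70 (fun j => j.elim) hO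
  refine ⟨T, transcript_size_le ?_ hT1, fun S x K F => ?_⟩
  · rw [Fintype.card_sum]
    have h1 := card_row_le P
    have h2 := card_coinIdx_le P
    have h3 := three_le_len P
    nlinarith
  · rw [hT2, ev_pi_sum]
    refine congrArg _ (funext fun u => ?_)
    refine ev_sharedCoin S _ _ fun g e z₁ z₂ z₃ => ?_
    rfl

/-! ### The hybrid argument for zero-knowledge -/

theorem expect_congr {α : Type} (p : PMF α) {f g : α → ℝ} (h : ∀ x, f x = g x) :
    expect p f = expect p g := by rw [funext h]

theorem abs_expect_sub_le {α : Type} (p : PMF α) {f g : α → ℝ} {δ : ℝ}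
    (hf : ∀ x, 0 ≤ f x ∧ f x ≤ 1) (hg : ∀ x, 0 ≤ g x ∧ g x ≤ 1) (hδ : 0 ≤ δ)
    (h : ∀ x, |f x - g x| ≤ δ) : |expect p f - expect p g| ≤ δ := by
  have key : ∀ {f g : α → ℝ}, (∀ x, 0 ≤ f x ∧ f x ≤ 1) → (∀ x, 0 ≤ g x ∧ g x ≤ 1) →
      (∀ x, f x ≤ g x + δ) → expect p f ≤ expect p g + δ := by
    intro f g hf hg h
    have hg0 := (expect_mem p g hg).1
    rw [← ENNReal.ofReal_le_ofReal_iff (by positivity), ENNReal.ofReal_add hg0 hδ,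
      ofReal_expect p f hf, ofReal_expect p g hg, ← ev_const p (ENNReal.ofReal δ), ← ev_add]
    refine ev_mono p fun x => ?_
    rw [← ENNReal.ofReal_add (hg x).1 hδ]
    exact ENNReal.ofReal_le_ofReal (h x)
  have h1 := key hf hg fun x => by linarith [(abs_le.mp (h x)).2]
  have h2 := key hg hf fun x => by linarith [(abs_le.mp (h x)).1]
  rw [abs_le]
  constructor <;> linarith

/-- The intermediate quantity `H` is the unweighted Gaussian experiment with real products `K s`. It
is within `2⁻¹⁰⁰` of the conditioned honest expectation for every key, and its mean over keys
differs from that of the simulator by exactly the Module-LWE advantage: fed with real products the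
reduction outputs `hybrid`, fed with uniform ones it has the distribution of the simulator. -/
theorem hvzk (S : Setup P) {k : ℕ} (hk : 72 ≤ k) : HVZK S 1024 k := by
  obtain ⟨Sim, hS1, hS2⟩ := exists_simulator P
  obtain ⟨T, hT1, hT2⟩ := exists_reduction P
  have hpow : P.len ^ 72 ≤ P.len ^ k :=
    Nat.pow_le_pow_right (by have := three_le_len P; omega) hk
  refine ⟨Sim, T, hS1.trans (Nat.mul_le_mul_left _ hpow), hT1.trans (Nat.mul_le_mul_left _ hpow),
    fun x r m ⟨hr, hx, hm⟩ D hD => ?_⟩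
  set H : AuxKey P → ℝ := fun K => (evHybrid S fun g s e z₁ z₂ z₃ => ENNReal.ofReal
    (D K (hybrid x K r (m 2) g e (fun i => K i ⬝ᵥ s) (redV z₁) (redV z₂) (redV z₃)))).toReal with hH
  have hTmem : ∀ M u, 0 ≤ T.expect S (Sum.elim (Sum.elim x fun p => M p.1 p.2)
      (Sum.elim u (Sum.elim r m))) (D M) ∧ T.expect S (Sum.elim (Sum.elim x fun p => M p.1 p.2)
      (Sum.elim u (Sum.elim r m))) (D M) ≤ 1 := fun M u => expect_mem _ _ fun o => hD M _
  have hT : ∀ M u, ENNReal.ofReal (T.expect S (Sum.elim (Sum.elim x fun p => M p.1 p.2)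
      (Sum.elim u (Sum.elim r m))) (D M)) = evMasked S fun g e z₁ z₂ z₃ =>
        ENNReal.ofReal (D M (hybrid x M r (m 2) g e u z₁ z₂ z₃)) := fun M u => by
    rw [TranscriptProg.expect, ofReal_expect _ _ fun o => hD M _]
    exact hT2 S x M u r m fun t => ENNReal.ofReal (D M t)
  have h1 : ∀ M, expect (piPMF fun _ : Fin P.n₁ => (polyPMF S.χ : PMF P.R)) (fun s =>
      T.expect S (Sum.elim (Sum.elim x fun p => M p.1 p.2)
        (Sum.elim (fun i => M i ⬝ᵥ s) (Sum.elim r m))) (D M)) = H M := by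
    intro M
    rw [expect_eq _ _ fun s => (hTmem M _).1]
    simp only [hT, hH]
    rw [ev_hybrid_mlwe S x M r (m 2) fun t => ENNReal.ofReal (D M t)]
  have h2 : ∀ M, expect (piPMF fun _ : Row P => unifPMF P) (fun u =>
      T.expect S (Sum.elim (Sum.elim x fun p => M p.1 p.2)
        (Sum.elim u (Sum.elim r m))) (D M))
      = Sim.expect S (Sum.elim x fun p => M p.1 p.2) (D M) := by
    intro M
    rw [expect_eq _ _ fun u => (hTmem M _).1, TranscriptProg.expect,
      expect_eq _ _ fun o => (hD M _).1]
    simp only [hT]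
    rw [ev_hybrid_uniform S x M r (m 2) hm fun t => ENNReal.ofReal (D M t)]
    exact congrArg _ (hS2 S x M fun t => ENNReal.ofReal (D M t)).symm
  have hmlwe : mlweAdv S (fun M u =>
      T.expect S (Sum.elim (Sum.elim x fun p => M p.1 p.2) (Sum.elim u (Sum.elim r m))) (D M))
      = |expect (auxPMF P) H
        - expect (auxPMF P) fun K => Sim.expect S (Sum.elim x fun p => K p.1 p.2) (D K)| := by
    rw [mlweAdv, expect_congr _ h1, expect_congr _ h2]
  rw [hmlwe]
  have hHmem : ∀ K, 0 ≤ H K ∧ H K ≤ 1 := fun K =>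
    ⟨ENNReal.toReal_nonneg, ENNReal.toReal_le_of_le_ofReal zero_le_one (by
      rw [ENNReal.ofReal_one]
      exact evHybrid_le_one S fun _ _ _ _ _ _ => by simpa using (hD K _).2)⟩
  have hclose := fun K => abs_honestExpect_sub_le S x K r m hr hx (D K) (hD K)
  have h3 := abs_expect_sub_le (auxPMF P) (fun K => ⟨(hclose K).1, (hclose K).2.1⟩) hHmem
    (by positivity) fun K => (hclose K).2.2
  have h4 := abs_sub_le (expect (auxPMF P) fun K => honestExpect S x K r (m 2) (D K))
    (expect (auxPMF P) H)
    (expect (auxPMF P) fun K => Sim.expect S (Sum.elim x fun p => K p.1 p.2) (D K))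
  linarith

end Simulation

end PoA

end

theorem mainTheorem11 :
    ∃ c k D : ℕ, ∀ (P : Params) (S : Setup P), P.NoWrap →
      Complete S ∧ KnowledgeSound S c k D ∧ HVZK S c k := by
  -- `72 = 70 + 2`: formulas of size at most `len ^ 70`, with `len ^ 2` bounding each of the two
  -- families of outputs. The power `8` is `4 + 4`, for the two pairs of transcripts.
  exact ⟨1024, 72, 8, fun _ S hq => ⟨complete S, knowledgeSound S hq (by norm_num), hvzk S le_rfl⟩⟩
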